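/- **Setting.** Let $G=(V,E)$ be an infinite, connected, locally finite graph with graph distance $\mathrm{dist}$, and write $x\sim y$ if $\{x,y\}\in E$. For $r\ge 0$ let $B(x,r)=\{y\in V:\mathrm{dist}(x,y)\le\lfloor r\rfloor\}$. Let $\omega_t(e)\in(0,\infty)$ ($t\in\mathbb R$, $e\in E$) be weights such that $t\mapsto\omega_t(e)$ is measurable for every $e$, and set $$\mathcal L^\omega_t f(x)=\sum_{y\sim x}\omega_t(\{x,y\})\,(f(y)-f(x)),\qquad \mu^\omega_t(x)=\sum_{y\sim x}\omega_t(\{x,y\}),\qquad \nu^\omega_t(x)=\sum_{y\sim x}\frac1{\omega_t(\{x,y\})}.$$ For a finite non-empty $B\subset V$, a compact interval $I$ of positive length $|I|$, and $p,p'\in[1,\infty]$ put $$\|f\|_{p,B}=\Big(\tfrac1{|B|}\sum_{x\in B}|f(x)|^p\Big)^{1/p},\qquad \|u\|_{p,p',I\times B}=\Big(\tfrac1{|I|}\int_I\|u_t\|_{p,B}^{p'}\,dt\Big)^{1/p'},$$ with $\|f\|_{\infty,B}=\max_{B}|f|$ and $\|u\|_{p,\infty,I\times B}=\sup_{t\in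 I}\|u_t\|_{p,B}$. For $t_0\in\mathbb R$, $x_0\in V$ and $r>0$ let $Q(r)=[t_0-r^2,t_0]\times B(x_0,r)$, and let $\operatorname{osc}_Q u=\sup_Q u-\inf_Q u$. **Assumption on the graph.** Let $d'\ge d\ge2$ be real numbers, $c_{\rm reg},C_{\rm reg},C_{\rm S},C_{\rm P}\in(0,\infty)$ and $C_{\rm W}\in[1,\infty)$. For every $x\in V$ there are $N_1(x),N_2(x),N_3(x)\in\mathbb N_0$ such that: (i) $c_{\rm reg}\,n^d\le|B(x,n)|\le C_{\rm reg}\,n^d$ for all integers $n\ge N_1(x)$; (ii) for all integers $n\ge N_2(x)$ and all $u:V\to\mathbb R$ vanishing outside $B(x,n)$, $$\|u\|_{d'/(d'-1),B(x,n)}\le C_{\rm S}\,\frac{n}{|B(x,n)|}\sum_{\{y,z\}\in E}|u(y)-u(z)|;$$ (iii) for all integers $n\ge N_3(x)$, all $u:V\to\mathbb R$ and all non-empty $\mathcal N\subset B(x,n)$, with $(u)_{\mathcal N}=\frac1{|\mathcal N|}\sum_{y\in\mathcal N}u(y)$, $$\sum_{y\in B(x,n)}|u(y)-(u)_{\mathcal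 N}|\le C_{\rm P}\,n\Big(1+\frac{|B(x,n)|}{|\mathcal N|}\Big)\sum_{\substack{y,y'\in B(x,C_{\rm W}n)\\ y\sim y'}}|u(y)-u(y')|,$$ where the last sum runs over ordered pairs $(y,y')$. **Theorem (oscillation inequality).** Let $p,q,q'\in[1,\infty]$ and $p'\in(1,\infty]$ satisfy $$\frac1p\cdot\frac{p'}{p'-1}\cdot\frac{q'+1}{q'}+\frac1q<\frac2{d'}$$ (with $\frac{p'}{p'-1}=1$ if $p'=\infty$, $\frac{q'+1}{q'}=1$ if $q'=\infty$, and $\frac1\infty=0$). There exist $\vartheta\in(0,1/2)$ and a continuous function $\gamma:[0,\infty)^2\to(0,1)$, strictly increasing in each component, depending only on $d,d',c_{\rm reg},C_{\rm reg},C_{\rm S},C_{\rm P},C_{\rm W},p,p',q,q'$, such that the following holds for every graph $G$ satisfying the assumption with these constants and all weights $\omega$ as above. Let $t_0\in\mathbb R$, $x_0\in V$, let $n$ be a real number with $n\ge 2^{8d}\,C_{\rm W}\max\{N_1(x_0),N_2(x_0),N_3(x_0)\}$, and let $u:\mathbb R\times V\to\mathbb R$ be positive on $Q(n)$ and solve $\partial_tu-\mathcal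 L^\omega_tu=0$ on $Q(n)$, in the sense that for each $x\in B(x_0,n)$ the map $t\mapsto u(t,x)$ is absolutely continuous on $[t_0-n^2,t_0]$ and $\partial_tu(t,x)=\mathcal L^\omega_tu(t,\cdot)(x)$ for almost every $t$ in this interval. If $\|1\vee\mu^\omega\|_{p,p',Q(n)}<\infty$ and $\|1\vee\nu^\omega\|_{q,q',Q(n)}<\infty$, then $$\operatorname{osc}_{Q(\vartheta n)}u\le\gamma\big(\|1\vee\mu^\omega\|_{p,p',Q(n)},\,\|1\vee\nu^\omega\|_{q,q',Q(n)}\big)\;\operatorname{osc}_{Q(n)}u.$$ -/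

import Mathlib

open MeasureTheory Set
open scoped ENNReal NNReal

namespace DeGiorgiGraph

variable {V : Type*}

theorem finite_edist_le (G : SimpleGraph V) [G.LocallyFinite] (x : V) (k : ℕ) :
    {y | G.edist x y ≤ (k : ℕ∞)}.Finite := by
  classical
  have hw : ∀ (k : ℕ) (x : V), {y | ∃ p : G.Walk x y, p.length ≤ k}.Finite := by
    intro k
    induction k with
    | zero =>
      intro x
      refine (Set.finite_singleton x).subset ?_
      rintro y ⟨p, hp⟩
      have := SimpleGraph.Walk.eq_of_length_eq_zero (Nat.le_zero.mp hp)
      simp [this]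
    | succ k ih =>
      intro x
      refine (((G.neighborFinset x).finite_toSet.biUnion (fun z _ => ih z)).union
        (Set.finite_singleton x)).subset ?_
      rintro y ⟨p, hp⟩
      cases p with
      | nil => right; simp
      | cons h q =>
        left
        simp only [Set.mem_iUnion]
        refine ⟨_, by simpa using h, q, ?_⟩
        simpa using hp
  refine (hw k x).subset ?_
  intro y hy
  have hy' : G.edist x y ≤ (k : ℕ∞) := hy
  obtain ⟨p, hp⟩ := SimpleGraph.exists_walk_of_edist_ne_top
    (ne_top_of_le_ne_top (ENat.natCast_ne_top k) hy')
  refine ⟨p, ?_⟩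
  rw [← hp] at hy'
  exact_mod_cast hy'

/-- The closed ball `B(x, r)`: the vertices at graph distance at most `⌊r⌋` from `x`. -/
noncomputable def ball (G : SimpleGraph V) [G.LocallyFinite] (x : V) (r : ℝ) : Finset V :=
  (finite_edist_le G x ⌊r⌋₊).toFinset

/-- Time-dependent weights, indexed by time and by unordered pairs; only the values on edges are
constrained or used. On every edge they are positive at all times and measurable in time. -/
structure IsWeight (G : SimpleGraph V) (ω : ℝ → Sym2 V → ℝ) : Prop where
  pos : ∀ t, ∀ e ∈ G.edgeSet, 0 < ω t e
  meas : ∀ e ∈ G.edgeSet, Measurable fun t => ω t e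

/-- The operator `(L_t f)(x) = ∑_{y ∼ x} ω_t({x, y}) (f(y) - f(x))`, with `w = ω_t`. -/
noncomputable def generator (G : SimpleGraph V) [G.LocallyFinite] (w : Sym2 V → ℝ) (f : V → ℝ)
    (x : V) : ℝ :=
  ∑ y ∈ G.neighborFinset x, w s(x, y) * (f y - f x)

/-- `μ(x) = ∑_{y ∼ x} w({x, y})`. -/
noncomputable def mu (G : SimpleGraph V) [G.LocallyFinite] (w : Sym2 V → ℝ) (x : V) : ℝ :=
  ∑ y ∈ G.neighborFinset x, w s(x, y)

/-- `ν(x) = ∑_{y ∼ x} 1 / w({x, y})`. -/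
noncomputable def nu (G : SimpleGraph V) [G.LocallyFinite] (w : Sym2 V → ℝ) (x : V) : ℝ :=
  ∑ y ∈ G.neighborFinset x, 1 / w s(x, y)

/-- The space-averaged norm `‖f‖_{p,B}`; for `p = ∞` it is the maximum over `B`. -/
noncomputable def spaceNorm (p : ℝ≥0∞) (B : Finset V) (f : V → ℝ) : ℝ :=
  if p = ∞ then ⨆ x : B, |f x|
  else (1 / (B.card : ℝ) * ∑ x ∈ B, |f x| ^ p.toReal) ^ (1 / p.toReal)

/-- The space-time-averaged norm `‖u‖_{p,p',I×B}`, with values in `[0, ∞]`; for `p' = ∞` it is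
the supremum over the times in `I`. -/
noncomputable def spaceTimeNorm (p p' : ℝ≥0∞) (I : Set ℝ) (B : Finset V) (u : ℝ → V → ℝ) :
    ℝ≥0∞ :=
  if p' = ∞ then ⨆ t ∈ I, ENNReal.ofReal (spaceNorm p B (u t))
  else ((volume I)⁻¹ * ∫⁻ t in I, ENNReal.ofReal (spaceNorm p B (u t)) ^ p'.toReal)
    ^ (1 / p'.toReal)

/-- `|∇u(e)|` for an unoriented edge `e`. -/
def absGrad (u : V → ℝ) : Sym2 V → ℝ :=
  Sym2.lift ⟨fun a b => |u a - u b|, fun a b => abs_sub_comm (u a) (u b)⟩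

/-- The average of `u` over a finite set `N`. -/
noncomputable def average (N : Finset V) (u : V → ℝ) : ℝ :=
  1 / (N.card : ℝ) * ∑ y ∈ N, u y

open Classical in
/-- Volume regularity of order `d`, Sobolev inequality of dimension `d'` and weak Poincaré
inequality around each vertex `x` for radii above `N₁ x`, `N₂ x`, `N₃ x` respectively. -/
structure RegularGraph (G : SimpleGraph V) [G.LocallyFinite]
    (d d' creg Creg CS CP CW : ℝ) (N₁ N₂ N₃ : V → ℕ) : Prop where
  volume_reg : ∀ x : V, ∀ n : ℕ, N₁ x ≤ n →
    creg * (n : ℝ) ^ d ≤ ((ball G x n).card : ℝ) ∧ ((ball G x n).card : ℝ) ≤ Creg * (n : ℝ) ^ d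
  sobolev : ∀ x : V, ∀ n : ℕ, N₂ x ≤ n → ∀ u : V → ℝ, (∀ y ∉ ball G x n, u y = 0) →
    spaceNorm (ENNReal.ofReal (d' / (d' - 1))) (ball G x n) u ≤
      CS * ((n : ℝ) / ((ball G x n).card : ℝ)) * ∑' e : G.edgeSet, absGrad u e
  poincare : ∀ x : V, ∀ n : ℕ, N₃ x ≤ n → ∀ u : V → ℝ, ∀ N : Finset V, N.Nonempty →
    N ⊆ ball G x n →
    ∑ y ∈ ball G x n, |u y - average N u| ≤
      CP * (n : ℝ) * (1 + ((ball G x n).card : ℝ) / (N.card : ℝ)) *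
        ∑ y ∈ ball G x (CW * n), ∑ y' ∈ ball G x (CW * n) with G.Adj y y', |u y - u y'|

/-- `∂_t u - L_t u = 0` on `[a, b] × B`: for each `x ∈ B` the function `u(·, x)` is absolutely
continuous on `[a, b]` and the equation holds at almost every time. (The weights are only
measurable in time, so a solution need not be differentiable at every time.) -/
def SolvesHeat (G : SimpleGraph V) [G.LocallyFinite] (ω : ℝ → Sym2 V → ℝ) (a b : ℝ)
    (B : Finset V) (u : ℝ → V → ℝ) : Prop :=
  ∀ x ∈ B, AbsolutelyContinuousOnInterval (fun t => u t x) a b ∧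
    ∀ᵐ t ∂(volume.restrict (Icc a b)),
      HasDerivAt (fun s => u s x) (generator G (ω t) (u t) x) t

/-- The space-time cylinder `Q(r) = [t₀ - r², t₀] × B(x₀, r)`. -/
def cylinder (G : SimpleGraph V) [G.LocallyFinite] (t₀ : ℝ) (x₀ : V) (r : ℝ) : Set (ℝ × V) :=
  Icc (t₀ - r ^ 2) t₀ ×ˢ (ball G x₀ r : Set V)

/-- The oscillation of `u` over `Q`. -/
noncomputable def osc (Q : Set (ℝ × V)) (u : ℝ → V → ℝ) : ℝ :=
  sSup ((fun z : ℝ × V => u z.1 z.2) '' Q) - sInf ((fun z : ℝ × V => u z.1 z.2) '' Q)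

/-- `‖1 ∨ μ^ω‖_{p,p',Q(n)}`. -/
noncomputable def muNorm (G : SimpleGraph V) [G.LocallyFinite] (ω : ℝ → Sym2 V → ℝ)
    (p p' : ℝ≥0∞) (t₀ : ℝ) (x₀ : V) (n : ℝ) : ℝ≥0∞ :=
  spaceTimeNorm p p' (Icc (t₀ - n ^ 2) t₀) (ball G x₀ n) fun t x => max 1 (mu G (ω t) x)

/-- `‖1 ∨ ν^ω‖_{q,q',Q(n)}`. -/
noncomputable def nuNorm (G : SimpleGraph V) [G.LocallyFinite] (ω : ℝ → Sym2 V → ℝ)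
    (q q' : ℝ≥0∞) (t₀ : ℝ) (x₀ : V) (n : ℝ) : ℝ≥0∞ :=
  spaceTimeNorm q q' (Icc (t₀ - n ^ 2) t₀) (ball G x₀ n) fun t x => max 1 (nu G (ω t) x)

end DeGiorgiGraph

namespace DeGiorgiGraph

variable {V : Type*}

theorem AbsolutelyContinuousOnInterval.lipschitzOn_comp {f φ : ℝ → ℝ} {a b : ℝ} {J : Set ℝ}
    {K : ℝ≥0} (hφ : LipschitzOnWith K φ J) (hf : AbsolutelyContinuousOnInterval f a b)
    (hJ : ∀ t ∈ uIcc a b, f t ∈ J) :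
    AbsolutelyContinuousOnInterval (fun t => φ (f t)) a b := by
  unfold AbsolutelyContinuousOnInterval at hf ⊢
  refine squeeze_zero' (Filter.Eventually.of_forall fun E =>
    Finset.sum_nonneg fun i _ => dist_nonneg) ?_ (by simpa using hf.const_mul (K : ℝ))
  refine Filter.eventually_inf_principal.2 (Filter.Eventually.of_forall fun E hE => ?_)
  rw [Finset.mul_sum]
  exact Finset.sum_le_sum fun i hi =>
    hφ.dist_le_mul _ (hJ _ (hE.1 i hi).1) _ (hJ _ (hE.1 i hi).2)

theorem AbsolutelyContinuousOnInterval.finset_sum {ι : Type*} (s : Finset ι) {f : ι → ℝ → ℝ}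
    {a b : ℝ} (hf : ∀ i ∈ s, AbsolutelyContinuousOnInterval (f i) a b) :
    AbsolutelyContinuousOnInterval (fun t => ∑ i ∈ s, f i t) a b := by
  classical
  induction s using Finset.induction_on with
  | empty =>
    have : LipschitzOnWith 0 (fun _ : ℝ => (0 : ℝ)) (uIcc a b) :=
      (LipschitzWith.const 0).lipschitzOnWith
    simpa using this.absolutelyContinuousOnInterval
  | insert i s hi ih =>
    have h1 := (hf i (Finset.mem_insert_self i s)).add
      (ih fun j hj => hf j (Finset.mem_insert_of_mem hj))
    simpa [Finset.sum_insert hi, Pi.add_def] using h1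

open Classical in
/-- The conductance `w({x, y})` of the pair `x, y`, set to `0` off the edges. -/
noncomputable def conductance (G : SimpleGraph V) (w : Sym2 V → ℝ) (x y : V) : ℝ :=
  if G.Adj x y then w s(x, y) else 0

theorem conductance_comm (G : SimpleGraph V) (w : Sym2 V → ℝ) (x y : V) :
    conductance G w x y = conductance G w y x := by
  unfold conductance
  rw [Sym2.eq_swap]
  by_cases h : G.Adj x y
  · rw [if_pos h, if_pos h.symm]
  · rw [if_neg h, if_neg fun h' => h h'.symm]

theorem sum_mul_sub_eq_neg_half {B : Finset V} {c : V → V → ℝ} (hc : ∀ x y, c x y = c y x)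
    (ψ u : V → ℝ) :
    ∑ x ∈ B, ψ x * ∑ y ∈ B, c x y * (u y - u x) =
      -(1 / 2) * ∑ x ∈ B, ∑ y ∈ B, c x y * ((u y - u x) * (ψ y - ψ x)) := by
  have h1 : ∑ x ∈ B, ψ x * ∑ y ∈ B, c x y * (u y - u x) =
      ∑ x ∈ B, ∑ y ∈ B, c x y * ((u y - u x) * ψ x) := by
    simp_rw [Finset.mul_sum]
    exact Finset.sum_congr rfl fun x _ => Finset.sum_congr rfl fun y _ => by ring
  have h2 : ∑ x ∈ B, ∑ y ∈ B, c x y * ((u y - u x) * ψ x) =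
      -∑ x ∈ B, ∑ y ∈ B, c x y * ((u y - u x) * ψ y) := by
    rw [Finset.sum_comm, ← Finset.sum_neg_distrib]
    refine Finset.sum_congr rfl fun x _ => ?_
    rw [← Finset.sum_neg_distrib]
    exact Finset.sum_congr rfl fun y _ => by rw [hc y x]; ring
  have h3 : ∑ x ∈ B, ∑ y ∈ B, c x y * ((u y - u x) * (ψ y - ψ x)) =
      ∑ x ∈ B, ∑ y ∈ B, c x y * ((u y - u x) * ψ y) -
        ∑ x ∈ B, ∑ y ∈ B, c x y * ((u y - u x) * ψ x) := by
    rw [← Finset.sum_sub_distrib]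
    refine Finset.sum_congr rfl fun x _ => ?_
    rw [← Finset.sum_sub_distrib]
    exact Finset.sum_congr rfl fun y _ => by ring
  rw [h1, h3]
  linarith

theorem truncation_edge_inequality (l a b α β : ℝ) :
    (b - a) * (β ^ 2 * max (l - b) 0 - α ^ 2 * max (l - a) 0) ≤
      max (l - a) 0 * max (l - b) 0 * (β - α) ^ 2 -
        (β * max (l - b) 0 - α * max (l - a) 0) ^ 2 := by
  rcases le_total (l - a) 0 with ha | ha <;> rcases le_total (l - b) 0 with hb | hb <;>
    simp only [max_eq_right ha, max_eq_left ha, max_eq_right hb, max_eq_left hb]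
  · simp
  · nlinarith [mul_nonneg (mul_nonneg hb (sub_nonneg.2 (sub_nonpos.1 ha))) (sq_nonneg β)]
  · nlinarith [mul_nonneg (mul_nonneg ha (sub_nonneg.2 (sub_nonpos.1 hb))) (sq_nonneg α)]
  · apply le_of_eq; ring

theorem two_sub_exp_sub_exp_neg_le (s : ℝ) : 2 - Real.exp s - Real.exp (-s) ≤ -s ^ 2 := by
  have h1 : (s / 2) ^ 2 ≤ Real.sinh (s / 2) ^ 2 := by
    rw [sq_le_sq]
    rcases le_total 0 (s / 2) with h | h
    · rw [abs_of_nonneg h, abs_of_nonneg (h.trans (Real.self_le_sinh_iff.2 h))]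
      exact Real.self_le_sinh_iff.2 h
    · rw [abs_of_nonpos h, abs_of_nonpos ((Real.sinh_le_self_iff.2 h).trans h)]
      exact neg_le_neg (Real.sinh_le_self_iff.2 h)
  have h2 := Real.cosh_two_mul (s / 2)
  rw [Real.cosh_sq, mul_div_cancel₀ s two_ne_zero, Real.cosh_eq] at h2
  linarith

theorem log_edge_inequality_of_le {a b α β : ℝ} (ha : 0 < a) (hb : 0 < b) (hα : 0 ≤ α)
    (hαβ : α ≤ β) :
    (b - a) * (β ^ 2 / b - α ^ 2 / a) ≤
      5 * (β - α) ^ 2 - 1 / 2 * (α ^ 2 * (Real.log b - Real.log a) ^ 2) := by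
  set s := Real.log b - Real.log a with hs
  have hr : Real.exp s = b / a := by
    rw [hs, Real.exp_sub, Real.exp_log hb, Real.exp_log ha]
  have hr' : Real.exp (-s) = a / b := by rw [Real.exp_neg, hr, inv_div]
  have h1 : (b - a) * (β ^ 2 / b - α ^ 2 / a) =
      α ^ 2 * (2 - Real.exp s - Real.exp (-s)) + (β ^ 2 - α ^ 2) * (1 - Real.exp (-s)) := by
    rw [hr, hr']; field_simp; ring
  have h2 := mul_le_mul_of_nonneg_left (two_sub_exp_sub_exp_neg_le s) (sq_nonneg α)
  have hβα : 0 ≤ β ^ 2 - α ^ 2 := by nlinarith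
  have h3 : (β ^ 2 - α ^ 2) * (1 - Real.exp (-s)) ≤
      1 / 2 * (α ^ 2 * s ^ 2) + 5 * (β - α) ^ 2 := by
    rcases le_or_gt s 0 with hs0 | hs0
    · have : 1 - Real.exp (-s) ≤ 0 := by
        have := Real.one_le_exp (neg_nonneg.2 hs0); linarith
      have := mul_nonpos_of_nonneg_of_nonpos hβα this
      have : 0 ≤ 1 / 2 * (α ^ 2 * s ^ 2) + 5 * (β - α) ^ 2 := by positivity
      linarith
    · have e1 : 1 - Real.exp (-s) ≤ 1 := by have := Real.exp_pos (-s); linarith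
      have e2 : 1 - Real.exp (-s) ≤ s := by have := Real.add_one_le_exp (-s); linarith
      have := mul_le_mul_of_nonneg_left e1 hβα
      have := mul_le_mul_of_nonneg_left e2 hβα
      rcases le_total (2 * α) β with h | h
      · nlinarith [sq_nonneg (α * s)]
      · have h4 : (β ^ 2 - α ^ 2) * s ≤ 3 * (β - α) * (α * s) := by
          have : (β - α) * (β + α) * s ≤ (β - α) * (3 * α) * s :=
            mul_le_mul_of_nonneg_right
              (mul_le_mul_of_nonneg_left (by linarith) (by linarith)) hs0.le
          nlinarith
        nlinarith [sq_nonneg (α * s - 3 * (β - α)), sq_nonneg (β - α)]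
  rw [h1]
  linarith

theorem log_edge_inequality {a b α β : ℝ} (ha : 0 < a) (hb : 0 < b) (hα : 0 ≤ α) (hβ : 0 ≤ β) :
    (b - a) * (β ^ 2 / b - α ^ 2 / a) ≤
      5 * (β - α) ^ 2 - 1 / 2 * (min α β ^ 2 * (Real.log b - Real.log a) ^ 2) := by
  rcases le_total α β with h | h
  · rw [min_eq_left h]; exact log_edge_inequality_of_le ha hb hα h
  · rw [min_eq_right h]
    have := log_edge_inequality_of_le hb ha hβ h
    nlinarith

/-- `u` solves the heat equation on `[a, b]` at the points of `D`, where only the conductances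
between points of `B` enter. It is continuous at all times at the points of `B`. -/
structure IsCaloric (B D : Finset V) (c : ℝ → V → V → ℝ) (a b : ℝ) (u : ℝ → V → ℝ) : Prop where
  sub : D ⊆ B
  symm : ∀ t x y, c t x y = c t y x
  nonneg : ∀ t x y, 0 ≤ c t x y
  integrable : ∀ x ∈ B, ∀ y ∈ B, IntegrableOn (fun t => c t x y) (Icc a b)
  cont : ∀ x ∈ B, Continuous fun t => u t x
  ac : ∀ x ∈ B, AbsolutelyContinuousOnInterval (fun t => u t x) a b
  eqn : ∀ x ∈ D, ∀ᵐ t ∂(volume.restrict (Icc a b)),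
    HasDerivAt (fun s => u s x) (∑ y ∈ B, c t x y * (u t y - u t x)) t

theorem IsCaloric.affine {B D : Finset V} {c : ℝ → V → V → ℝ} {a b : ℝ} {u : ℝ → V → ℝ}
    (h : IsCaloric B D c a b u) (α β : ℝ) :
    IsCaloric B D c a b fun t x => α * u t x + β where
  sub := h.sub
  symm := h.symm
  nonneg := h.nonneg
  integrable := h.integrable
  cont x hx := by have := h.cont x hx; fun_prop
  ac x hx := by
    have h1 := (h.ac x hx).const_mul α
    have : LipschitzOnWith 0 (fun _ : ℝ => β) (uIcc a b) :=
      (LipschitzWith.const β).lipschitzOnWith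
    simpa [Pi.add_def] using h1.add this.absolutelyContinuousOnInterval
  eqn x hx := by
    filter_upwards [h.eqn x hx] with t ht
    have e : ∑ y ∈ B, c t x y * (α * u t y + β - (α * u t x + β)) =
        α * ∑ y ∈ B, c t x y * (u t y - u t x) := by
      rw [Finset.mul_sum]
      exact Finset.sum_congr rfl fun y _ => by ring
    rw [e]
    exact (ht.const_mul α).add_const β

theorem IsCaloric.intervalIntegrable_sum {B D : Finset V} {c : ℝ → V → V → ℝ} {a b : ℝ}
    {u : ℝ → V → ℝ} (h : IsCaloric B D c a b u) {F : ℝ → V → V → ℝ}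
    (hF : ∀ x ∈ B, ∀ y ∈ B, Continuous fun t => F t x y) {s t : ℝ} (hs : s ∈ Icc a b)
    (ht : t ∈ Icc a b) :
    IntervalIntegrable (fun r => ∑ x ∈ B, ∑ y ∈ B, c r x y * F r x y) volume s t := by
  have key := fun (x : V) (hx : x ∈ B) (y : V) (hy : y ∈ B) =>
    show IntervalIntegrable (fun r => c r x y * F r x y) volume s t from ?_
  · have := IntervalIntegrable.sum B fun x hx => IntervalIntegrable.sum B fun y hy => key x hx y hy
    simpa only [Finset.sum_fn] using this
  refine IntervalIntegrable.mul_continuousOn ?_ (hF x hx y hy).continuousOn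
  refine IntegrableOn.intervalIntegrable ((h.integrable x hx y hy).mono_set ?_)
  exact uIcc_subset_Icc hs ht

/-- The energy identity: the time derivative of `∑ η² φ(u)` and its integrated form. -/
theorem IsCaloric.energy_identity {B D : Finset V} {c : ℝ → V → V → ℝ} {a b : ℝ}
    {u : ℝ → V → ℝ} (h : IsCaloric B D c a b u) {η : V → ℝ} (hη : ∀ x ∉ D, η x = 0)
    {φ φ' : ℝ → ℝ} {J : Set ℝ} {K : ℝ≥0} (hφ : ∀ r ∈ J, HasDerivAt φ (φ' r) r)
    (hL : LipschitzOnWith K φ J) (hJ : ∀ t ∈ Icc a b, ∀ x ∈ B, u t x ∈ J) {s t : ℝ}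
    (hs : s ∈ Icc a b) (ht : t ∈ Icc a b) (hst : s ≤ t) :
    ∑ x ∈ B, η x ^ 2 * φ (u t x) - ∑ x ∈ B, η x ^ 2 * φ (u s x) =
      ∫ r in s..t, -(1 / 2) * ∑ x ∈ B, ∑ y ∈ B, c r x y *
        ((u r y - u r x) * (η y ^ 2 * φ' (u r y) - η x ^ 2 * φ' (u r x))) := by
  have hsub : Icc s t ⊆ Icc a b := Icc_subset_Icc hs.1 ht.2
  have hab : a ≤ b := hs.1.trans hs.2
  have hac : AbsolutelyContinuousOnInterval (fun r => ∑ x ∈ B, η x ^ 2 * φ (u r x)) s t := by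
    refine AbsolutelyContinuousOnInterval.finset_sum B fun x hx => ?_
    refine AbsolutelyContinuousOnInterval.const_mul _ ?_
    refine AbsolutelyContinuousOnInterval.lipschitzOn_comp hL ((h.ac x hx).mono ?_) ?_
    · rwa [uIcc_of_le hst, uIcc_of_le hab]
    · rw [uIcc_of_le hst]
      exact fun r hr => hJ r (hsub hr) x hx
  rw [← hac.integral_deriv_eq_sub]
  refine intervalIntegral.integral_congr_ae ?_
  have hall : ∀ᵐ r ∂(volume.restrict (Icc a b)), ∀ x ∈ D,
      HasDerivAt (fun s => u s x) (∑ y ∈ B, c r x y * (u r y - u r x)) r :=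
    (Filter.eventually_all_finset D).2 h.eqn
  rw [ae_restrict_iff' measurableSet_Icc] at hall
  filter_upwards [hall] with r hr hrI
  rw [uIoc_of_le hst] at hrI
  have hrI' : r ∈ Icc a b := hsub (Ioc_subset_Icc_self hrI)
  have hd : HasDerivAt (fun r => ∑ x ∈ B, η x ^ 2 * φ (u r x))
      (∑ x ∈ B, η x ^ 2 * φ' (u r x) * ∑ y ∈ B, c r x y * (u r y - u r x)) r := by
    refine HasDerivAt.fun_sum fun x hx => ?_
    by_cases hxD : x ∈ D
    · have := ((hφ _ (hJ r hrI' x hx)).comp r (hr hrI' x hxD)).const_mul (η x ^ 2)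
      simpa only [mul_assoc, Function.comp_def] using this
    · simpa [hη x hxD] using hasDerivAt_const r (0 : ℝ)
  rw [hd.deriv, sum_mul_sub_eq_neg_half (h.symm r) (fun x => η x ^ 2 * φ' (u r x))]

theorem hasDerivAt_half_sq_max (l r : ℝ) :
    HasDerivAt (fun r : ℝ => 1 / 2 * max (l - r) 0 ^ 2) (-max (l - r) 0) r := by
  rcases lt_trichotomy r l with h | h | h
  · have h1 : HasDerivAt (fun r : ℝ => 1 / 2 * (l - r) ^ 2) (-(l - r)) r := by
      have := ((((hasDerivAt_id r).const_sub l).pow 2).const_mul (1 / 2 : ℝ))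
      refine this.congr_deriv ?_
      simp
    rw [max_eq_left (by linarith)]
    refine h1.congr_of_eventuallyEq ?_
    filter_upwards [Iio_mem_nhds h] with y hy
    rw [max_eq_left (by linarith [mem_Iio.1 hy])]
  · subst h
    rw [sub_self, max_self, neg_zero, hasDerivAt_iff_isLittleO]
    simp only [sub_self, max_self, smul_zero, sub_zero, ne_eq, OfNat.ofNat_ne_zero,
      not_false_eq_true, zero_pow, mul_zero]
    refine Asymptotics.IsBigO.trans_isLittleO (g := fun y => (y - r) ^ 2) ?_ ?_
    · refine Asymptotics.IsBigO.of_bound 1 (Filter.Eventually.of_forall fun y => ?_)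
      have h1 : max (r - y) 0 ^ 2 ≤ (y - r) ^ 2 := by
        rcases le_total (r - y) 0 with h | h
        · rw [max_eq_right h]; simpa using sq_nonneg (y - r)
        · rw [max_eq_left h]; nlinarith
      rw [Real.norm_of_nonneg (by positivity), Real.norm_of_nonneg (by positivity)]
      nlinarith [sq_nonneg (max (r - y) 0)]
    · have := (Asymptotics.isLittleO_pow_id (𝕜 := ℝ) (n := 2) one_lt_two).comp_tendsto
        (k := fun y => y - r) (l' := nhds r) (by
          have : Filter.Tendsto (fun y : ℝ => y - r) (nhds r) (nhds (r - r)) :=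
            (continuous_id.sub continuous_const).tendsto r
          simpa using this)
      simpa [Function.comp_def] using this
  · rw [max_eq_right (by linarith), neg_zero]
    refine (hasDerivAt_const r (0 : ℝ)).congr_of_eventuallyEq ?_
    filter_upwards [Ioi_mem_nhds h] with y hy
    rw [max_eq_right (by linarith [mem_Ioi.1 hy])]
    simp

theorem lipschitzOnWith_of_hasDerivAt_le {φ φ' : ℝ → ℝ} {J : Set ℝ} (hJ : Convex ℝ J) {K : ℝ≥0}
    (hφ : ∀ r ∈ J, HasDerivAt φ (φ' r) r) (hK : ∀ r ∈ J, |φ' r| ≤ K) : LipschitzOnWith K φ J :=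
  hJ.lipschitzOnWith_of_nnnorm_hasDerivWithin_le (fun r hr => (hφ r hr).hasDerivWithinAt)
    fun r hr => by
      rw [← NNReal.coe_le_coe, coe_nnnorm, Real.norm_eq_abs]; exact hK r hr

theorem IsCaloric.caccioppoli {B D : Finset V} {c : ℝ → V → V → ℝ} {a b : ℝ}
    {u : ℝ → V → ℝ} (h : IsCaloric B D c a b u) {η : V → ℝ} (hη : ∀ x ∉ D, η x = 0)
    (hu : ∀ t ∈ Icc a b, ∀ x ∈ B, 0 ≤ u t x) (l : ℝ) {s t : ℝ}
    (hs : s ∈ Icc a b) (ht : t ∈ Icc a b) (hst : s ≤ t) :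
    1 / 2 * ∑ x ∈ B, (η x * max (l - u t x) 0) ^ 2 +
        ∫ r in s..t, 1 / 2 * ∑ x ∈ B, ∑ y ∈ B, c r x y *
          (η y * max (l - u r y) 0 - η x * max (l - u r x) 0) ^ 2 ≤
      1 / 2 * ∑ x ∈ B, (η x * max (l - u s x) 0) ^ 2 +
        ∫ r in s..t, 1 / 2 * ∑ x ∈ B, ∑ y ∈ B, c r x y *
          (max (l - u r x) 0 * max (l - u r y) 0 * (η y - η x) ^ 2) := by
  have hmax : ∀ x ∈ B, Continuous fun t => max (l - u t x) 0 := fun x hx => by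
    have := h.cont x hx; fun_prop
  have hLip : LipschitzOnWith (Real.toNNReal |l|) (fun r : ℝ => 1 / 2 * max (l - r) 0 ^ 2)
      (Ici 0) :=
    lipschitzOnWith_of_hasDerivAt_le (convex_Ici 0) (fun r _ => hasDerivAt_half_sq_max l r)
      fun r hr => by
        rw [abs_neg, abs_of_nonneg (le_max_right _ _), Real.coe_toNNReal _ (abs_nonneg _)]
        exact max_le (by linarith [le_abs_self l, mem_Ici.1 hr]) (abs_nonneg _)
  have hid := h.energy_identity hη (fun r _ => hasDerivAt_half_sq_max l r) hLip hu hs ht hst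
  have e : ∀ t, 1 / 2 * ∑ x ∈ B, (η x * max (l - u t x) 0) ^ 2 =
      ∑ x ∈ B, η x ^ 2 * (1 / 2 * max (l - u t x) 0 ^ 2) := fun t => by
    rw [Finset.mul_sum]
    exact Finset.sum_congr rfl fun x _ => by ring
  have i1 : IntervalIntegrable (fun r => 1 / 2 * ∑ x ∈ B, ∑ y ∈ B, c r x y *
          (η y * max (l - u r y) 0 - η x * max (l - u r x) 0) ^ 2) volume s t :=
    (h.intervalIntegrable_sum (fun x hx y hy => by
      have := hmax x hx; have := hmax y hy; fun_prop) hs ht).const_mul _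
  have i2 : IntervalIntegrable (fun r => 1 / 2 * ∑ x ∈ B, ∑ y ∈ B, c r x y *
          (max (l - u r x) 0 * max (l - u r y) 0 * (η y - η x) ^ 2)) volume s t :=
    (h.intervalIntegrable_sum (fun x hx y hy => by
      have := hmax x hx; have := hmax y hy; fun_prop) hs ht).const_mul _
  have i3 : IntervalIntegrable (fun r => -(1 / 2) * ∑ x ∈ B, ∑ y ∈ B, c r x y *
        ((u r y - u r x) * (η y ^ 2 * -max (l - u r y) 0 - η x ^ 2 * -max (l - u r x) 0)))
        volume s t :=
    (h.intervalIntegrable_sum (fun x hx y hy => by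
      have := hmax x hx; have := hmax y hy
      have := h.cont x hx; have := h.cont y hy
      fun_prop) hs ht).const_mul _
  have key := intervalIntegral.integral_mono_on hst i3 (i2.sub i1) fun r _ => by
    rw [← mul_sub, ← Finset.sum_sub_distrib, neg_mul, ← mul_neg, ← Finset.sum_neg_distrib]
    refine mul_le_mul_of_nonneg_left (Finset.sum_le_sum fun x _ => ?_) (by norm_num)
    rw [← Finset.sum_sub_distrib, ← Finset.sum_neg_distrib]
    refine Finset.sum_le_sum fun y _ => ?_
    rw [← mul_sub, ← mul_neg]
    refine mul_le_mul_of_nonneg_left ?_ (h.nonneg r x y)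
    have := truncation_edge_inequality l (u r x) (u r y) (η x) (η y)
    linarith
  rw [intervalIntegral.integral_sub i2 i1] at key
  rw [e, e]
  linarith

theorem IsCaloric.log_estimate {B D : Finset V} {c : ℝ → V → V → ℝ} {a b : ℝ}
    {u : ℝ → V → ℝ} (h : IsCaloric B D c a b u) {η : V → ℝ} (hη : ∀ x ∉ D, η x = 0)
    (hη0 : ∀ x, 0 ≤ η x) {ε : ℝ} (hε : 0 < ε) (hu : ∀ t ∈ Icc a b, ∀ x ∈ B, ε ≤ u t x) {s t : ℝ}
    (hs : s ∈ Icc a b) (ht : t ∈ Icc a b) (hst : s ≤ t) :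
    ∑ x ∈ B, η x ^ 2 * -Real.log (u t x) +
        ∫ r in s..t, 1 / 4 * ∑ x ∈ B, ∑ y ∈ B, c r x y *
          (min (η x) (η y) ^ 2 *
            (Real.log (max ε (u r y)) - Real.log (max ε (u r x))) ^ 2) ≤
      ∑ x ∈ B, η x ^ 2 * -Real.log (u s x) +
        ∫ r in s..t, 5 / 2 * ∑ x ∈ B, ∑ y ∈ B, c r x y * (η y - η x) ^ 2 := by
  have hlog : ∀ x ∈ B, Continuous fun t => Real.log (max ε (u t x)) := fun x hx => by
    have := h.cont x hx
    exact Continuous.log (by fun_prop) fun t => (lt_max_of_lt_left hε).ne'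
  have hder : ∀ r ∈ Ici ε, HasDerivAt (fun r => -Real.log r) (-r⁻¹) r := fun r hr =>
    (Real.hasDerivAt_log (hε.trans_le hr).ne').neg
  have hLip : LipschitzOnWith (Real.toNNReal ε⁻¹) (fun r : ℝ => -Real.log r) (Ici ε) :=
    lipschitzOnWith_of_hasDerivAt_le (convex_Ici ε) hder fun r hr => by
        have hr0 : 0 < r := hε.trans_le hr
        rw [abs_neg, abs_of_pos (inv_pos.2 hr0), Real.coe_toNNReal _ (inv_pos.2 hε).le]
        exact inv_anti₀ hε hr
  have hid := h.energy_identity hη hder hLip hu hs ht hst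
  have i1 : IntervalIntegrable (fun r => 1 / 4 * ∑ x ∈ B, ∑ y ∈ B, c r x y *
          (min (η x) (η y) ^ 2 *
            (Real.log (max ε (u r y)) - Real.log (max ε (u r x))) ^ 2)) volume s t :=
    (h.intervalIntegrable_sum (fun x hx y hy => by
      have := hlog x hx; have := hlog y hy; fun_prop) hs ht).const_mul _
  have i2 : IntervalIntegrable (fun r => 5 / 2 * ∑ x ∈ B, ∑ y ∈ B, c r x y *
          (η y - η x) ^ 2) volume s t :=
    (h.intervalIntegrable_sum (fun x hx y hy => by fun_prop) hs ht).const_mul _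
  have i3 : IntervalIntegrable (fun r => -(1 / 2) * ∑ x ∈ B, ∑ y ∈ B, c r x y *
        ((u r y - u r x) * (η y ^ 2 * -(u r y)⁻¹ - η x ^ 2 * -(u r x)⁻¹)))
        volume s t := by
    refine IntervalIntegrable.congr (f := fun r => -(1 / 2) * ∑ x ∈ B, ∑ y ∈ B, c r x y *
        ((u r y - u r x) * (η y ^ 2 * -(max ε (u r y))⁻¹ - η x ^ 2 * -(max ε (u r x))⁻¹))) ?_ ?_
    · intro r hr
      have hr' : r ∈ Icc a b := uIcc_subset_Icc hs ht (uIoc_subset_uIcc hr)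
      simp only
      congr 1
      refine Finset.sum_congr rfl fun x hx => Finset.sum_congr rfl fun y hy => ?_
      rw [max_eq_right (hu r hr' x hx), max_eq_right (hu r hr' y hy)]
    · refine (h.intervalIntegrable_sum (fun x hx y hy => ?_) hs ht).const_mul _
      have := h.cont x hx
      have := h.cont y hy
      have hinv : ∀ z ∈ B, Continuous fun t => (max ε (u t z))⁻¹ := fun z hz => by
        have := h.cont z hz
        exact Continuous.inv₀ (by fun_prop) fun t => (lt_max_of_lt_left hε).ne'
      have := hinv x hx
      have := hinv y hy
      fun_prop
  have key := intervalIntegral.integral_mono_on hst i3 (i2.sub i1) fun r hr => by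
    have hr' : r ∈ Icc a b := ⟨hs.1.trans hr.1, hr.2.trans ht.2⟩
    simp only [Finset.mul_sum]
    rw [← Finset.sum_sub_distrib]
    refine Finset.sum_le_sum fun x hx => ?_
    rw [← Finset.sum_sub_distrib]
    refine Finset.sum_le_sum fun y hy => ?_
    rw [max_eq_right (hu r hr' x hx), max_eq_right (hu r hr' y hy)]
    have := mul_le_mul_of_nonneg_left (log_edge_inequality (hε.trans_le (hu r hr' x hx))
      (hε.trans_le (hu r hr' y hy)) (hη0 x) (hη0 y)) (h.nonneg r x y)
    simp only [div_eq_mul_inv] at this ⊢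
    linarith
  rw [intervalIntegral.integral_sub i2 i1] at key
  linarith

theorem conductance_nonneg {G : SimpleGraph V} {w : Sym2 V → ℝ} (hw : ∀ e ∈ G.edgeSet, 0 < w e)
    (x y : V) : 0 ≤ conductance G w x y := by
  unfold conductance
  split_ifs with h
  · exact (hw _ h).le
  · exact le_rfl

theorem conductance_le_mu {G : SimpleGraph V} [G.LocallyFinite] {w : Sym2 V → ℝ}
    (hw : ∀ e ∈ G.edgeSet, 0 < w e) (B : Finset V) (x : V) :
    ∑ y ∈ B, conductance G w x y ≤ mu G w x := by
  classical
  unfold conductance mu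
  rw [← Finset.sum_filter]
  refine Finset.sum_le_sum_of_subset_of_nonneg (fun y hy => ?_) fun y hy _ => ?_
  · simpa using (Finset.mem_filter.1 hy).2
  · exact (hw _ (by simpa using hy)).le

theorem inv_conductance_le_nu {G : SimpleGraph V} [G.LocallyFinite] {w : Sym2 V → ℝ}
    (hw : ∀ e ∈ G.edgeSet, 0 < w e) (B : Finset V) (x : V) :
    ∑ y ∈ B, (conductance G w x y)⁻¹ ≤ nu G w x := by
  classical
  have e : ∀ y, (conductance G w x y)⁻¹ = if G.Adj x y then 1 / w s(x, y) else 0 := fun y => by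
    unfold conductance; split_ifs <;> simp
  simp_rw [e]
  unfold nu
  rw [← Finset.sum_filter]
  refine Finset.sum_le_sum_of_subset_of_nonneg (fun y hy => ?_) fun y hy _ => ?_
  · simpa using (Finset.mem_filter.1 hy).2
  · exact (one_div_pos.2 (hw _ (by simpa using hy))).le

/-- The normalized `ℓ^p` norm of a nonnegative function on `B`. -/
noncomputable def lpMean (p : ℝ) (B : Finset V) (g : V → ℝ) : ℝ :=
  (1 / (B.card : ℝ) * ∑ x ∈ B, g x ^ p) ^ (1 / p)

theorem lpMean_nonneg {p : ℝ} {B : Finset V} {g : V → ℝ} (hg : ∀ x ∈ B, 0 ≤ g x) :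
    0 ≤ lpMean p B g := by
  have : 0 ≤ ∑ x ∈ B, g x ^ p := Finset.sum_nonneg fun x hx => Real.rpow_nonneg (hg x hx) _
  unfold lpMean
  positivity

theorem mean_mul_le_lpMean_mul {p : ℝ} (hp : 1 < p) {B : Finset V} (hB : B.Nonempty)
    {g F : V → ℝ} (hg : ∀ x ∈ B, 0 ≤ g x) (hF : ∀ x ∈ B, 0 ≤ F x) :
    1 / (B.card : ℝ) * ∑ x ∈ B, g x * F x ≤
      lpMean p B g * (1 / (B.card : ℝ) * ∑ x ∈ B, F x ^ (p / (p - 1))) ^ (1 - 1 / p) := by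
  have hb : (0 : ℝ) < B.card := by exact_mod_cast hB.card_pos
  have hpq : p.HolderConjugate (p / (p - 1)) := Real.HolderConjugate.conjExponent hp
  have h := Real.inner_le_Lp_mul_Lq_of_nonneg B hpq hg hF
  have e : 1 / (p / (p - 1)) = 1 - 1 / p := by
    have : p ≠ 0 := by linarith
    field_simp
  rw [e] at h
  have s1 : 0 ≤ ∑ x ∈ B, g x ^ p := Finset.sum_nonneg fun x hx => Real.rpow_nonneg (hg x hx) _
  have s2 : 0 ≤ ∑ x ∈ B, F x ^ (p / (p - 1)) :=
    Finset.sum_nonneg fun x hx => Real.rpow_nonneg (hF x hx) _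
  unfold lpMean
  rw [Real.mul_rpow (by positivity) s1, Real.mul_rpow (by positivity) s2]
  have e2 : (1 / (B.card : ℝ)) ^ (1 / p) * (1 / (B.card : ℝ)) ^ (1 - 1 / p) = 1 / B.card := by
    rw [← Real.rpow_add (by positivity)]; simp
  calc _ ≤ 1 / (B.card : ℝ) * ((∑ x ∈ B, g x ^ p) ^ (1 / p) *
        (∑ x ∈ B, F x ^ (p / (p - 1))) ^ (1 - 1 / p)) := by gcongr
    _ = _ := by nth_rewrite 1 [← e2]; ring

/-- The proportion of points of `B` that lie in `S`. -/
noncomputable def density (B S : Finset V) : ℝ := (S.card : ℝ) / B.card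

theorem density_nonneg (B S : Finset V) : 0 ≤ density B S := by unfold density; positivity

theorem density_le_one {B S : Finset V} (h : S ⊆ B) : density B S ≤ 1 := by
  unfold density
  exact div_le_one_of_le₀ (by exact_mod_cast Finset.card_le_card h) (by positivity)

theorem mean_le_lpMean_mul_density {p : ℝ} (hp : 1 < p) {B S : Finset V} (hB : B.Nonempty)
    (hS : S ⊆ B) {g : V → ℝ} (hg : ∀ x ∈ B, 0 ≤ g x) :
    1 / (B.card : ℝ) * ∑ x ∈ S, g x ≤ lpMean p B g * density B S ^ (1 - 1 / p) := by
  classical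
  have h := mean_mul_le_lpMean_mul hp hB (F := fun x => if x ∈ S then 1 else 0) hg
    fun x _ => by split_ifs <;> norm_num
  have hp0 : p / (p - 1) ≠ 0 := (div_pos (by linarith) (by linarith)).ne'
  have e1 : ∑ x ∈ B, g x * (if x ∈ S then (1 : ℝ) else 0) = ∑ x ∈ S, g x := by
    simp [Finset.sum_ite_mem, Finset.inter_eq_right.2 hS]
  have e2 : ∑ x ∈ B, (if x ∈ S then (1 : ℝ) else 0) ^ (p / (p - 1)) = S.card := by
    have : ∀ x, (if x ∈ S then (1 : ℝ) else 0) ^ (p / (p - 1)) = if x ∈ S then 1 else 0 :=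
      fun x => by split_ifs <;> simp [hp0]
    simp [this, Finset.sum_ite_mem, Finset.inter_eq_right.2 hS]
  rw [e1, e2] at h
  rw [density, div_eq_inv_mul (S.card : ℝ), ← one_div (B.card : ℝ)]
  exact h

theorem measurable_density {B : Finset V} {S : ℝ → Finset V} (hS : ∀ t, S t ⊆ B)
    (hm : ∀ x ∈ B, MeasurableSet {t | x ∈ S t}) : Measurable fun t => density B (S t) := by
  classical
  have e : ∀ t, density B (S t) = (∑ x ∈ B, {t | x ∈ S t}.indicator (fun _ => (1 : ℝ)) t) /
      B.card := fun t => by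
    unfold density
    congr 1
    simp [Set.indicator_apply, Finset.sum_ite_mem, Finset.inter_eq_right.2 (hS t)]
  simp_rw [e]
  exact (Finset.measurable_fun_sum B fun x hx => measurable_const.indicator (hm x hx)).div_const _

theorem integrableOn_density_rpow {B : Finset V} {S : ℝ → Finset V} (hS : ∀ t, S t ⊆ B)
    (hm : ∀ x ∈ B, MeasurableSet {t | x ∈ S t}) {θ : ℝ} (hθ : 0 ≤ θ) (a e : ℝ) :
    IntegrableOn (fun t => density B (S t) ^ θ) (Icc a e) := by
  refine Measure.integrableOn_of_bounded (M := 1) (by simp)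
    ((measurable_density hS hm).pow_const θ).aestronglyMeasurable ?_
  refine Filter.Eventually.of_forall fun t => ?_
  rw [Real.norm_of_nonneg (Real.rpow_nonneg (density_nonneg _ _) _)]
  exact Real.rpow_le_one (density_nonneg _ _) (density_le_one (hS t)) hθ

theorem integral_mul_le_rpow_integral {α : Type*} [MeasurableSpace α] {μ : Measure α} {p q : ℝ}
    (hpq : p.HolderConjugate q) {f g : α → ℝ} (hf : Measurable f) (hg : Measurable g)
    (hf0 : ∀ x, 0 ≤ f x) (hg0 : ∀ x, 0 ≤ g x) (hfi : Integrable (fun x => f x ^ p) μ)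
    (hgi : Integrable (fun x => g x ^ q) μ) :
    Integrable (fun x => f x * g x) μ ∧
      ∫ x, f x * g x ∂μ ≤ (∫ x, f x ^ p ∂μ) ^ (1 / p) * (∫ x, g x ^ q ∂μ) ^ (1 / q) := by
  have m : ∀ {r : ℝ} {h : α → ℝ}, 0 < r → Measurable h → (∀ x, 0 ≤ h x) →
      Integrable (fun x => h x ^ r) μ → MemLp h (ENNReal.ofReal r) μ := by
    intro r h hr hh hh0 hi
    rw [← integrable_norm_rpow_iff hh.aestronglyMeasurable (by simpa using hr)
      ENNReal.ofReal_ne_top, ENNReal.toReal_ofReal hr.le]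
    simpa only [Real.norm_of_nonneg (hh0 _)] using hi
  have mf := m hpq.pos hf hf0 hfi
  have mg := m hpq.symm.pos hg hg0 hgi
  refine ⟨?_, integral_mul_le_Lp_mul_Lq_of_nonneg hpq (Filter.Eventually.of_forall hf0)
    (Filter.Eventually.of_forall hg0) mf mg⟩
  have : ENNReal.HolderConjugate (ENNReal.ofReal p) (ENNReal.ofReal q) := hpq.ennrealOfReal
  exact mf.integrable_mul mg

/-- The mixed norm of `g` on `[a, e] × B` with time exponent `p'` and space exponent `p` is at
most `A`. -/
structure MixedBound (p p' : ℝ) (B : Finset V) (a e : ℝ) (g : ℝ → V → ℝ) (A : ℝ) : Prop where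
  nonneg : ∀ t x, 0 ≤ g t x
  meas : ∀ x ∈ B, Measurable fun t => g t x
  integrable : IntegrableOn (fun t => lpMean p B (g t) ^ p') (Icc a e)
  bound : ∫ t in Icc a e, lpMean p B (g t) ^ p' ≤ (e - a) * A ^ p'

theorem MixedBound.measurable_lpMean {p p' : ℝ} {B : Finset V} {a e : ℝ} {g : ℝ → V → ℝ} {A : ℝ}
    (h : MixedBound p p' B a e g A) : Measurable fun t => lpMean p B (g t) := by
  unfold lpMean
  exact ((Finset.measurable_fun_sum B fun x hx => (h.meas x hx).pow_const p).const_mul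
    _).pow_const _

theorem MixedBound.setIntegral_sum_le {p p' β θ : ℝ} {B : Finset V} {a e : ℝ} {g : ℝ → V → ℝ}
    {A : ℝ} (h : MixedBound p p' B a e g A) (hp : 1 < p) (hβ : p'.HolderConjugate β)
    (hθ : θ = β * (1 - 1 / p)) (hB : B.Nonempty) (hA : 0 ≤ A) (hae : a < e) {S : ℝ → Finset V}
    (hS : ∀ t, S t ⊆ B) (hm : ∀ x ∈ B, MeasurableSet {t | x ∈ S t}) {J : Set ℝ}
    (hJ : J ⊆ Icc a e) :
    IntegrableOn (fun t => 1 / (B.card : ℝ) * ∑ x ∈ S t, g t x) J ∧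
    ∫ t in J, 1 / (B.card : ℝ) * ∑ x ∈ S t, g t x ≤
      (e - a) * A * (1 / (e - a) * ∫ t in J, density B (S t) ^ θ) ^ (1 / β) := by
  have hp0 : 0 < 1 - 1 / p := by
    rw [sub_pos, div_lt_one (by linarith)]; exact hp
  have hea : 0 < e - a := sub_pos.2 hae
  have e1 : ∀ t, (density B (S t) ^ (1 - 1 / p)) ^ β = density B (S t) ^ θ := fun t => by
    rw [← Real.rpow_mul (density_nonneg _ _), hθ, mul_comm]
  have hθ0 : 0 ≤ θ := hθ ▸ (mul_pos hβ.symm.pos hp0).le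
  have hdi : IntegrableOn (fun t => density B (S t) ^ θ) J :=
    (integrableOn_density_rpow hS hm hθ0 a e).mono_set hJ
  obtain ⟨i1, i2⟩ := integral_mul_le_rpow_integral (μ := volume.restrict J) hβ
    (f := fun t => lpMean p B (g t)) (g := fun t => density B (S t) ^ (1 - 1 / p))
    h.measurable_lpMean ((measurable_density hS hm).pow_const _)
    (fun t => lpMean_nonneg fun x _ => h.nonneg t x)
    (fun t => Real.rpow_nonneg (density_nonneg _ _) _) (h.integrable.mono_set hJ)
    (by simpa only [e1, IntegrableOn] using hdi)
  simp only [e1] at i2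
  have hpt : ∀ t, 1 / (B.card : ℝ) * ∑ x ∈ S t, g t x ≤
      lpMean p B (g t) * density B (S t) ^ (1 - 1 / p) := fun t =>
    mean_le_lpMean_mul_density hp hB (hS t) fun x _ => h.nonneg t x
  have hmeas : Measurable fun t => 1 / (B.card : ℝ) * ∑ x ∈ S t, g t x := by
    classical
    have e2 : ∀ t, ∑ x ∈ S t, g t x = ∑ x ∈ B, {t | x ∈ S t}.indicator (fun t => g t x) t :=
      fun t => by
        simp [Set.indicator_apply, Finset.sum_ite_mem, Finset.inter_eq_right.2 (hS t)]
    simp_rw [e2]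
    exact (Finset.measurable_fun_sum B fun x hx => (h.meas x hx).indicator (hm x hx)).const_mul _
  have hint : IntegrableOn (fun t => 1 / (B.card : ℝ) * ∑ x ∈ S t, g t x) J := by
    refine i1.mono' hmeas.aestronglyMeasurable (Filter.Eventually.of_forall fun t => ?_)
    rw [Real.norm_of_nonneg]
    · exact hpt t
    · have := Finset.sum_nonneg fun x (_ : x ∈ S t) => h.nonneg t x
      positivity
  refine ⟨hint, ?_⟩
  refine (integral_mono hint i1 hpt).trans (i2.trans ?_)
  have hI : ∫ t in J, lpMean p B (g t) ^ p' ≤ (e - a) * A ^ p' :=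
    (setIntegral_mono_set h.integrable (Filter.Eventually.of_forall fun t =>
      Real.rpow_nonneg (lpMean_nonneg fun x _ => h.nonneg t x) _)
      (LE.le.eventuallyLE hJ)).trans h.bound
  have hI0 : 0 ≤ ∫ t in J, lpMean p B (g t) ^ p' :=
    integral_nonneg fun t => Real.rpow_nonneg (lpMean_nonneg fun x _ => h.nonneg t x) _
  have hD0 : 0 ≤ ∫ t in J, density B (S t) ^ θ :=
    integral_nonneg fun t => Real.rpow_nonneg (density_nonneg _ _) _
  have hI' := Real.rpow_le_rpow hI0 hI hβ.one_div_nonneg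
  rw [Real.mul_rpow hea.le (Real.rpow_nonneg hA _), ← Real.rpow_mul hA,
    mul_one_div_cancel hβ.ne_zero, Real.rpow_one] at hI'
  have e3 : (e - a) ^ (1 / p') = (e - a) * (1 / (e - a)) ^ (1 / β) := by
    rw [one_div (e - a), Real.inv_rpow hea.le, ← div_eq_mul_inv]
    have h1 : 1 / p' = 1 - 1 / β := by
      have := hβ.inv_add_inv_eq_one
      simp only [one_div]
      linarith
    rw [h1, Real.rpow_sub hea, Real.rpow_one]
  calc _ ≤ ((e - a) ^ (1 / p') * A) * (∫ t in J, density B (S t) ^ θ) ^ (1 / β) :=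
        mul_le_mul_of_nonneg_right hI' (Real.rpow_nonneg hD0 _)
    _ = _ := by rw [e3, Real.mul_rpow (by positivity) hD0]; ring

theorem abs_rpow_sub_rpow_le {m x y : ℝ} (hm : 1 ≤ m) (hx : 0 ≤ x) (hy : 0 ≤ y) :
    |x ^ m - y ^ m| ≤ m * (max x y ^ (m - 1) * |x - y|) := by
  wlog hxy : y ≤ x generalizing x y
  · rw [abs_sub_comm, abs_sub_comm x, max_comm]
    exact this hy hx (le_of_not_ge hxy)
  rw [max_eq_left hxy, abs_of_nonneg (sub_nonneg.2 hxy),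
    abs_of_nonneg (sub_nonneg.2 (Real.rpow_le_rpow hy hxy (by linarith)))]
  rcases hx.eq_or_lt with h | h
  · have : y = 0 := by linarith
    subst this; rw [← h]; simp
  · have h1 := one_add_mul_self_le_rpow_one_add (s := y / x - 1)
      (by have : 0 ≤ y / x := by positivity
          linarith) hm
    rw [add_sub_cancel, Real.div_rpow hy hx, le_div_iff₀ (Real.rpow_pos_of_pos h m)] at h1
    have h2 : x ^ m = x ^ (m - 1) * x := by
      rw [← Real.rpow_add_one h.ne', sub_add_cancel]
    have h3 : (1 + m * (y / x - 1)) * x ^ m = x ^ m - m * (x ^ (m - 1) * (x - y)) := by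
      rw [h2]; field_simp; ring
    linarith

theorem max_rpow_le_add {x y r : ℝ} (hx : 0 ≤ x) (hy : 0 ≤ y) :
    max x y ^ r ≤ x ^ r + y ^ r := by
  rcases le_total x y with h | h
  · rw [max_eq_right h]; linarith [Real.rpow_nonneg hx r]
  · rw [max_eq_left h]; linarith [Real.rpow_nonneg hy r]

theorem sum_sum_add_of_symm {B : Finset V} {c : V → V → ℝ} (hc : ∀ x y, c x y = c y x)
    (F : V → ℝ) :
    ∑ x ∈ B, ∑ y ∈ B, c x y * (F x + F y) = 2 * ∑ x ∈ B, F x * ∑ y ∈ B, c x y := by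
  have h1 : ∑ x ∈ B, ∑ y ∈ B, c x y * F y = ∑ x ∈ B, ∑ y ∈ B, c x y * F x := by
    rw [Finset.sum_comm]
    exact Finset.sum_congr rfl fun x _ => Finset.sum_congr rfl fun y _ => by rw [hc]
  simp_rw [mul_add, Finset.sum_add_distrib]
  rw [h1, ← two_mul]
  congr 1
  refine Finset.sum_congr rfl fun x _ => ?_
  rw [Finset.mul_sum]
  exact Finset.sum_congr rfl fun y _ => mul_comm _ _

/-- Sum of `|f x - f y|` over the edges inside `B`. -/
noncomputable def variation (G : SimpleGraph V) (B : Finset V) (f : V → ℝ) : ℝ :=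
  1 / 2 * ∑ x ∈ B, ∑ y ∈ B, conductance G (fun _ => 1) x y * |f y - f x|

theorem conductance_one_sq {G : SimpleGraph V} {w : Sym2 V → ℝ}
    (hw : ∀ e ∈ G.edgeSet, 0 < w e) (x y : V) :
    conductance G (fun _ => 1) x y ^ 2 = conductance G w x y * (conductance G w x y)⁻¹ := by
  unfold conductance
  split_ifs with h
  · rw [mul_inv_cancel₀ (hw _ h).ne', one_pow]
  · simp

theorem variation_rpow_sq_le {G : SimpleGraph V} [G.LocallyFinite] {w : Sym2 V → ℝ}
    (hw : ∀ e ∈ G.edgeSet, 0 < w e) (B : Finset V) {f : V → ℝ} (hf : ∀ x, 0 ≤ f x) {m : ℝ}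
    (hm : 1 ≤ m) :
    variation G B (fun x => f x ^ m) ^ 2 ≤
      m ^ 2 * (1 / 2 * ∑ x ∈ B, ∑ y ∈ B, conductance G w x y * (f y - f x) ^ 2) *
        ∑ x ∈ B, nu G w x * f x ^ (2 * (m - 1)) := by
  have hc1 := fun x y =>
    conductance_nonneg (G := G) (w := fun _ => (1 : ℝ)) (fun _ _ => one_pos) x y
  have hc := fun x y => conductance_nonneg hw x y
  have h1 : variation G B (fun x => f x ^ m) ≤ m * (1 / 2 * ∑ z ∈ B ×ˢ B,
      conductance G (fun _ => 1) z.1 z.2 * (max (f z.2) (f z.1) ^ (m - 1) * |f z.2 - f z.1|)) := by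
    unfold variation
    rw [Finset.sum_product, mul_left_comm, Finset.mul_sum _ _ m]
    refine mul_le_mul_of_nonneg_left (Finset.sum_le_sum fun x _ => ?_) one_half_pos.le
    rw [Finset.mul_sum]
    refine Finset.sum_le_sum fun y _ => ?_
    rw [mul_left_comm]
    exact mul_le_mul_of_nonneg_left (abs_rpow_sub_rpow_le hm (hf y) (hf x)) (hc1 x y)
  have h0 : 0 ≤ variation G B (fun x => f x ^ m) := by
    unfold variation
    exact mul_nonneg (by norm_num) (Finset.sum_nonneg fun x _ => Finset.sum_nonneg fun y _ =>
      mul_nonneg (hc1 x y) (abs_nonneg _))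
  have h2 := Finset.sum_sq_le_sum_mul_sum_of_sq_le_mul (B ×ˢ B)
    (r := fun z : V × V => conductance G (fun _ => 1) z.1 z.2 *
      (max (f z.2) (f z.1) ^ (m - 1) * |f z.2 - f z.1|))
    (f := fun z => conductance G w z.1 z.2 * (f z.2 - f z.1) ^ 2)
    (g := fun z => (conductance G w z.1 z.2)⁻¹ * max (f z.2) (f z.1) ^ (2 * (m - 1)))
    (fun z _ => mul_nonneg (hc _ _) (sq_nonneg _))
    (fun z _ => mul_nonneg (inv_nonneg.2 (hc _ _))
      (Real.rpow_nonneg (le_max_of_le_left (hf _)) _))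
    (fun z _ => le_of_eq <| by
      rw [mul_pow, mul_pow, sq_abs, conductance_one_sq hw, mul_comm 2 (m - 1), Real.rpow_mul
        (le_max_of_le_left (hf _)), Real.rpow_two]
      ring)
  have h3 : ∑ z ∈ B ×ˢ B, (conductance G w z.1 z.2)⁻¹ * max (f z.2) (f z.1) ^ (2 * (m - 1)) ≤
      2 * ∑ x ∈ B, nu G w x * f x ^ (2 * (m - 1)) := by
    rw [Finset.sum_product]
    calc _ ≤ ∑ x ∈ B, ∑ y ∈ B, (conductance G w x y)⁻¹ *
          (f x ^ (2 * (m - 1)) + f y ^ (2 * (m - 1))) := by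
          refine Finset.sum_le_sum fun x _ => Finset.sum_le_sum fun y _ => ?_
          refine mul_le_mul_of_nonneg_left ?_ (inv_nonneg.2 (hc _ _))
          rw [add_comm]
          exact max_rpow_le_add (hf y) (hf x)
      _ = 2 * ∑ x ∈ B, f x ^ (2 * (m - 1)) * ∑ y ∈ B, (conductance G w x y)⁻¹ :=
          sum_sum_add_of_symm (fun x y => by rw [conductance_comm]) fun x => f x ^ (2 * (m - 1))
      _ ≤ _ := by
          refine mul_le_mul_of_nonneg_left (Finset.sum_le_sum fun x _ => ?_) (by norm_num)
          rw [mul_comm]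
          exact mul_le_mul_of_nonneg_right (inv_conductance_le_nu hw B x)
            (Real.rpow_nonneg (hf x) _)
  have h4 : 0 ≤ ∑ z ∈ B ×ˢ B, conductance G w z.1 z.2 * (f z.2 - f z.1) ^ 2 :=
    Finset.sum_nonneg fun z _ => mul_nonneg (hc _ _) (sq_nonneg _)
  refine (pow_le_pow_left₀ h0 h1 2).trans ?_
  rw [mul_pow, mul_pow]
  have h5 := h2.trans (mul_le_mul_of_nonneg_left h3 h4)
  rw [Finset.sum_product] at h5
  rw [Finset.sum_product]
  rw [Finset.sum_product] at h5
  have := mul_le_mul_of_nonneg_left h5 (sq_nonneg m)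
  linarith

/-- A Sobolev inequality for `f ^ m` bounds a power of `f` by the Dirichlet energy of `f` and the
norm of `ν`. -/
theorem weighted_sobolev {G : SimpleGraph V} [G.LocallyFinite] {w : Sym2 V → ℝ}
    (hw : ∀ e ∈ G.edgeSet, 0 < w e) {B : Finset V} (hB : B.Nonempty) {f : V → ℝ}
    (hf : ∀ x, 0 ≤ f x) {m ds q σ K : ℝ} (hm : 1 ≤ m) (hq : 1 < q)
    (hmq : 2 * (m - 1) * (q / (q - 1)) = m * ds) (hσ : σ = 2 / ds - (1 - 1 / q)) (hσ0 : 0 < σ)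
    (hsob : lpMean ds B (fun x => f x ^ m) ≤ K / B.card * variation G B fun x => f x ^ m) :
    (1 / (B.card : ℝ) * ∑ x ∈ B, f x ^ (m * ds)) ^ σ ≤
      K ^ 2 * m ^ 2 * (1 / (B.card : ℝ) *
        (1 / 2 * ∑ x ∈ B, ∑ y ∈ B, conductance G w x y * (f y - f x) ^ 2)) *
        lpMean q B (fun x => max 1 (nu G w x)) := by
  have hb : (0 : ℝ) < B.card := by exact_mod_cast hB.card_pos
  set X := 1 / (B.card : ℝ) * ∑ x ∈ B, f x ^ (m * ds) with hX
  set E := 1 / 2 * ∑ x ∈ B, ∑ y ∈ B, conductance G w x y * (f y - f x) ^ 2 with hE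
  set N := lpMean q B (fun x => max 1 (nu G w x)) with hN
  have hE0 : 0 ≤ E := mul_nonneg (by norm_num) (Finset.sum_nonneg fun x _ =>
    Finset.sum_nonneg fun y _ => mul_nonneg (conductance_nonneg hw x y) (sq_nonneg _))
  have hN0 : 0 ≤ N := lpMean_nonneg fun x _ => zero_le_one.trans (le_max_left _ _)
  have hX0 : 0 ≤ X := mul_nonneg (by positivity)
    (Finset.sum_nonneg fun x _ => Real.rpow_nonneg (hf x) _)
  have h1 : lpMean ds B (fun x => f x ^ m) = X ^ (1 / ds) := by
    unfold lpMean
    simp only [hX, Real.rpow_mul (hf _)]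
  have h2 : ∑ x ∈ B, nu G w x * f x ^ (2 * (m - 1)) ≤ B.card * (N * X ^ (1 - 1 / q)) := by
    have h := mean_mul_le_lpMean_mul hq hB (g := fun x => max 1 (nu G w x))
      (F := fun x => f x ^ (2 * (m - 1))) (fun x _ => zero_le_one.trans (le_max_left _ _))
      fun x _ => Real.rpow_nonneg (hf x) _
    simp only [← Real.rpow_mul (hf _), hmq] at h
    rw [one_div, inv_mul_le_iff₀ hb, ← one_div] at h
    refine le_trans (Finset.sum_le_sum fun x _ => ?_) h
    exact mul_le_mul_of_nonneg_right (le_max_right _ _) (Real.rpow_nonneg (hf x) _)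
  have h3 := variation_rpow_sq_le hw B hf hm
  have h4 : X ^ (2 / ds) ≤ K ^ 2 * m ^ 2 * (1 / (B.card : ℝ) * E) * N * X ^ (1 - 1 / q) := by
    have h5 := pow_le_pow_left₀ (Real.rpow_nonneg hX0 _) (h1 ▸ hsob) 2
    rw [← Real.rpow_two, ← Real.rpow_mul hX0, show 1 / ds * 2 = 2 / ds by ring, mul_pow] at h5
    have h6 := h3.trans (mul_le_mul_of_nonneg_left h2 (mul_nonneg (sq_nonneg m) hE0))
    refine h5.trans ((mul_le_mul_of_nonneg_left h6 (sq_nonneg _)).trans (le_of_eq ?_))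
    rw [← hE]
    field_simp
  rcases hX0.eq_or_lt with h | h
  · rw [← h, Real.zero_rpow hσ0.ne']
    positivity
  · rw [hσ, Real.rpow_sub h, div_le_iff₀ (Real.rpow_pos_of_pos h _)]
    exact h4

/-- The radial cutoff equal to `1` up to distance `r'` from `x₀` and to `0` from distance `r` on. -/
noncomputable def cutoff (G : SimpleGraph V) (x₀ : V) (r r' : ℝ) (x : V) : ℝ :=
  max 0 (min 1 ((r - G.dist x₀ x) / (r - r')))

theorem cutoff_nonneg (G : SimpleGraph V) (x₀ : V) (r r' : ℝ) (x : V) :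
    0 ≤ cutoff G x₀ r r' x := le_max_left _ _

theorem cutoff_le_one (G : SimpleGraph V) (x₀ : V) (r r' : ℝ) (x : V) :
    cutoff G x₀ r r' x ≤ 1 := max_le zero_le_one (min_le_left _ _)

theorem cutoff_eq_one {G : SimpleGraph V} {x₀ : V} {r r' : ℝ} (h : r' < r) {x : V}
    (hx : (G.dist x₀ x : ℝ) ≤ r') : cutoff G x₀ r r' x = 1 := by
  unfold cutoff
  rw [min_eq_left ((one_le_div (sub_pos.2 h)).2 (by linarith)), max_eq_right zero_le_one]

theorem cutoff_eq_zero {G : SimpleGraph V} {x₀ : V} {r r' : ℝ} (h : r' < r) {x : V}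
    (hx : r ≤ (G.dist x₀ x : ℝ)) : cutoff G x₀ r r' x = 0 := by
  unfold cutoff
  exact max_eq_left (min_le_of_right_le
    (div_nonpos_of_nonpos_of_nonneg (by linarith) (sub_pos.2 h).le))

theorem abs_dist_sub_dist_le_one {G : SimpleGraph V} (hG : G.Connected) (x₀ : V) {x y : V}
    (hxy : G.Adj x y) : |(G.dist x₀ x : ℝ) - G.dist x₀ y| ≤ 1 := by
  have h1 := hG.dist_triangle (u := x₀) (v := x) (w := y)
  have h2 := hG.dist_triangle (u := x₀) (v := y) (w := x)
  rw [SimpleGraph.dist_eq_one_iff_adj.2 hxy] at h1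
  rw [SimpleGraph.dist_eq_one_iff_adj.2 hxy.symm] at h2
  rw [abs_le]
  constructor
  · have : (G.dist x₀ y : ℝ) ≤ G.dist x₀ x + 1 := by exact_mod_cast h1
    linarith
  · have : (G.dist x₀ x : ℝ) ≤ G.dist x₀ y + 1 := by exact_mod_cast h2
    linarith

theorem abs_cutoff_sub_cutoff_le {G : SimpleGraph V} (hG : G.Connected) (x₀ : V) {r r' : ℝ}
    (h : r' < r) {x y : V} (hxy : G.Adj x y) :
    |cutoff G x₀ r r' y - cutoff G x₀ r r' x| ≤ 1 / (r - r') := by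
  have hr := sub_pos.2 h
  unfold cutoff
  refine (abs_max_sub_max_le_max _ _ _ _).trans (max_le (by simp [hr.le]) ?_)
  refine (abs_min_sub_min_le_max _ _ _ _).trans (max_le (by simp [hr.le]) ?_)
  rw [← sub_div, abs_div, abs_of_pos hr]
  refine div_le_div_of_nonneg_right ?_ hr.le
  have := abs_dist_sub_dist_le_one hG x₀ hxy
  rwa [sub_sub_sub_cancel_left]

theorem conductance_mul_cutoff_sq_le {G : SimpleGraph V} (hG : G.Connected) {w : Sym2 V → ℝ}
    (hw : ∀ e ∈ G.edgeSet, 0 < w e) (x₀ : V) {r r' : ℝ} (h : r' < r) (x y : V) :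
    conductance G w x y * (cutoff G x₀ r r' y - cutoff G x₀ r r' x) ^ 2 ≤
      (1 / (r - r')) ^ 2 * conductance G w x y := by
  by_cases hxy : G.Adj x y
  · rw [mul_comm]
    refine mul_le_mul_of_nonneg_right ?_ (conductance_nonneg hw x y)
    exact sq_le_sq' (abs_le.1 (abs_cutoff_sub_cutoff_le hG x₀ h hxy)).1
      (abs_le.1 (abs_cutoff_sub_cutoff_le hG x₀ h hxy)).2
  · simp [conductance, hxy]

/-- A space-time cylinder `[a, a + T] × {dist x₀ < k}` inside `[a, a + T] × B` on which the weights
have bounded mixed norms and functions supported in `{dist x₀ < k}` satisfy a Sobolev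
inequality. -/
structure Frame (G : SimpleGraph V) [G.LocallyFinite] (ω : ℝ → Sym2 V → ℝ) (x₀ : V)
    (B D : Finset V) (k a T p p' q q' ds A K₁ Ks : ℝ) : Prop where
  conn : G.Connected
  weight : IsWeight G ω
  k_pos : 0 < k
  sq_le : k ^ 2 ≤ T
  le_sq : T ≤ K₁ * k ^ 2
  A_nonneg : 0 ≤ A
  nonempty : B.Nonempty
  near : ∀ x, (G.dist x₀ x : ℝ) < k → x ∈ D
  sub : D ⊆ B
  mu_bound : MixedBound p p' B a (a + T) (fun t x => max 1 (mu G (ω t) x)) A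
  nu_bound : MixedBound q q' B a (a + T) (fun t x => max 1 (nu G (ω t) x)) A
  sob : ∀ f : V → ℝ, (∀ x, 0 ≤ f x) → (∀ x, k ≤ (G.dist x₀ x : ℝ) → f x = 0) →
    lpMean ds B f ≤ Ks * k / B.card * variation G B f

/-- The exponents of the iteration. -/
structure Exponents (p p' q q' ds β θ s σ m : ℝ) : Prop where
  hp : 1 < p
  hβ : p'.HolderConjugate β
  hθ : θ = β * (1 - 1 / p)
  hq : 1 < q
  hq' : 1 ≤ q'
  hs : s = q' / (q' + 1)
  hds : 0 < ds
  hσ : σ = 2 / ds - (1 - 1 / q)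
  hσ0 : 0 < σ
  hm : 1 ≤ m
  hmq : 2 * (m - 1) * (q / (q - 1)) = m * ds
  hθσ : s * σ ≤ θ
  hκ : β < θ - s * σ + s

theorem Exponents.θ_pos {p p' q q' ds β θ s σ m : ℝ} (h : Exponents p p' q q' ds β θ s σ m) :
    0 < θ := by
  rw [h.hθ]
  refine mul_pos h.hβ.symm.pos (sub_pos.2 ?_)
  rw [div_lt_one (by linarith [h.hp])]
  exact h.hp

open Classical in
/-- The points of `B` at distance less than `r` from `x₀` at which `u_t < l`. -/
noncomputable def sublevel (G : SimpleGraph V) (x₀ : V) (B : Finset V) (u : ℝ → V → ℝ) (r l : ℝ)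
    (t : ℝ) : Finset V :=
  B.filter fun x => (G.dist x₀ x : ℝ) < r ∧ u t x < l

theorem mem_sublevel {G : SimpleGraph V} {x₀ : V} {B : Finset V} {u : ℝ → V → ℝ} {r l t : ℝ}
    {x : V} : x ∈ sublevel G x₀ B u r l t ↔ x ∈ B ∧ (G.dist x₀ x : ℝ) < r ∧ u t x < l := by
  simp [sublevel]

theorem sublevel_subset {G : SimpleGraph V} {x₀ : V} {B : Finset V} {u : ℝ → V → ℝ} {r l t : ℝ} :
    sublevel G x₀ B u r l t ⊆ B := fun _ hx => (mem_sublevel.1 hx).1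

theorem measurableSet_mem_sublevel {G : SimpleGraph V} {x₀ : V} {B : Finset V} {u : ℝ → V → ℝ}
    {r l : ℝ} (hu : ∀ x ∈ B, Continuous fun t => u t x) (x : V) (hx : x ∈ B) :
    MeasurableSet {t | x ∈ sublevel G x₀ B u r l t} := by
  simp only [mem_sublevel, hx, true_and]
  by_cases h : (G.dist x₀ x : ℝ) < r
  · simp only [h, true_and]
    exact (isOpen_lt (hu x hx) continuous_const).measurableSet
  · simp [h]

/-- The Dirichlet energy on `B`. -/
noncomputable def dirichlet (G : SimpleGraph V) (w : Sym2 V → ℝ) (B : Finset V) (f : V → ℝ) : ℝ :=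
  1 / 2 * ∑ x ∈ B, ∑ y ∈ B, conductance G w x y * (f y - f x) ^ 2

theorem dirichlet_nonneg {G : SimpleGraph V} {w : Sym2 V → ℝ} (hw : ∀ e ∈ G.edgeSet, 0 < w e)
    (B : Finset V) (f : V → ℝ) : 0 ≤ dirichlet G w B f :=
  mul_nonneg (by norm_num) (Finset.sum_nonneg fun x _ => Finset.sum_nonneg fun y _ =>
    mul_nonneg (conductance_nonneg hw x y) (sq_nonneg _))

theorem IsWeight.measurable_conductance {G : SimpleGraph V} {ω : ℝ → Sym2 V → ℝ}
    (h : IsWeight G ω) (x y : V) : Measurable fun t => conductance G (ω t) x y := by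
  unfold conductance
  by_cases hxy : G.Adj x y
  · simpa [hxy] using h.meas s(x, y) hxy
  · simp [hxy]

theorem IsWeight.measurable_dirichlet {G : SimpleGraph V} {ω : ℝ → Sym2 V → ℝ}
    (h : IsWeight G ω) {B : Finset V} {f : ℝ → V → ℝ}
    (hf : ∀ x ∈ B, Continuous fun t => f t x) :
    Measurable fun t => dirichlet G (ω t) B (f t) := by
  unfold dirichlet
  refine (Finset.measurable_fun_sum B fun x hx => Finset.measurable_fun_sum B fun y hy =>
    ?_).const_mul _
  exact (h.measurable_conductance x y).mul
    (((hf y hy).measurable.sub (hf x hx).measurable).pow_const 2)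

theorem cutoff_energy_le {G : SimpleGraph V} [G.LocallyFinite] (hG : G.Connected)
    {w : Sym2 V → ℝ} (hw : ∀ e ∈ G.edgeSet, 0 < w e) (x₀ : V) {B S : Finset V} (hSB : S ⊆ B)
    {r r' : ℝ} (hr : r' < r) {v : V → ℝ} (hv0 : ∀ x ∈ B, 0 ≤ v x) (hv1 : ∀ x ∈ B, v x ≤ 1)
    (hS : ∀ x ∈ B, (G.dist x₀ x : ℝ) < r → 0 < v x → x ∈ S) :
    1 / 2 * ∑ x ∈ B, ∑ y ∈ B, conductance G w x y *
        (v x * v y * (cutoff G x₀ r r' y - cutoff G x₀ r r' x) ^ 2) ≤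
      (1 / (r - r')) ^ 2 * ∑ x ∈ S, mu G w x := by
  classical
  set F : V → ℝ := fun x => if x ∈ S then 1 else 0 with hF
  have hF0 : ∀ x, 0 ≤ F x := fun x => by simp only [hF]; split_ifs <;> norm_num
  have key : ∀ x ∈ B, ∀ y ∈ B, conductance G w x y *
      (v x * v y * (cutoff G x₀ r r' y - cutoff G x₀ r r' x) ^ 2) ≤
      (1 / (r - r')) ^ 2 * (conductance G w x y * (F x + F y)) := by
    intro x hx y hy
    have hc := conductance_nonneg hw x y
    have h1 := conductance_mul_cutoff_sq_le hG hw x₀ hr x y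
    have hcF : 0 ≤ (1 / (r - r')) ^ 2 * (conductance G w x y * (F x + F y)) :=
      mul_nonneg (sq_nonneg _) (mul_nonneg hc (add_nonneg (hF0 x) (hF0 y)))
    by_cases h0 : v x * v y * (cutoff G x₀ r r' y - cutoff G x₀ r r' x) ^ 2 = 0
    · rwa [h0, mul_zero]
    have hvx : 0 < v x := (hv0 x hx).lt_of_ne' fun h => h0 (by simp [h])
    have hvy : 0 < v y := (hv0 y hy).lt_of_ne' fun h => h0 (by simp [h])
    have hS' : 1 ≤ F x + F y := by
      by_cases hxr : (G.dist x₀ x : ℝ) < r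
      · have : F x = 1 := by simp [hF, hS x hx hxr hvx]
        linarith [hF0 y]
      · by_cases hyr : (G.dist x₀ y : ℝ) < r
        · have : F y = 1 := by simp [hF, hS y hy hyr hvy]
          linarith [hF0 x]
        · exact absurd (by rw [cutoff_eq_zero hr (not_lt.1 hxr), cutoff_eq_zero hr (not_lt.1 hyr)]
                           simp) h0
    have hvv : v x * v y ≤ 1 := mul_le_one₀ (hv1 x hx) hvy.le (hv1 y hy)
    calc _ = v x * v y * (conductance G w x y *
          (cutoff G x₀ r r' y - cutoff G x₀ r r' x) ^ 2) := by ring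
      _ ≤ 1 * (conductance G w x y * (cutoff G x₀ r r' y - cutoff G x₀ r r' x) ^ 2) :=
          mul_le_mul_of_nonneg_right hvv (mul_nonneg hc (sq_nonneg _))
      _ ≤ (1 / (r - r')) ^ 2 * conductance G w x y := by rw [one_mul]; exact h1
      _ ≤ _ := mul_le_mul_of_nonneg_left (le_mul_of_one_le_right hc hS') (sq_nonneg _)
  calc _ ≤ 1 / 2 * ∑ x ∈ B, ∑ y ∈ B, (1 / (r - r')) ^ 2 * (conductance G w x y * (F x + F y)) :=
        mul_le_mul_of_nonneg_left (Finset.sum_le_sum fun x hx =>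
          Finset.sum_le_sum fun y hy => key x hx y hy) (by norm_num)
    _ = (1 / (r - r')) ^ 2 * ∑ x ∈ B, F x * ∑ y ∈ B, conductance G w x y := by
        simp_rw [← Finset.mul_sum]
        rw [sum_sum_add_of_symm (conductance_comm G w)]
        ring
    _ ≤ _ := by
        refine mul_le_mul_of_nonneg_left ?_ (sq_nonneg _)
        calc _ ≤ ∑ x ∈ B, F x * mu G w x := Finset.sum_le_sum fun x _ =>
              mul_le_mul_of_nonneg_left (conductance_le_mu hw B x) (hF0 x)
          _ = _ := by simp [hF, Finset.sum_ite_mem, Finset.inter_eq_right.2 hSB]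

/-- The time average of `density ^ θ` of the sublevel sets. -/
noncomputable def excess (G : SimpleGraph V) (x₀ : V) (B : Finset V) (u : ℝ → V → ℝ)
    (θ e T r l τ : ℝ) : ℝ :=
  1 / T * ∫ t in Icc τ e, density B (sublevel G x₀ B u r l t) ^ θ

theorem excess_nonneg {G : SimpleGraph V} {x₀ : V} {B : Finset V} {u : ℝ → V → ℝ} {θ T : ℝ}
    (hT : 0 ≤ T) (e r l τ : ℝ) : 0 ≤ excess G x₀ B u θ e T r l τ :=
  mul_nonneg (by positivity)
    (integral_nonneg fun t => Real.rpow_nonneg (density_nonneg _ _) _)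

section Iteration

variable {G : SimpleGraph V} [G.LocallyFinite] {ω : ℝ → Sym2 V → ℝ} {x₀ : V} {B D : Finset V}
  {k a T p p' q q' ds A K₁ Ks β θ s σ m : ℝ} {u : ℝ → V → ℝ}

theorem Frame.T_pos (F : Frame G ω x₀ B D k a T p p' q q' ds A K₁ Ks) : 0 < T :=
  (pow_pos F.k_pos 2).trans_le F.sq_le

theorem Frame.energy_step (F : Frame G ω x₀ B D k a T p p' q q' ds A K₁ Ks)
    (E : Exponents p p' q q' ds β θ s σ m)
    (hu : IsCaloric B D (fun t => conductance G (ω t)) a (a + T) u)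
    (hu0 : ∀ t ∈ Icc a (a + T), ∀ x ∈ B, 0 ≤ u t x) {l r τ Λ : ℝ} (hl : l ≤ 1) (hr : r ≤ k)
    (hτ : a ≤ τ) (hΛ : 0 < Λ) (hΛ1 : Λ ≤ 1) (hτΛ : τ + T * Λ ≤ a + T) :
    (∀ t ∈ Icc (τ + T * Λ) (a + T), 1 / (B.card : ℝ) *
        ∑ x ∈ B, (cutoff G x₀ r (r - k * Λ) x * max (l - u t x) 0) ^ 2 ≤
      2 * ((1 + K₁) / Λ ^ 2 * A * excess G x₀ B u θ (a + T) T r l τ ^ (1 / β))) ∧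
    ∫ t in Icc (τ + T * Λ) (a + T), 1 / (B.card : ℝ) * dirichlet G (ω t) B
        (fun x => cutoff G x₀ r (r - k * Λ) x * max (l - u t x) 0) ≤
      (1 + K₁) / Λ ^ 2 * A * excess G x₀ B u θ (a + T) T r l τ ^ (1 / β) := by
  have hT := F.T_pos
  have hk := F.k_pos
  have hkΛ : 0 < k * Λ := mul_pos hk hΛ
  have hTΛ : 0 < T * Λ := mul_pos hT hΛ
  have hb : (0 : ℝ) < B.card := by exact_mod_cast F.nonempty.card_pos
  have hrr : r - k * Λ < r := by linarith
  set η := cutoff G x₀ r (r - k * Λ) with hη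
  have hηD : ∀ x ∉ D, η x = 0 := fun x hx =>
    cutoff_eq_zero hrr (hr.trans (not_lt.1 fun h => hx (F.near x h)))
  set S := fun t => sublevel G x₀ B u r l t with hSdef
  set Y := excess G x₀ B u θ (a + T) T r l τ with hY
  set g := fun t => 1 / (B.card : ℝ) * ∑ x ∈ S t, max 1 (mu G (ω t) x) with hg
  have hJ : Icc τ (a + T) ⊆ Icc a (a + T) := Icc_subset_Icc_left hτ
  obtain ⟨hgi, hgle⟩ := F.mu_bound.setIntegral_sum_le E.hp E.hβ E.hθ F.nonempty F.A_nonneg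
    (by linarith) (S := S) (fun t => sublevel_subset) (measurableSet_mem_sublevel hu.cont) hJ
  rw [add_sub_cancel_left] at hgle
  change IntegrableOn g _ at hgi
  change ∫ t in Icc τ (a + T), g t ≤ T * A * Y ^ (1 / β) at hgle
  have hg0 : ∀ t, 0 ≤ g t := fun t => mul_nonneg (by positivity)
    (Finset.sum_nonneg fun x _ => zero_le_one.trans (le_max_left _ _))
  have hv1 : ∀ t ∈ Icc a (a + T), ∀ x ∈ B, max (l - u t x) 0 ≤ 1 := fun t ht x hx =>
    max_le (by linarith [hu0 t ht x hx]) zero_le_one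
  have hmemS : ∀ t, ∀ x ∈ B, (G.dist x₀ x : ℝ) < r → 0 < max (l - u t x) 0 → x ∈ S t := by
    intro t x hx hxr hpos
    refine mem_sublevel.2 ⟨hx, hxr, ?_⟩
    rcases lt_max_iff.1 hpos with h | h
    · linarith
    · exact absurd h (lt_irrefl _)
  have hf2 : ∀ t ∈ Icc a (a + T), 1 / 2 * ∑ x ∈ B, (η x * max (l - u t x) 0) ^ 2 ≤
      B.card * g t := by
    intro t ht
    have h1 : ∑ x ∈ B, (η x * max (l - u t x) 0) ^ 2 ≤ ∑ x ∈ S t, 1 := by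
      rw [← Finset.sum_subset (s₁ := S t) sublevel_subset]
      · refine Finset.sum_le_sum fun x hx => ?_
        have hxB := (mem_sublevel.1 hx).1
        rw [mul_pow]
        exact mul_le_one₀ (pow_le_one₀ (cutoff_nonneg _ _ _ _ _) (cutoff_le_one _ _ _ _ _))
          (sq_nonneg _) (pow_le_one₀ (le_max_right _ _) (hv1 t ht x hxB))
      · intro x hxB hxS
        by_contra h0
        have hη0 : η x ≠ 0 := fun h => h0 (by simp [h])
        have hv0 : max (l - u t x) 0 ≠ 0 := fun h => h0 (by simp [h])
        refine hxS (hmemS t x hxB ?_ ((le_max_right _ _).lt_of_ne' hv0))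
        by_contra h
        exact hη0 (cutoff_eq_zero hrr (not_lt.1 h))
    have h2 : ∑ x ∈ S t, (1 : ℝ) ≤ ∑ x ∈ S t, max 1 (mu G (ω t) x) :=
      Finset.sum_le_sum fun x _ => le_max_left _ _
    have h3 : (B.card : ℝ) * g t = ∑ x ∈ S t, max 1 (mu G (ω t) x) := by
      simp only [hg]; field_simp
    have h4 : 0 ≤ ∑ x ∈ B, (η x * max (l - u t x) 0) ^ 2 :=
      Finset.sum_nonneg fun x _ => sq_nonneg _
    rw [h3]
    linarith
  have hcut : ∀ t ∈ Icc a (a + T), 1 / 2 * ∑ x ∈ B, ∑ y ∈ B, conductance G (ω t) x y *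
      (max (l - u t x) 0 * max (l - u t y) 0 * (η y - η x) ^ 2) ≤
      (1 / (k * Λ)) ^ 2 * (B.card * g t) := by
    intro t ht
    have h1 := cutoff_energy_le F.conn (F.weight.pos t) x₀ (S := S t) sublevel_subset hrr
      (v := fun x => max (l - u t x) 0) (fun x _ => le_max_right _ _) (hv1 t ht) (hmemS t)
    rw [sub_sub_cancel] at h1
    refine h1.trans (mul_le_mul_of_nonneg_left ?_ (sq_nonneg _))
    have h3 : (B.card : ℝ) * g t = ∑ x ∈ S t, max 1 (mu G (ω t) x) := by
      simp only [hg]; field_simp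
    rw [h3]
    exact Finset.sum_le_sum fun x _ => le_max_right _ _
  have hmax : ∀ x ∈ B, Continuous fun t => max (l - u t x) 0 := fun x hx => by
    have := hu.cont x hx; fun_prop
  have hcont : Continuous fun t => 1 / 2 * ∑ x ∈ B, (η x * max (l - u t x) 0) ^ 2 := by
    refine continuous_const.mul (continuous_finsetSum B fun x hx => ?_)
    have := hmax x hx
    fun_prop
  obtain ⟨t₁, ht₁, hle⟩ := exists_le_setAverage (μ := volume) (s := Icc τ (τ + T * Λ))
    (f := fun t => 1 / 2 * ∑ x ∈ B, (η x * max (l - u t x) 0) ^ 2)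
    (by simpa using hTΛ) (by simp) (hcont.continuousOn.integrableOn_Icc)
  have ht₁I : t₁ ∈ Icc a (a + T) := ⟨hτ.trans ht₁.1, ht₁.2.trans hτΛ⟩
  have hstart : 1 / 2 * ∑ x ∈ B, (η x * max (l - u t₁ x) 0) ^ 2 ≤
      1 / (T * Λ) * (B.card * (T * A * Y ^ (1 / β))) := by
    refine hle.trans ?_
    rw [setAverage_eq, smul_eq_mul, Real.volume_real_Icc_of_le (by linarith),
      add_sub_cancel_left, ← one_div]
    refine mul_le_mul_of_nonneg_left ?_ (by positivity)
    have hsub : Icc τ (τ + T * Λ) ⊆ Icc τ (a + T) := Icc_subset_Icc_right hτΛ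
    calc _ ≤ ∫ t in Icc τ (τ + T * Λ), (B.card : ℝ) * g t :=
          setIntegral_mono_on hcont.continuousOn.integrableOn_Icc
            ((hgi.mono_set hsub).const_mul _) measurableSet_Icc
            fun t ht => hf2 t (hJ (hsub ht))
      _ ≤ ∫ t in Icc τ (a + T), (B.card : ℝ) * g t :=
          setIntegral_mono_set (hgi.const_mul _)
            (Filter.Eventually.of_forall fun t => mul_nonneg hb.le (hg0 t))
            (LE.le.eventuallyLE hsub)
      _ ≤ _ := by
          rw [integral_const_mul]
          exact mul_le_mul_of_nonneg_left hgle hb.le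
  have hmain : ∀ t ∈ Icc (τ + T * Λ) (a + T),
      1 / 2 * ∑ x ∈ B, (η x * max (l - u t x) 0) ^ 2 +
        ∫ r in t₁..t, dirichlet G (ω r) B (fun x => η x * max (l - u r x) 0) ≤
      B.card * ((1 + K₁) / Λ ^ 2 * A * Y ^ (1 / β)) := by
    intro t ht
    have htI : t ∈ Icc a (a + T) := ⟨hτ.trans (le_trans (by linarith) ht.1), ht.2⟩
    have ht₁t : t₁ ≤ t := ht₁.2.trans ht.1
    have hc := hu.caccioppoli hηD hu0 l ht₁I htI ht₁t
    have h2 : ∫ r in t₁..t, 1 / 2 * ∑ x ∈ B, ∑ y ∈ B, conductance G (ω r) x y *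
        (max (l - u r x) 0 * max (l - u r y) 0 * (η y - η x) ^ 2) ≤
        (1 / (k * Λ)) ^ 2 * (B.card * (T * A * Y ^ (1 / β))) := by
      have hsub : Icc t₁ t ⊆ Icc τ (a + T) := Icc_subset_Icc ht₁.1 ht.2
      have i1 := (hu.intervalIntegrable_sum (F := fun r x y =>
          max (l - u r x) 0 * max (l - u r y) 0 * (η y - η x) ^ 2) (fun x hx y hy => by
        have := hmax x hx; have := hmax y hy; fun_prop) ht₁I htI).const_mul (1 / 2)
      have i2 : IntervalIntegrable (fun t => (1 / (k * Λ)) ^ 2 * (B.card * g t)) volume t₁ t :=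
        (intervalIntegrable_iff_integrableOn_Icc_of_le ht₁t).2
          (((hgi.mono_set hsub).const_mul _).const_mul _)
      refine (intervalIntegral.integral_mono_on ht₁t i1 i2
        fun r hr => hcut r (hJ (hsub hr))).trans ?_
      rw [intervalIntegral.integral_const_mul, intervalIntegral.integral_const_mul,
        intervalIntegral.integral_of_le ht₁t, ← integral_Icc_eq_integral_Ioc]
      refine mul_le_mul_of_nonneg_left (mul_le_mul_of_nonneg_left ?_ hb.le) (sq_nonneg _)
      exact (setIntegral_mono_set hgi (Filter.Eventually.of_forall hg0)
        (LE.le.eventuallyLE hsub)).trans hgle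
    have hY0 : 0 ≤ A * Y ^ (1 / β) :=
      mul_nonneg F.A_nonneg (Real.rpow_nonneg (excess_nonneg hT.le _ _ _ _) _)
    have h3 : 1 / (T * Λ) * (B.card * (T * A * Y ^ (1 / β))) +
        (1 / (k * Λ)) ^ 2 * (B.card * (T * A * Y ^ (1 / β))) ≤
        B.card * ((1 + K₁) / Λ ^ 2 * A * Y ^ (1 / β)) := by
      have e1 : 1 / (T * Λ) * (B.card * (T * A * Y ^ (1 / β))) =
          B.card * (A * Y ^ (1 / β)) * (1 / Λ) := by field_simp
      have e2 : (1 / (k * Λ)) ^ 2 * (B.card * (T * A * Y ^ (1 / β))) =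
          B.card * (A * Y ^ (1 / β)) * (T / k ^ 2 / Λ ^ 2) := by field_simp
      have e3 : B.card * ((1 + K₁) / Λ ^ 2 * A * Y ^ (1 / β)) =
          B.card * (A * Y ^ (1 / β)) * ((1 + K₁) / Λ ^ 2) := by ring
      rw [e1, e2, e3, ← mul_add]
      refine mul_le_mul_of_nonneg_left ?_ (mul_nonneg hb.le hY0)
      rw [add_div]
      refine add_le_add ?_ ?_
      · refine one_div_le_one_div_of_le (by positivity) ?_
        nlinarith
      · refine div_le_div_of_nonneg_right ?_ (by positivity)
        rw [div_le_iff₀ (by positivity)]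
        exact F.le_sq
    have h4 : ∫ r in t₁..t, dirichlet G (ω r) B (fun x => η x * max (l - u r x) 0) =
        ∫ r in t₁..t, 1 / 2 * ∑ x ∈ B, ∑ y ∈ B, conductance G (ω r) x y *
          (η y * max (l - u r y) 0 - η x * max (l - u r x) 0) ^ 2 := rfl
    rw [h4]
    linarith
  have hdir0 : ∀ t, 0 ≤ dirichlet G (ω t) B (fun x => η x * max (l - u t x) 0) := fun t =>
    dirichlet_nonneg (F.weight.pos t) _ _
  constructor
  · intro t ht
    have h1 := hmain t ht
    have h2 : 0 ≤ ∫ r in t₁..t, dirichlet G (ω r) B (fun x => η x * max (l - u r x) 0) :=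
      intervalIntegral.integral_nonneg (ht₁.2.trans ht.1) fun r _ => hdir0 r
    rw [one_div, inv_mul_le_iff₀ hb]
    linarith
  · have h1 := hmain (a + T) ⟨hτΛ, le_rfl⟩
    have h2 : 0 ≤ 1 / 2 * ∑ x ∈ B, (η x * max (l - u (a + T) x) 0) ^ 2 :=
      mul_nonneg (by norm_num) (Finset.sum_nonneg fun x _ => sq_nonneg _)
    have hte : t₁ ≤ a + T := ht₁I.2
    have i1 : IntegrableOn (fun t => dirichlet G (ω t) B (fun x => η x * max (l - u t x) 0))
        (Icc t₁ (a + T)) := by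
      rw [← intervalIntegrable_iff_integrableOn_Icc_of_le hte]
      exact (hu.intervalIntegrable_sum (F := fun r x y =>
          (η y * max (l - u r y) 0 - η x * max (l - u r x) 0) ^ 2) (fun x hx y hy => by
        have := hmax x hx; have := hmax y hy; fun_prop) ht₁I
          ⟨by linarith, le_rfl⟩).const_mul (1 / 2)
    rw [integral_const_mul, one_div, inv_mul_le_iff₀ hb]
    rw [intervalIntegral.integral_of_le hte, ← integral_Icc_eq_integral_Ioc] at h1
    have h3 := setIntegral_mono_set i1 (Filter.Eventually.of_forall hdir0)
      (LE.le.eventuallyLE (Icc_subset_Icc_left ht₁.2 : Icc (τ + T * Λ) (a + T) ⊆ _))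
    linarith

end Iteration

section Iteration

variable {G : SimpleGraph V} [G.LocallyFinite] {ω : ℝ → Sym2 V → ℝ} {x₀ : V} {B D : Finset V}
  {k a T p p' q q' ds A K₁ Ks β θ s σ m : ℝ} {u : ℝ → V → ℝ}

theorem Exponents.mul_σ_eq_two (E : Exponents p p' q q' ds β θ s σ m) : m * ds * σ = 2 := by
  have h1 := E.hds
  have h2 := E.hq
  have h3 : m * ds * (1 - 1 / q) = 2 * (m - 1) := by
    rw [← E.hmq]
    have : q - 1 ≠ 0 := by linarith
    field_simp
  have h4 : m * ds * (2 / ds) = 2 * m := by field_simp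
  rw [E.hσ, mul_sub, h3, h4]
  ring

theorem Exponents.s_pos (E : Exponents p p' q q' ds β θ s σ m) : 0 < s := by
  have := E.hq'
  rw [E.hs]; positivity

theorem Exponents.holderConjugate_s (E : Exponents p p' q q' ds β θ s σ m) :
    (1 / s).HolderConjugate (q' + 1) := by
  have := E.hq'
  rw [Real.holderConjugate_iff]
  have hs := E.hs
  constructor
  · rw [one_lt_div E.s_pos, hs, div_lt_one (by linarith)]; linarith
  · rw [one_div, inv_inv, hs]; field_simp

theorem density_mul_le_of_le {S : Finset V} (hS : S ⊆ B) {F : V → ℝ} (hF : ∀ x ∈ B, 0 ≤ F x)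
    {c : ℝ} (hc : ∀ x ∈ S, c ≤ F x) :
    density B S * c ≤ 1 / (B.card : ℝ) * ∑ x ∈ B, F x := by
  have h1 : (S.card : ℝ) * c ≤ ∑ x ∈ S, F x := by
    rw [← nsmul_eq_mul]
    exact Finset.card_nsmul_le_sum S F c hc
  have h2 : ∑ x ∈ S, F x ≤ ∑ x ∈ B, F x :=
    Finset.sum_le_sum_of_subset_of_nonneg hS fun x hx _ => hF x hx
  have h3 : density B S * c = 1 / (B.card : ℝ) * (S.card * c) := by unfold density; ring
  rw [h3]
  exact mul_le_mul_of_nonneg_left (h1.trans h2) (by positivity)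

theorem Frame.excess_step (F : Frame G ω x₀ B D k a T p p' q q' ds A K₁ Ks)
    (E : Exponents p p' q q' ds β θ s σ m)
    (hu : IsCaloric B D (fun t => conductance G (ω t)) a (a + T) u)
    (hu0 : ∀ t ∈ Icc a (a + T), ∀ x ∈ B, 0 ≤ u t x) {l r τ Λ : ℝ} (hl : l ≤ 1) (hr : r ≤ k)
    (hτ : a ≤ τ) (hΛ : 0 < Λ) (hΛ1 : Λ ≤ 1) (hτΛ : τ + T * Λ ≤ a + T) :
    excess G x₀ B u θ (a + T) T (r - k * Λ) (l - Λ) (τ + T * Λ) ≤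
      ((2 * (1 + K₁) * A + Ks ^ 2 * m ^ 2 * (1 + K₁) * A ^ 2) / Λ ^ 4 *
        excess G x₀ B u θ (a + T) T r l τ ^ (1 / β)) ^ (θ - s * σ + s) := by
  obtain ⟨hpt, hen⟩ := F.energy_step E hu hu0 hl hr hτ hΛ hΛ1 hτΛ
  have hT := F.T_pos
  have hk := F.k_pos
  have hkΛ : 0 < k * Λ := mul_pos hk hΛ
  have hTΛ : 0 < T * Λ := mul_pos hT hΛ
  have hA := F.A_nonneg
  have hK₁ : 0 ≤ K₁ := by
    by_contra h
    have := F.le_sq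
    nlinarith [pow_pos hk 2]
  have hs0 := E.s_pos
  have hσ0 := E.hσ0
  have hb : (0 : ℝ) < B.card := by exact_mod_cast F.nonempty.card_pos
  have hrr : r - k * Λ < r := by linarith
  have hJ : Icc (τ + T * Λ) (a + T) ⊆ Icc a (a + T) := Icc_subset_Icc_left (by linarith)
  set f : ℝ → V → ℝ := fun t x => cutoff G x₀ r (r - k * Λ) x * max (l - u t x) 0 with hf
  set S := fun t => sublevel G x₀ B u (r - k * Λ) (l - Λ) t with hS
  set Y := excess G x₀ B u θ (a + T) T r l τ with hY
  have hY0 : 0 ≤ Y := excess_nonneg hT.le _ _ _ _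
  have hYβ : 0 ≤ Y ^ (1 / β) := Real.rpow_nonneg hY0 _
  set M := (1 + K₁) / Λ ^ 2 * A * Y ^ (1 / β) with hM
  have hM0 : 0 ≤ M := by positivity
  set e := fun t => 1 / (B.card : ℝ) * dirichlet G (ω t) B (f t) with he
  set N := fun t => lpMean q B (fun x => max 1 (nu G (ω t) x)) with hN
  have he0 : ∀ t, 0 ≤ e t := fun t =>
    mul_nonneg (by positivity) (dirichlet_nonneg (F.weight.pos t) _ _)
  have hN0 : ∀ t, 0 ≤ N t := fun t => lpMean_nonneg fun x _ => zero_le_one.trans (le_max_left _ _)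
  have hf0 : ∀ t x, 0 ≤ f t x := fun t x => mul_nonneg (cutoff_nonneg _ _ _ _ _) (le_max_right _ _)
  have hfcont : ∀ x ∈ B, Continuous fun t => f t x := fun x hx => by
    have := hu.cont x hx
    simp only [hf]
    fun_prop
  have hfS : ∀ t, ∀ x ∈ S t, Λ ≤ f t x := fun t x hx => by
    obtain ⟨_, hxr, hxl⟩ := mem_sublevel.1 hx
    simp only [hf]
    rw [cutoff_eq_one hrr hxr.le, one_mul]
    exact le_max_of_le_left (by linarith)
  have hSB : ∀ t, S t ⊆ B := fun t => sublevel_subset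
  have hSm := fun x hx => measurableSet_mem_sublevel (G := G) (x₀ := x₀) (r := r - k * Λ)
    (l := l - Λ) hu.cont x hx
  have hd0 : ∀ t, 0 ≤ density B (S t) := fun t => density_nonneg _ _
  have hcheb : ∀ t ∈ Icc (τ + T * Λ) (a + T), density B (S t) ≤ 2 * M / Λ ^ 2 := by
    intro t ht
    rw [le_div_iff₀ (by positivity)]
    refine (density_mul_le_of_le (hSB t) (F := fun x => f t x ^ 2) (fun x _ => sq_nonneg _)
      fun x hx => pow_le_pow_left₀ hΛ.le (hfS t x hx) 2).trans (hpt t ht)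
  have hsob : ∀ t, density B (S t) ^ σ ≤ Ks ^ 2 * m ^ 2 * k ^ 2 / Λ ^ 2 * (e t * N t) := by
    intro t
    have h1 := weighted_sobolev (F.weight.pos t) F.nonempty (hf0 t) E.hm E.hq E.hmq E.hσ hσ0
      (F.sob (fun x => f t x ^ m) (fun x => Real.rpow_nonneg (hf0 t x) _) fun x hx => by
        have h2 : f t x = 0 := by
          simp only [hf]
          rw [cutoff_eq_zero hrr (hr.trans hx), zero_mul]
        have hm0 : m ≠ 0 := by linarith [E.hm]
        simp only [h2, Real.zero_rpow hm0])
    have h2 := density_mul_le_of_le (hSB t) (F := fun x => f t x ^ (m * ds)) (c := Λ ^ (m * ds))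
      (fun x _ => Real.rpow_nonneg (hf0 t x) _) fun x hx =>
        Real.rpow_le_rpow hΛ.le (hfS t x hx) (mul_nonneg (by linarith [E.hm]) E.hds.le)
    have h3 := Real.rpow_le_rpow (mul_nonneg (hd0 t) (Real.rpow_nonneg hΛ.le _)) h2 hσ0.le
    rw [Real.mul_rpow (hd0 t) (Real.rpow_nonneg hΛ.le _), ← Real.rpow_mul hΛ.le, E.mul_σ_eq_two,
      Real.rpow_two] at h3
    rw [div_mul_eq_mul_div, le_div_iff₀ (by positivity)]
    refine h3.trans (h1.trans (le_of_eq ?_))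
    simp only [he, hN, dirichlet]
    ring
  set C := Ks ^ 2 * m ^ 2 * k ^ 2 / Λ ^ 2 with hC
  have hC0 : 0 ≤ C := by positivity
  have hθσ : 0 ≤ θ - s * σ := sub_nonneg.2 E.hθσ
  have hprod : ∀ t ∈ Icc (τ + T * Λ) (a + T), density B (S t) ^ θ ≤
      (2 * M / Λ ^ 2) ^ (θ - s * σ) * C ^ s * (e t ^ s * N t ^ s) := by
    intro t ht
    have e1 : density B (S t) ^ θ =
        density B (S t) ^ (θ - s * σ) * (density B (S t) ^ σ) ^ s := by
      rw [← Real.rpow_mul (hd0 t), mul_comm σ s,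
        ← Real.rpow_add_of_nonneg (hd0 t) hθσ (by positivity), sub_add_cancel]
    have e2 : C ^ s * (e t ^ s * N t ^ s) = (C * (e t * N t)) ^ s := by
      rw [Real.mul_rpow hC0 (mul_nonneg (he0 t) (hN0 t)), Real.mul_rpow (he0 t) (hN0 t)]
    rw [e1, mul_assoc, e2]
    exact mul_le_mul (Real.rpow_le_rpow (hd0 t) (hcheb t ht) hθσ)
      (Real.rpow_le_rpow (Real.rpow_nonneg (hd0 t) _) (hsob t) hs0.le)
      (Real.rpow_nonneg (Real.rpow_nonneg (hd0 t) _) _) (Real.rpow_nonneg (by positivity) _)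
  have hemeas : Measurable e := (F.weight.measurable_dirichlet hfcont).const_mul _
  have hei : IntegrableOn e (Icc (τ + T * Λ) (a + T)) := by
    rw [← intervalIntegrable_iff_integrableOn_Icc_of_le hτΛ]
    exact ((hu.intervalIntegrable_sum (F := fun r x y => (f r y - f r x) ^ 2)
      (fun x hx y hy => by
        have := hfcont x hx; have := hfcont y hy; fun_prop)
      (hJ ⟨le_rfl, hτΛ⟩) (hJ ⟨hτΛ, le_rfl⟩)).const_mul (1 / 2)).const_mul _
  have hq'0 : 0 < q' + 1 := by linarith [E.hq']
  have ee : ∀ t, (e t ^ s) ^ (1 / s) = e t := fun t => by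
    rw [← Real.rpow_mul (he0 t), mul_one_div_cancel hs0.ne', Real.rpow_one]
  have hsq' : s * (q' + 1) = q' := by rw [E.hs]; field_simp
  have eN : ∀ t, (N t ^ s) ^ (q' + 1) = N t ^ q' := fun t => by
    rw [← Real.rpow_mul (hN0 t), hsq']
  have hNi : IntegrableOn (fun t => N t ^ q') (Icc (τ + T * Λ) (a + T)) :=
    F.nu_bound.integrable.mono_set hJ
  obtain ⟨hi, hH⟩ := integral_mul_le_rpow_integral (μ := volume.restrict (Icc (τ + T * Λ) (a + T)))
    E.holderConjugate_s (f := fun t => e t ^ s) (g := fun t => N t ^ s) (hemeas.pow_const s)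
    (F.nu_bound.measurable_lpMean.pow_const s) (fun t => Real.rpow_nonneg (he0 t) _)
    (fun t => Real.rpow_nonneg (hN0 t) _) (by simpa only [ee, IntegrableOn] using hei)
    (by simpa only [eN, IntegrableOn] using hNi)
  simp only [ee, eN, one_div_one_div] at hH
  have hIe0 : 0 ≤ ∫ t in Icc (τ + T * Λ) (a + T), e t := integral_nonneg he0
  have hIN0 : 0 ≤ ∫ t in Icc (τ + T * Λ) (a + T), N t ^ q' :=
    integral_nonneg fun t => Real.rpow_nonneg (hN0 t) _
  have hIN : ∫ t in Icc (τ + T * Λ) (a + T), N t ^ q' ≤ T * A ^ q' := by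
    have h1 := (setIntegral_mono_set F.nu_bound.integrable (Filter.Eventually.of_forall fun t =>
      Real.rpow_nonneg (hN0 t) _) (LE.le.eventuallyLE hJ)).trans F.nu_bound.bound
    rwa [add_sub_cancel_left] at h1
  have hINs : (∫ t in Icc (τ + T * Λ) (a + T), N t ^ q') ^ (1 / (q' + 1)) ≤
      T * (A / T) ^ s := by
    refine (Real.rpow_le_rpow hIN0 hIN (by positivity)).trans (le_of_eq ?_)
    have h1 : 1 / (q' + 1) = 1 - s := by rw [E.hs]; field_simp; ring
    have h2 : q' * (1 / (q' + 1)) = s := by rw [E.hs]; ring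
    rw [Real.mul_rpow hT.le (Real.rpow_nonneg hA _), ← Real.rpow_mul hA, h2, h1,
      Real.rpow_sub hT, Real.rpow_one, Real.div_rpow hA hT.le]
    ring
  have hIes : (∫ t in Icc (τ + T * Λ) (a + T), e t) ^ s ≤ M ^ s :=
    Real.rpow_le_rpow hIe0 hen hs0.le
  have hfinal : excess G x₀ B u θ (a + T) T (r - k * Λ) (l - Λ) (τ + T * Λ) ≤
      (2 * M / Λ ^ 2) ^ (θ - s * σ) * (C * M * (A / T)) ^ s := by
    unfold excess
    have h1 : ∫ t in Icc (τ + T * Λ) (a + T), density B (S t) ^ θ ≤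
        (2 * M / Λ ^ 2) ^ (θ - s * σ) * C ^ s * (M ^ s * (T * (A / T) ^ s)) := by
      refine (setIntegral_mono_on ((integrableOn_density_rpow hSB hSm E.θ_pos.le _ _))
        (hi.const_mul _) measurableSet_Icc hprod).trans ?_
      rw [integral_const_mul]
      refine mul_le_mul_of_nonneg_left (hH.trans ?_)
        (mul_nonneg (Real.rpow_nonneg (by positivity) _) (Real.rpow_nonneg hC0 _))
      exact mul_le_mul hIes hINs (Real.rpow_nonneg hIN0 _) (Real.rpow_nonneg hM0 _)
    rw [one_div, inv_mul_le_iff₀ hT]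
    refine h1.trans (le_of_eq ?_)
    rw [Real.mul_rpow (mul_nonneg hC0 hM0) (div_nonneg hA hT.le), Real.mul_rpow hC0 hM0]
    ring
  refine hfinal.trans ?_
  set Z := (2 * (1 + K₁) * A + Ks ^ 2 * m ^ 2 * (1 + K₁) * A ^ 2) / Λ ^ 4 * Y ^ (1 / β) with hZ
  have hZ0 : 0 ≤ Z := by positivity
  have hZ1 : 2 * M / Λ ^ 2 ≤ Z := by
    have e1 : 2 * M / Λ ^ 2 = 2 * (1 + K₁) * A / Λ ^ 4 * Y ^ (1 / β) := by
      rw [hM]; field_simp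
    rw [e1, hZ]
    gcongr
    have : 0 ≤ Ks ^ 2 * m ^ 2 * (1 + K₁) * A ^ 2 := by positivity
    linarith
  have hZ2 : C * M * (A / T) ≤ Z := by
    have e1 : C * M * (A / T) =
        (Ks ^ 2 * m ^ 2 * (1 + K₁) * A ^ 2 / Λ ^ 4 * Y ^ (1 / β)) * (k ^ 2 / T) := by
      rw [hM, hC]; field_simp
    have h1 : k ^ 2 / T ≤ 1 := (div_le_one hT).2 F.sq_le
    have h2 : 0 ≤ Ks ^ 2 * m ^ 2 * (1 + K₁) * A ^ 2 / Λ ^ 4 * Y ^ (1 / β) := by positivity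
    rw [e1, hZ]
    refine (mul_le_of_le_one_right h2 h1).trans ?_
    gcongr
    have : 0 ≤ 2 * (1 + K₁) * A := by positivity
    linarith
  rw [Real.rpow_add_of_nonneg hZ0 hθσ hs0.le]
  exact mul_le_mul (Real.rpow_le_rpow (by positivity) hZ1 hθσ)
    (Real.rpow_le_rpow (by positivity) hZ2 hs0.le) (Real.rpow_nonneg (by positivity) _)
    (Real.rpow_nonneg hZ0 _)

end Iteration

theorem exists_tendsto_zero_of_superlinear_recursion {K d κ : ℝ} (hK : 0 < K) (hd : 1 < d)
    (hκ : 1 < κ) :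
    ∃ δ > 0, ∀ Y : ℕ → ℝ, (∀ j, 0 ≤ Y j) → Y 0 ≤ δ →
      (∀ j, Y (j + 1) ≤ K * d ^ j * Y j ^ κ) → Filter.Tendsto Y Filter.atTop (nhds 0) := by
  have hκ1 : 0 < κ - 1 := sub_pos.2 hκ
  have hd0 : 0 < d := zero_lt_one.trans hd
  set ρ := d ^ (-1 / (κ - 1)) with hρ
  have hρ0 : 0 < ρ := Real.rpow_pos_of_pos hd0 _
  have hρ1 : ρ < 1 := Real.rpow_lt_one_of_one_lt_of_neg hd
    (div_neg_of_neg_of_pos (by norm_num) hκ1)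
  set δ := (ρ / K) ^ (1 / (κ - 1)) with hδ
  have hδ0 : 0 < δ := Real.rpow_pos_of_pos (div_pos hρ0 hK) _
  refine ⟨δ, hδ0, fun Y hY0 hYδ hrec => ?_⟩
  have hρd : d * ρ ^ (κ - 1) = 1 := by
    rw [hρ, ← Real.rpow_mul hd0.le, div_mul_cancel₀ _ hκ1.ne', Real.rpow_neg_one,
      mul_inv_cancel₀ hd0.ne']
  have hKδ : K * δ ^ (κ - 1) = ρ := by
    rw [hδ, ← Real.rpow_mul (div_pos hρ0 hK).le, one_div_mul_cancel hκ1.ne', Real.rpow_one,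
      mul_div_cancel₀ _ hK.ne']
  have key : ∀ j, Y j ≤ δ * ρ ^ j := by
    intro j
    induction j with
    | zero => simpa using hYδ
    | succ j ih =>
      have hpos : 0 < δ * ρ ^ j := by positivity
      have e1 : (δ * ρ ^ j) ^ κ = δ * ρ ^ j * (δ ^ (κ - 1) * (ρ ^ (κ - 1)) ^ j) := by
        have : (δ * ρ ^ j) ^ κ = (δ * ρ ^ j) * (δ * ρ ^ j) ^ (κ - 1) := by
          rw [Real.rpow_sub_one hpos.ne', mul_div_cancel₀ _ hpos.ne']
        rw [this, Real.mul_rpow hδ0.le (pow_pos hρ0 j).le, ← Real.rpow_natCast_mul hρ0.le,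
          ← Real.rpow_mul_natCast hρ0.le, mul_comm (j : ℝ)]
      calc Y (j + 1) ≤ K * d ^ j * Y j ^ κ := hrec j
        _ ≤ K * d ^ j * (δ * ρ ^ j) ^ κ := by
            have := Real.rpow_le_rpow (hY0 j) ih (by linarith : 0 ≤ κ)
            gcongr
        _ = δ * ρ ^ j * (K * δ ^ (κ - 1)) * (d * ρ ^ (κ - 1)) ^ j := by rw [e1, mul_pow]; ring
        _ = δ * ρ ^ (j + 1) := by rw [hKδ, hρd, one_pow]; ring
  refine squeeze_zero hY0 key ?_
  simpa using (tendsto_pow_atTop_nhds_zero_of_lt_one hρ0.le hρ1).const_mul δ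

/-- De Giorgi's first lemma: a nonnegative solution that is below `1` only on a small proportion
of the cylinder is at least `1 / 2` on a smaller cylinder. -/
theorem exists_deGiorgi_constant {p p' q q' ds A K₁ Ks β θ s σ m : ℝ}
    (E : Exponents p p' q q' ds β θ s σ m) (hK₁ : 0 ≤ K₁) (hA : 0 ≤ A) :
    ∃ δ > 0, ∀ (V : Type*) (G : SimpleGraph V) [G.LocallyFinite] (ω : ℝ → Sym2 V → ℝ) (x₀ : V)
      (B D : Finset V) (k a T : ℝ) (_ : Frame G ω x₀ B D k a T p p' q q' ds A K₁ Ks)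
      (u : ℝ → V → ℝ) (_ : IsCaloric B D (fun t => conductance G (ω t)) a (a + T) u)
      (_ : ∀ t ∈ Icc a (a + T), ∀ x ∈ B, 0 ≤ u t x)
      (_ : ∫ t in Icc a (a + T), density B (sublevel G x₀ B u k 1 t) ≤ δ * T),
      ∀ t ∈ Icc (a + T / 2) (a + T), ∀ x, (G.dist x₀ x : ℝ) ≤ k / 2 → 1 / 2 ≤ u t x := by
  set W := 2 * (1 + K₁) * A + Ks ^ 2 * m ^ 2 * (1 + K₁) * A ^ 2 with hW
  have hW0 : 0 ≤ W := by positivity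
  set κ := θ - s * σ + s with hκ
  have hβ0 := E.hβ.symm.pos
  have hκβ : β < κ := E.hκ
  have hκ0 : 0 < κ := hβ0.trans hκβ
  obtain ⟨δ, hδ, hrec⟩ := exists_tendsto_zero_of_superlinear_recursion
    (K := (256 * W + 1) ^ κ) (d := (16 : ℝ) ^ κ) (κ := κ / β)
    (Real.rpow_pos_of_pos (by positivity) _) (Real.one_lt_rpow (by norm_num) hκ0)
    ((one_lt_div hβ0).2 hκβ)
  have hθ := E.θ_pos
  set ℓ := (δ / 2) ^ (1 / θ) with hℓ
  have hℓ0 : 0 < ℓ := Real.rpow_pos_of_pos (by positivity) _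
  have hℓθ : ℓ ^ θ = δ / 2 := by
    rw [hℓ, ← Real.rpow_mul (by positivity), one_div_mul_cancel hθ.ne', Real.rpow_one]
  set C := max 1 (ℓ ^ (θ - 1)) with hC
  have hC0 : 0 < C := lt_max_of_lt_left one_pos
  refine ⟨δ / (2 * C), by positivity, ?_⟩
  intro V G _ ω x₀ B D k a T F u hu hu0 hbad
  have hT := F.T_pos
  have hb : (0 : ℝ) < B.card := by exact_mod_cast F.nonempty.card_pos
  set lv : ℕ → ℝ := fun j => (1 + (1 / 2) ^ j) / 2 with hlv
  have hlv1 : ∀ j, lv j ≤ 1 := fun j => by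
    have : (1 / 2 : ℝ) ^ j ≤ 1 := pow_le_one₀ (by norm_num) (by norm_num)
    simp only [hlv]; linarith
  have hlvhalf : ∀ j, 1 / 2 < lv j := fun j => by
    have : (0 : ℝ) < (1 / 2 : ℝ) ^ j := by positivity
    simp only [hlv]; linarith
  have hlvs : ∀ j, lv (j + 1) = lv j - (1 / 2) ^ (j + 2) := fun j => by
    simp only [hlv]; ring
  set Y : ℕ → ℝ := fun j => excess G x₀ B u θ (a + T) T (k * lv j) (lv j) (a + T - T * lv j)
    with hY
  have hY0 : ∀ j, 0 ≤ Y j := fun j => excess_nonneg hT.le _ _ _ _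
  have hSB : ∀ r l t, sublevel G x₀ B u r l t ⊆ B := fun r l t => sublevel_subset
  have hstep : ∀ j, Y (j + 1) ≤ (256 * W + 1) ^ κ * ((16 : ℝ) ^ κ) ^ j * Y j ^ (κ / β) := by
    intro j
    have h1 := F.excess_step E hu hu0 (l := lv j) (r := k * lv j) (τ := a + T - T * lv j)
      (Λ := (1 / 2) ^ (j + 2)) (hlv1 j) (mul_le_of_le_one_right F.k_pos.le (hlv1 j))
      (by nlinarith [hlv1 j]) (by positivity) (pow_le_one₀ (by norm_num) (by norm_num))
      (by
        have := hlvhalf (j + 1)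
        rw [hlvs] at this
        nlinarith)
    have e1 : k * lv j - k * (1 / 2) ^ (j + 2) = k * lv (j + 1) := by rw [hlvs]; ring
    have e2 : a + T - T * lv j + T * (1 / 2) ^ (j + 2) = a + T - T * lv (j + 1) := by
      rw [hlvs]; ring
    rw [e1, e2, ← hlvs] at h1
    refine h1.trans ?_
    have hYβ : 0 ≤ Y j ^ (1 / β) := Real.rpow_nonneg (hY0 j) _
    have e3 : (256 * W + 1) ^ κ * ((16 : ℝ) ^ κ) ^ j * Y j ^ (κ / β) =
        ((256 * W + 1) * 16 ^ j * Y j ^ (1 / β)) ^ κ := by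
      rw [Real.mul_rpow (by positivity) hYβ, Real.mul_rpow (by positivity) (by positivity),
        ← Real.rpow_mul (hY0 j), ← Real.rpow_natCast, ← Real.rpow_natCast,
        ← Real.rpow_mul (by norm_num), ← Real.rpow_mul (by norm_num), mul_comm κ (j : ℝ)]
      congr 2
      ring
    rw [e3]
    refine Real.rpow_le_rpow (by positivity) ?_ hκ0.le
    refine mul_le_mul_of_nonneg_right ?_ hYβ
    have e4 : W / ((1 / 2 : ℝ) ^ (j + 2)) ^ 4 = 256 * W * 16 ^ j := by
      have : ((1 / 2 : ℝ) ^ (j + 2)) ^ 4 = 1 / (256 * 16 ^ j) := by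
        rw [← pow_mul, one_div, inv_pow, one_div, show (j + 2) * 4 = 4 * j + 8 by ring, pow_add,
          pow_mul]
        norm_num
        ring
      rw [this]
      field_simp
    rw [e4]
    gcongr
    linarith
  have hmeas0 := fun x hx => measurableSet_mem_sublevel (G := G) (x₀ := x₀) (r := k) (l := 1)
    hu.cont x hx
  have hstart : Y 0 ≤ δ := by
    have e0 : lv 0 = 1 := by simp [hlv]
    have e1 : Y 0 = 1 / T * ∫ t in Icc a (a + T), density B (sublevel G x₀ B u k 1 t) ^ θ := by
      simp only [hY, excess, e0, mul_one, add_sub_cancel_right]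
    have hpt : ∀ t, density B (sublevel G x₀ B u k 1 t) ^ θ ≤
        δ / 2 + C * density B (sublevel G x₀ B u k 1 t) := by
      intro t
      set y := density B (sublevel G x₀ B u k 1 t) with hy
      have hy0 : 0 ≤ y := density_nonneg _ _
      have hy1 : y ≤ 1 := density_le_one (hSB _ _ _)
      rcases le_or_gt y ℓ with h | h
      · have := Real.rpow_le_rpow hy0 h hθ.le
        rw [hℓθ] at this
        have : 0 ≤ C * y := by positivity
        linarith
      · have hy0' : 0 < y := hℓ0.trans h
        have h1 : y ^ θ = y ^ (θ - 1) * y := by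
          rw [Real.rpow_sub_one hy0'.ne', div_mul_cancel₀ _ hy0'.ne']
        have h2 : y ^ (θ - 1) ≤ C := by
          rcases le_total 1 θ with h3 | h3
          · exact le_max_of_le_left (Real.rpow_le_one hy0 hy1 (by linarith))
          · exact le_max_of_le_right (Real.rpow_le_rpow_of_nonpos hℓ0 h.le (by linarith))
        rw [h1]
        have := mul_le_mul_of_nonneg_right h2 hy0
        linarith
    have i0 : IntegrableOn (fun t => density B (sublevel G x₀ B u k 1 t)) (Icc a (a + T)) := by
      have := integrableOn_density_rpow (B := B) (hSB k 1) hmeas0 zero_le_one a (a + T)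
      simpa only [Real.rpow_one] using this
    rw [e1, one_div, inv_mul_le_iff₀ hT]
    refine (integral_mono (integrableOn_density_rpow (hSB k 1) hmeas0 hθ.le a (a + T))
      ((integrable_const (δ / 2)).add (i0.const_mul C)) hpt).trans ?_
    rw [integral_add' (integrable_const _) (i0.const_mul C), integral_const_mul]
    simp only [integral_const, measureReal_restrict_apply_univ,
      Real.volume_real_Icc_of_le (by linarith : a ≤ a + T), add_sub_cancel_left, smul_eq_mul]
    have h2 := mul_le_mul_of_nonneg_left hbad hC0.le
    have h3 : C * (δ / (2 * C) * T) = T * (δ / 2) := by field_simp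
    linarith
  have hlim := hrec Y hY0 hstart hstep
  intro t ht x hx
  have hxB : x ∈ B := F.sub (F.near x (by linarith [F.k_pos]))
  have hopen : ∀ r ∈ Ioo (a + T / 2) (a + T), 1 / 2 ≤ u r x := by
    intro r₀ hr₀
    by_contra hlt
    rw [not_le] at hlt
    set U := Ioo (a + T / 2) (a + T) ∩ {r | u r x < 1 / 2} with hU
    have hUo : IsOpen U := isOpen_Ioo.inter (isOpen_lt (hu.cont x hxB) continuous_const)
    have hUpos : 0 < volume U := hUo.measure_pos volume ⟨r₀, hr₀, hlt⟩
    have hUfin : volume U ≠ ⊤ := ((measure_mono inter_subset_left).trans_lt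
      (by simp : volume (Ioo (a + T / 2) (a + T)) < ⊤)).ne
    have hUreal : 0 < volume.real U := ENNReal.toReal_pos hUpos.ne' hUfin
    have hlow : ∀ j, 1 / T * (volume.real U * (1 / (B.card : ℝ)) ^ θ) ≤ Y j := by
      intro j
      have hmj := fun x hx => measurableSet_mem_sublevel (G := G) (x₀ := x₀) (r := k * lv j)
        (l := lv j) hu.cont x hx
      have hij : IntegrableOn (fun t => density B (sublevel G x₀ B u (k * lv j) (lv j) t) ^ θ)
          (Icc (a + T - T * lv j) (a + T)) :=
        integrableOn_density_rpow (hSB _ _) hmj hθ.le _ _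
      have hsub : U ⊆ Icc (a + T - T * lv j) (a + T) := fun r hr =>
        ⟨by nlinarith [hr.1.1, hlvhalf j], hr.1.2.le⟩
      refine mul_le_mul_of_nonneg_left ?_ (by positivity)
      calc volume.real U * (1 / (B.card : ℝ)) ^ θ = ∫ _ in U, (1 / (B.card : ℝ)) ^ θ := by
            simp
        _ ≤ ∫ t in U, density B (sublevel G x₀ B u (k * lv j) (lv j) t) ^ θ := by
            refine setIntegral_mono_on (integrableOn_const hUfin) (hij.mono_set hsub)
              hUo.measurableSet fun r hr => ?_
            refine Real.rpow_le_rpow (by positivity) ?_ hθ.le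
            unfold density
            refine div_le_div_of_nonneg_right ?_ hb.le
            have : x ∈ sublevel G x₀ B u (k * lv j) (lv j) r := mem_sublevel.2 ⟨hxB,
              by nlinarith [hlvhalf j, F.k_pos], by have := hr.2; have := hlvhalf j
                                                    simp only [mem_ofPred_eq] at *; linarith⟩
            exact_mod_cast Finset.card_pos.2 ⟨x, this⟩
        _ ≤ _ := setIntegral_mono_set hij (Filter.Eventually.of_forall fun t =>
            Real.rpow_nonneg (density_nonneg _ _) _) (LE.le.eventuallyLE hsub)
    have h1 := ge_of_tendsto' hlim hlow
    have h2 : 0 < 1 / T * (volume.real U * (1 / (B.card : ℝ)) ^ θ) := by positivity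
    linarith
  have hcl : t ∈ closure (Ioo (a + T / 2) (a + T)) := by
    rw [closure_Ioo (by linarith)]; exact ht
  have hclosed : IsClosed {r | 1 / 2 ≤ u r x} := isClosed_le continuous_const (hu.cont x hxB)
  exact closure_minimal (fun r hr => hopen r hr) hclosed hcl

theorem MixedBound.integral_mean_le {p p' : ℝ} {B : Finset V} {a e : ℝ} {g : ℝ → V → ℝ}
    {A : ℝ} (h : MixedBound p p' B a e g A) (hp : 1 < p) (hp' : 1 ≤ p') (hB : B.Nonempty)
    (hA : 0 < A) (hae : a ≤ e) :
    IntegrableOn (fun t => 1 / (B.card : ℝ) * ∑ x ∈ B, g t x) (Icc a e) ∧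
    ∫ t in Icc a e, 1 / (B.card : ℝ) * ∑ x ∈ B, g t x ≤ (e - a) * A := by
  have hb : (0 : ℝ) < B.card := by exact_mod_cast hB.card_pos
  have hp'0 : 0 < p' := by linarith
  have hN0 : ∀ t, 0 ≤ lpMean p B (g t) := fun t => lpMean_nonneg fun x _ => h.nonneg t x
  have hpt : ∀ t, 1 / (B.card : ℝ) * ∑ x ∈ B, g t x ≤
      A * (1 - 1 / p') + A * (1 / p' / A ^ p') * lpMean p B (g t) ^ p' := by
    intro t
    have h1 := mean_le_lpMean_mul_density hp hB (Finset.Subset.refl B)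
      fun x _ => h.nonneg t x
    have h2 : density B B = 1 := div_self hb.ne'
    rw [h2, Real.one_rpow, mul_one] at h1
    refine h1.trans ?_
    have h3 := one_add_mul_self_le_rpow_one_add (s := lpMean p B (g t) / A - 1)
      (by have := div_nonneg (hN0 t) hA.le; linarith) hp'
    rw [add_sub_cancel, Real.div_rpow (hN0 t) hA.le] at h3
    have h4 : lpMean p B (g t) = A * (1 - 1 / p') +
        A * (1 / p') * (1 + p' * (lpMean p B (g t) / A - 1)) := by field_simp; ring
    have h5 := mul_le_mul_of_nonneg_left h3 (by positivity : 0 ≤ A * (1 / p'))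
    have h6 : A * (1 / p' / A ^ p') * lpMean p B (g t) ^ p' =
        A * (1 / p') * (lpMean p B (g t) ^ p' / A ^ p') := by ring
    rw [h6]
    linarith
  have hri : IntegrableOn (fun t => A * (1 - 1 / p') +
      A * (1 / p' / A ^ p') * lpMean p B (g t) ^ p') (Icc a e) :=
    (integrable_const _).add (h.integrable.const_mul _)
  have hm : Measurable fun t => 1 / (B.card : ℝ) * ∑ x ∈ B, g t x :=
    (Finset.measurable_fun_sum B h.meas).const_mul _
  have hi : IntegrableOn (fun t => 1 / (B.card : ℝ) * ∑ x ∈ B, g t x) (Icc a e) := by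
    refine hri.mono' hm.aestronglyMeasurable (Filter.Eventually.of_forall fun t => ?_)
    rw [Real.norm_of_nonneg (mul_nonneg (by positivity)
      (Finset.sum_nonneg fun x _ => h.nonneg t x))]
    exact hpt t
  refine ⟨hi, (integral_mono hi hri hpt).trans ?_⟩
  rw [integral_add (integrable_const _) (h.integrable.const_mul _),
    integral_const_mul (A * (1 / p' / A ^ p'))]
  simp only [integral_const, measureReal_restrict_apply_univ,
    Real.volume_real_Icc_of_le hae, smul_eq_mul]
  have h7 := mul_le_mul_of_nonneg_left h.bound
    (mul_nonneg hA.le (div_nonneg (by positivity) (Real.rpow_nonneg hA.le p')) :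
      0 ≤ A * (1 / p' / A ^ p'))
  have hAp : 0 < A ^ p' := Real.rpow_pos_of_pos hA _
  have h8 : A * (1 / p' / A ^ p') * ((e - a) * A ^ p') = A * (1 / p') * (e - a) := by
    field_simp
  have h9 : (e - a) * (A * (1 - 1 / p')) + A * (1 / p') * (e - a) = (e - a) * A := by ring
  linarith

theorem sum_conductance_mul_cutoff_sq_le {G : SimpleGraph V} [G.LocallyFinite]
    (hG : G.Connected) {w : Sym2 V → ℝ} (hw : ∀ e ∈ G.edgeSet, 0 < w e) (x₀ : V) (B : Finset V)
    {r r' : ℝ} (h : r' < r) :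
    ∑ x ∈ B, ∑ y ∈ B, conductance G w x y * (cutoff G x₀ r r' y - cutoff G x₀ r r' x) ^ 2 ≤
      (1 / (r - r')) ^ 2 * ∑ x ∈ B, max 1 (mu G w x) := by
  rw [Finset.mul_sum]
  refine Finset.sum_le_sum fun x _ => ?_
  refine (Finset.sum_le_sum fun y _ => conductance_mul_cutoff_sq_le hG hw x₀ h x y).trans ?_
  rw [← Finset.mul_sum]
  exact mul_le_mul_of_nonneg_left ((conductance_le_mu hw B x).trans (le_max_right _ _))
    (sq_nonneg _)

theorem abs_le_weighted {c d Λ : ℝ} (hc : 0 < c) (hΛ : 0 < Λ) :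
    |d| ≤ Λ / 2 * (c * d ^ 2) + 1 / (2 * Λ) * c⁻¹ := by
  have h1 : 0 ≤ (Λ * c * |d| - 1) ^ 2 / (2 * Λ * c) := by positivity
  have h2 : (Λ * c * |d| - 1) ^ 2 / (2 * Λ * c) =
      Λ / 2 * (c * d ^ 2) + 1 / (2 * Λ) * c⁻¹ - |d| := by
    rw [← sq_abs d]; field_simp; ring
  linarith

theorem conductance_one_mul_abs_le {G : SimpleGraph V} {w : Sym2 V → ℝ} (hw : ∀ e ∈ G.edgeSet, 0 < w e) {Λ : ℝ}
    (hΛ : 0 < Λ) (x y : V) (d : ℝ) :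
    conductance G (fun _ => 1) x y * |d| ≤
      Λ / 2 * (conductance G w x y * d ^ 2) + 1 / (2 * Λ) * (conductance G w x y)⁻¹ := by
  by_cases h : G.Adj x y
  · simpa [conductance, h] using abs_le_weighted (d := d) (hw _ h) hΛ
  · simp [conductance, h]

section LogEstimates

variable {G : SimpleGraph V} [G.LocallyFinite] {ω : ℝ → Sym2 V → ℝ} {x₀ : V} {B D : Finset V}
  {k a T p p' q q' ds A K₁ Ks β θ s σ m : ℝ} {u : ℝ → V → ℝ}

/-- The estimate for `-log (u + ε)` between the initial time and a time `t`. -/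
theorem Frame.log_estimate (F : Frame G ω x₀ B D k a T p p' q q' ds A K₁ Ks)
    (hp : 1 < p) (hp' : 1 ≤ p') (hA : 0 < A)
    (hu : IsCaloric B D (fun t => conductance G (ω t)) a (a + T) u)
    (hu0 : ∀ t ∈ Icc a (a + T), ∀ x ∈ B, 0 ≤ u t x) {R K₂ : ℝ} (hR0 : 0 < R)
    (hR : ∀ x, (G.dist x₀ x : ℝ) < R → x ∈ D) (hTR : T ≤ K₂ * R ^ 2) {ε : ℝ} (hε : 0 < ε)
    {t : ℝ} (ht : t ∈ Icc a (a + T)) :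
    ∑ x ∈ B, cutoff G x₀ R (R / 2) x ^ 2 * (Real.log 3 - Real.log (u t x + ε)) +
        ∫ r in a..t, 1 / 4 * ∑ x ∈ B, ∑ y ∈ B, conductance G (ω r) x y *
          (min (cutoff G x₀ R (R / 2) x) (cutoff G x₀ R (R / 2) y) ^ 2 *
            (Real.log (max ε (u r y + ε)) - Real.log (max ε (u r x + ε))) ^ 2) ≤
      ∑ x ∈ B, cutoff G x₀ R (R / 2) x ^ 2 * (Real.log 3 - Real.log (u a x + ε)) +
        10 * K₂ * A * B.card := by
  have hT := F.T_pos
  have hb : (0 : ℝ) < B.card := by exact_mod_cast F.nonempty.card_pos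
  have hRR : R / 2 < R := by linarith
  have haI : a ∈ Icc a (a + T) := ⟨le_rfl, by linarith⟩
  have hw : IsCaloric B D (fun t => conductance G (ω t)) a (a + T) fun t x => u t x + ε := by
    simpa only [one_mul] using hu.affine 1 ε
  set η := cutoff G x₀ R (R / 2) with hη
  have hlog := hw.log_estimate (η := η) (fun x hx => cutoff_eq_zero hRR
    (not_lt.1 fun h => hx (hR x h))) (cutoff_nonneg _ _ _ _) hε
    (fun t ht x hx => by linarith [hu0 t ht x hx]) haI ht ht.1
  obtain ⟨hmi, hmle⟩ := F.mu_bound.integral_mean_le hp hp' F.nonempty hA (by linarith)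
  rw [add_sub_cancel_left] at hmle
  have herr : ∫ r in a..t, 5 / 2 * ∑ x ∈ B, ∑ y ∈ B, conductance G (ω r) x y *
      (η y - η x) ^ 2 ≤ 10 * K₂ * A * B.card := by
    have hsub : Icc a t ⊆ Icc a (a + T) := Icc_subset_Icc_right ht.2
    have i1 := (hu.intervalIntegrable_sum (F := fun r x y => (η y - η x) ^ 2)
      (fun x hx y hy => by fun_prop) haI ht).const_mul (5 / 2)
    have i2 : IntervalIntegrable (fun r => 10 / R ^ 2 * B.card *
        (1 / (B.card : ℝ) * ∑ x ∈ B, max 1 (mu G (ω r) x))) volume a t :=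
      (intervalIntegrable_iff_integrableOn_Icc_of_le ht.1).2 ((hmi.mono_set hsub).const_mul _)
    refine (intervalIntegral.integral_mono_on ht.1 i1 i2 fun r _ => ?_).trans ?_
    · have h1 := sum_conductance_mul_cutoff_sq_le F.conn (F.weight.pos r) x₀ B hRR
      have h2 : 5 / 2 * ((1 / (R - R / 2)) ^ 2 * ∑ x ∈ B, max 1 (mu G (ω r) x)) =
          10 / R ^ 2 * B.card * (1 / (B.card : ℝ) * ∑ x ∈ B, max 1 (mu G (ω r) x)) := by
        rw [show R - R / 2 = R / 2 by ring]
        field_simp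
        ring
      rw [← h2]
      exact mul_le_mul_of_nonneg_left h1 (by norm_num)
    · rw [intervalIntegral.integral_const_mul, intervalIntegral.integral_of_le ht.1,
        ← integral_Icc_eq_integral_Ioc]
      have h3 : ∫ r in Icc a t, 1 / (B.card : ℝ) * ∑ x ∈ B, max 1 (mu G (ω r) x) ≤ T * A :=
        (setIntegral_mono_set hmi (Filter.Eventually.of_forall fun r => mul_nonneg
          (by positivity) (Finset.sum_nonneg fun x _ => zero_le_one.trans (le_max_left _ _)))
          (LE.le.eventuallyLE hsub)).trans hmle
      calc _ ≤ 10 / R ^ 2 * B.card * (T * A) := mul_le_mul_of_nonneg_left h3 (by positivity)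
        _ ≤ 10 / R ^ 2 * B.card * (K₂ * R ^ 2 * A) := by gcongr
        _ = _ := by field_simp
  have e : ∀ r, ∑ x ∈ B, η x ^ 2 * (Real.log 3 - Real.log (u r x + ε)) =
      ∑ x ∈ B, η x ^ 2 * -Real.log (u r x + ε) + ∑ x ∈ B, η x ^ 2 * Real.log 3 := fun r => by
    rw [← Finset.sum_add_distrib]
    exact Finset.sum_congr rfl fun x _ => by ring
  rw [e, e]
  linarith

/-- Positivity on half of the ball at the initial time propagates to all later times. -/
theorem Frame.card_superlevel_ge (F : Frame G ω x₀ B D k a T p p' q q' ds A K₁ Ks)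
    (hp : 1 < p) (hp' : 1 ≤ p') (hA : 0 < A)
    (hu : IsCaloric B D (fun t => conductance G (ω t)) a (a + T) u)
    (hu0 : ∀ t ∈ Icc a (a + T), ∀ x ∈ B, 0 ≤ u t x)
    (hu2 : ∀ t ∈ Icc a (a + T), ∀ x ∈ B, u t x ≤ 2) {c₀ : ℝ} (hc₀ : 0 < c₀)
    (hvol : c₀ * B.card ≤ ∑ x ∈ B, cutoff G x₀ k (k / 2) x ^ 2)
    (hstart : ∑ x ∈ B with u a x < 1, cutoff G x₀ k (k / 2) x ^ 2 ≤
      1 / 2 * ∑ x ∈ B, cutoff G x₀ k (k / 2) x ^ 2) {t : ℝ} (ht : t ∈ Icc a (a + T)) :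
    c₀ / 4 * B.card ≤ ((B.filter fun x => (G.dist x₀ x : ℝ) < k ∧
      3 * Real.exp (-(8 + 40 * K₁ * A / c₀)) ≤ u t x).card : ℝ) := by
  have hT := F.T_pos
  have hk := F.k_pos
  have hb : (0 : ℝ) < B.card := by exact_mod_cast F.nonempty.card_pos
  have hK₁ : 0 ≤ K₁ := by
    by_contra h
    have := F.le_sq
    nlinarith [pow_pos hk 2]
  set Lh := 8 + 40 * K₁ * A / c₀ with hLh
  have hK0 : 0 ≤ 10 * K₁ * A / c₀ := by positivity
  have hLh4 : Lh = 8 + 4 * (10 * K₁ * A / c₀) := by rw [hLh]; ring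
  set h := 3 * Real.exp (-Lh) with hh
  have hh0 : 0 < h := by positivity
  have hlogh : Real.log h = Real.log 3 - Lh := by
    rw [hh, Real.log_mul (by norm_num) (Real.exp_pos _).ne', Real.log_exp]; ring
  have hh1 : h ≤ 1 := by
    have h1 : 3 ≤ Real.exp Lh := by
      have := Real.add_one_le_exp Lh
      linarith
    rw [hh, Real.exp_neg, ← div_eq_mul_inv, div_le_one (Real.exp_pos _)]
    exact h1
  set η := cutoff G x₀ k (k / 2) with hη
  have hη0 : ∀ x, 0 ≤ η x := cutoff_nonneg _ _ _ _
  have haI : a ∈ Icc a (a + T) := ⟨le_rfl, by linarith⟩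
  have hest := F.log_estimate hp hp' hA hu hu0 hk F.near F.le_sq hh0 ht
  have hgrad : 0 ≤ ∫ r in a..t, 1 / 4 * ∑ x ∈ B, ∑ y ∈ B, conductance G (ω r) x y *
          (min (η x) (η y) ^ 2 *
            (Real.log (max h (u r y + h)) - Real.log (max h (u r x + h))) ^ 2) :=
    intervalIntegral.integral_nonneg ht.1 fun r _ => mul_nonneg (by norm_num)
      (Finset.sum_nonneg fun x _ => Finset.sum_nonneg fun y _ => mul_nonneg
        (conductance_nonneg (F.weight.pos r) x y) (by positivity))
  set S₁ := ∑ x ∈ B, η x ^ 2 with hS₁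
  set U := ∑ x ∈ B with u t x < h, η x ^ 2 with hU
  have hlog2 := Real.log_two_lt_d9
  have hlog20 : 0 < Real.log 2 := Real.log_pos (by norm_num)
  have hlog3 : Real.log 3 ≤ 2 * Real.log 2 := by
    rw [← Real.log_rpow (by norm_num)]
    exact Real.log_le_log (by norm_num) (by norm_num)
  have hlog30 : 0 < Real.log 3 := Real.log_pos (by norm_num)
  have hlow : U * (Lh - Real.log 2) ≤
      ∑ x ∈ B, η x ^ 2 * (Real.log 3 - Real.log (u t x + h)) := by
    rw [hU, Finset.sum_mul]
    calc _ ≤ ∑ x ∈ B with u t x < h, η x ^ 2 * (Real.log 3 - Real.log (u t x + h)) := by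
          refine Finset.sum_le_sum fun x hx => mul_le_mul_of_nonneg_left ?_ (sq_nonneg _)
          obtain ⟨hxB, hxh⟩ := Finset.mem_filter.1 hx
          have h1 : Real.log (u t x + h) ≤ Real.log (2 * h) :=
            Real.log_le_log (by linarith [hu0 t ht x hxB]) (by linarith)
          rw [Real.log_mul (by norm_num) hh0.ne'] at h1
          linarith
      _ ≤ _ := by
          refine Finset.sum_le_sum_of_subset_of_nonneg (Finset.filter_subset _ _) fun x hx _ => ?_
          refine mul_nonneg (sq_nonneg _) (sub_nonneg.2 ?_)
          exact Real.log_le_log (by linarith [hu0 t ht x hx]) (by linarith [hu2 t ht x hx])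
  have hup : ∑ x ∈ B, η x ^ 2 * (Real.log 3 - Real.log (u a x + h)) ≤
      S₁ * Real.log 3 + 1 / 2 * S₁ * Lh := by
    have h1 : ∀ x ∈ B, η x ^ 2 * (Real.log 3 - Real.log (u a x + h)) ≤
        η x ^ 2 * Real.log 3 + (if u a x < 1 then η x ^ 2 * Lh else 0) := by
      intro x hx
      have hux := hu0 a haI x hx
      split_ifs with h2
      · rw [← mul_add]
        refine mul_le_mul_of_nonneg_left ?_ (sq_nonneg _)
        have : Real.log h ≤ Real.log (u a x + h) := Real.log_le_log hh0 (by linarith)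
        linarith
      · rw [add_zero]
        refine mul_le_mul_of_nonneg_left ?_ (sq_nonneg _)
        have : 0 ≤ Real.log (u a x + h) := Real.log_nonneg (by linarith)
        linarith
    refine (Finset.sum_le_sum h1).trans ?_
    rw [Finset.sum_add_distrib, ← Finset.sum_mul, ← Finset.sum_filter, ← Finset.sum_mul]
    have : 0 ≤ Lh := by rw [hLh4]; linarith
    have := mul_le_mul_of_nonneg_right hstart this
    linarith
  have hS₁0 : 0 ≤ S₁ := Finset.sum_nonneg fun x _ => sq_nonneg _
  have hKS : 10 * K₁ * A * B.card ≤ 10 * K₁ * A / c₀ * S₁ := by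
    have h1 := mul_le_mul_of_nonneg_left hvol hK0
    have h2 : 10 * K₁ * A / c₀ * (c₀ * B.card) = 10 * K₁ * A * B.card := by field_simp
    linarith
  have hU34 : U ≤ 3 / 4 * S₁ := by
    have hpos : 0 < Lh - Real.log 2 := by rw [hLh4]; linarith
    have h1 : U * (Lh - Real.log 2) ≤ 3 / 4 * S₁ * (Lh - Real.log 2) := by
      have h2 : U * (Lh - Real.log 2) ≤
          S₁ * (Real.log 3 + 1 / 2 * Lh + 10 * K₁ * A / c₀) := by linarith
      refine h2.trans ?_
      have h3 : 3 / 4 * S₁ * (Lh - Real.log 2) = S₁ * (3 / 4 * (Lh - Real.log 2)) := by ring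
      rw [h3]
      refine mul_le_mul_of_nonneg_left ?_ hS₁0
      rw [hLh4]
      linarith
    exact le_of_mul_le_mul_right h1 hpos
  have hsplit : S₁ = U + ∑ x ∈ B with ¬ u t x < h, η x ^ 2 :=
    (Finset.sum_filter_add_sum_filter_not B _ _).symm
  have hcard : ∑ x ∈ B with ¬ u t x < h, η x ^ 2 ≤ ((B.filter fun x => (G.dist x₀ x : ℝ) < k ∧
      h ≤ u t x).card : ℝ) := by
    rw [Finset.card_eq_sum_ones, Nat.cast_sum, Finset.sum_filter, Finset.sum_filter]
    refine Finset.sum_le_sum fun x _ => ?_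
    have h1 : η x ^ 2 ≤ 1 := pow_le_one₀ (hη0 x) (cutoff_le_one _ _ _ _ _)
    by_cases hx : (G.dist x₀ x : ℝ) < k
    · by_cases h2 : u t x < h
      · simp [h2, not_le.2 h2]
      · simp [h2, hx, not_lt.1 h2, h1]
    · have : η x = 0 := cutoff_eq_zero (by linarith) (not_lt.1 hx)
      simp [this, hx]
  linarith

/-- Integrated Poincaré inequality for `log (3 / (u + ε))`. -/
theorem Frame.integral_log_le (F : Frame G ω x₀ B D k a T p p' q q' ds A K₁ Ks)
    (hp : 1 < p) (hp' : 1 ≤ p') (hq : 1 < q) (hq' : 1 ≤ q') (hA : 0 < A)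
    (hu : IsCaloric B D (fun t => conductance G (ω t)) a (a + T) u)
    (hu0 : ∀ t ∈ Icc a (a + T), ∀ x ∈ B, 0 ≤ u t x)
    (hu2 : ∀ t ∈ Icc a (a + T), ∀ x ∈ B, u t x ≤ 2) {c₀ h Lh : ℝ} (hc₀ : 0 < c₀) (hh : 0 < h)
    (hLh : Real.log 3 - Real.log h ≤ Lh) (hLh0 : 0 ≤ Lh) {Bk Bw : Finset V} (hBk : Bk ⊆ B)
    (hBw : Bw ⊆ B)
    (hmem : ∀ x ∈ B, (G.dist x₀ x : ℝ) < k → x ∈ Bk)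
    {R K₂ CP : ℝ} (hCP : 0 ≤ CP) (hR0 : 0 < R) (hR : ∀ x, (G.dist x₀ x : ℝ) < R → x ∈ D)
    (hTR : T ≤ K₂ * R ^ 2) (hBwR : ∀ x ∈ Bw, (G.dist x₀ x : ℝ) ≤ R / 2)
    (hpoin : ∀ f : V → ℝ, ∀ N : Finset V, N.Nonempty → N ⊆ Bk →
      ∑ y ∈ Bk, |f y - average N f| ≤ CP * k * (1 + (Bk.card : ℝ) / N.card) *
        ∑ x ∈ Bw, ∑ y ∈ Bw, conductance G (fun _ => 1) x y * |f y - f x|)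
    (hsup : ∀ t ∈ Icc a (a + T), c₀ * B.card ≤
      ((B.filter fun x => (G.dist x₀ x : ℝ) < k ∧ h ≤ u t x).card : ℝ))
    {ε Λ : ℝ} (hε : 0 < ε) (hε1 : ε ≤ 1) (hΛ : 0 < Λ) :
    ∫ t in Icc a (a + T), 1 / (B.card : ℝ) *
        ∑ x ∈ Bk, (Real.log 3 - Real.log (max ε (u t x + ε))) ≤
      T * (Lh + CP * (1 + 1 / c₀) * (2 * Λ * (Real.log 3 - Real.log ε + 10 * K₂ * A) +
        A / (2 * Λ))) := by
  have hT := F.T_pos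
  have hk := F.k_pos
  have hb : (0 : ℝ) < B.card := by exact_mod_cast F.nonempty.card_pos
  have haI : a ∈ Icc a (a + T) := ⟨le_rfl, by linarith⟩
  have heI : a + T ∈ Icc a (a + T) := ⟨by linarith, le_rfl⟩
  have hRR : R / 2 < R := by linarith
  have hkΛ : 0 < k * Λ := mul_pos hk hΛ
  set η := cutoff G x₀ R (R / 2) with hη
  set g : ℝ → V → ℝ := fun t x => Real.log 3 - Real.log (max ε (u t x + ε)) with hg
  have hmaxε : ∀ t ∈ Icc a (a + T), ∀ x ∈ B, max ε (u t x + ε) = u t x + ε := fun t ht x hx =>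
    max_eq_right (by linarith [hu0 t ht x hx])
  set I : ℝ → ℝ := fun r => 1 / 4 * ∑ x ∈ B, ∑ y ∈ B, conductance G (ω r) x y *
          (min (η x) (η y) ^ 2 *
            (Real.log (max ε (u r y + ε)) - Real.log (max ε (u r x + ε))) ^ 2) with hI
  set N : ℝ → ℝ := fun t => 1 / (B.card : ℝ) * ∑ x ∈ B, max 1 (nu G (ω t) x) with hN
  obtain ⟨hNi, hNle⟩ := F.nu_bound.integral_mean_le hq hq' F.nonempty hA (by linarith)
  rw [add_sub_cancel_left] at hNle
  have hlogc : ∀ x ∈ B, Continuous fun t => Real.log (max ε (u t x + ε)) := fun x hx => by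
    have := hu.cont x hx
    exact Continuous.log (by fun_prop) fun t => (lt_max_of_lt_left hε).ne'
  have hIi : IntegrableOn I (Icc a (a + T)) := by
    rw [← intervalIntegrable_iff_integrableOn_Icc_of_le (by linarith)]
    exact (hu.intervalIntegrable_sum (F := fun r x y => min (η x) (η y) ^ 2 *
      (Real.log (max ε (u r y + ε)) - Real.log (max ε (u r x + ε))) ^ 2) (fun x hx y hy => by
        have := hlogc x hx; have := hlogc y hy; fun_prop) haI heI).const_mul _
  have hIle : ∫ t in Icc a (a + T), I t ≤
      B.card * (Real.log 3 - Real.log ε + 10 * K₂ * A) := by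
    have h1 := F.log_estimate hp hp' hA hu hu0 hR0 hR hTR hε heI
    rw [intervalIntegral.integral_of_le (by linarith), ← integral_Icc_eq_integral_Ioc] at h1
    have h2 : 0 ≤ ∑ x ∈ B, η x ^ 2 * (Real.log 3 - Real.log (u (a + T) x + ε)) :=
      Finset.sum_nonneg fun x hx => mul_nonneg (sq_nonneg _) (sub_nonneg.2
        (Real.log_le_log (by linarith [hu0 _ heI x hx]) (by linarith [hu2 _ heI x hx])))
    have h3 : ∑ x ∈ B, η x ^ 2 * (Real.log 3 - Real.log (u a x + ε)) ≤
        ∑ x ∈ B, (Real.log 3 - Real.log ε) := by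
      refine Finset.sum_le_sum fun x hx => ?_
      have e1 : Real.log ε ≤ Real.log (u a x + ε) :=
        Real.log_le_log hε (by linarith [hu0 _ haI x hx])
      have e2 : Real.log (u a x + ε) ≤ Real.log 3 :=
        Real.log_le_log (by linarith [hu0 _ haI x hx]) (by linarith [hu2 _ haI x hx])
      have e3 : η x ^ 2 ≤ 1 := pow_le_one₀ (cutoff_nonneg _ _ _ _ _) (cutoff_le_one _ _ _ _ _)
      exact (mul_le_of_le_one_left (by linarith) e3).trans (by linarith)
    rw [Finset.sum_const, nsmul_eq_mul] at h3
    change _ + ∫ t in Icc a (a + T), I t ≤ _ at h1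
    linarith
  have hpt : ∀ t ∈ Icc a (a + T), 1 / (B.card : ℝ) * ∑ x ∈ Bk, g t x ≤
      Lh + CP * k * (1 + 1 / c₀) * (2 * (k * Λ) * (1 / B.card) * I t +
        1 / (2 * (k * Λ)) * N t) := by
    intro t ht
    set S := B.filter fun x => (G.dist x₀ x : ℝ) < k ∧ h ≤ u t x with hS
    have hScard : c₀ * B.card ≤ (S.card : ℝ) := hsup t ht
    have hScard0 : (0 : ℝ) < S.card := (mul_pos hc₀ hb).trans_le hScard
    have hSne : S.Nonempty := Finset.card_pos.1 (by exact_mod_cast hScard0)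
    have hSBk : S ⊆ Bk := fun x hx => by
      obtain ⟨hxB, hxk, _⟩ := Finset.mem_filter.1 hx
      exact hmem x hxB hxk
    have havg : average S (g t) ≤ Lh := by
      unfold average
      rw [one_div, inv_mul_le_iff₀ hScard0, ← nsmul_eq_mul]
      refine Finset.sum_le_card_nsmul _ _ _ fun x hx => ?_
      obtain ⟨hxB, _, hxh⟩ := Finset.mem_filter.1 hx
      simp only [hg]
      rw [hmaxε t ht x hxB]
      have : Real.log h ≤ Real.log (u t x + ε) := Real.log_le_log hh (by linarith)
      linarith
    have hvar : ∑ x ∈ Bw, ∑ y ∈ Bw, conductance G (fun _ => 1) x y * |g t y - g t x| ≤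
        2 * (k * Λ) * I t + 1 / (2 * (k * Λ)) * (B.card * N t) := by
      have hstep : ∀ x ∈ Bw, ∀ y ∈ Bw, conductance G (fun _ => 1) x y * |g t y - g t x| ≤
          2 * (k * Λ) * (1 / 4 * (conductance G (ω t) x y * (min (η x) (η y) ^ 2 *
            (Real.log (max ε (u t y + ε)) - Real.log (max ε (u t x + ε))) ^ 2))) +
          1 / (2 * (k * Λ)) * (conductance G (ω t) x y)⁻¹ := by
        intro x hx y hy
        have e1 : η x = 1 := cutoff_eq_one hRR (hBwR x hx)
        have e2 : η y = 1 := cutoff_eq_one hRR (hBwR y hy)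
        have e3 := conductance_one_mul_abs_le (F.weight.pos t) hkΛ x y (g t y - g t x)
        have e4 : (g t y - g t x) ^ 2 =
            (Real.log (max ε (u t y + ε)) - Real.log (max ε (u t x + ε))) ^ 2 := by
          simp only [hg]; ring
        rw [e4] at e3
        rw [e1, e2, min_self]
        linarith
      refine (Finset.sum_le_sum fun x hx => Finset.sum_le_sum fun y hy =>
        hstep x hx y hy).trans ?_
      simp only [Finset.sum_add_distrib, ← Finset.mul_sum]
      have hc := fun x y => conductance_nonneg (F.weight.pos t) x y
      refine add_le_add (mul_le_mul_of_nonneg_left (mul_le_mul_of_nonneg_left ?_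
        (by norm_num)) (by positivity)) (mul_le_mul_of_nonneg_left ?_ (by positivity))
      · calc _ ≤ ∑ x ∈ Bw, ∑ y ∈ B, conductance G (ω t) x y * (min (η x) (η y) ^ 2 *
              (Real.log (max ε (u t y + ε)) - Real.log (max ε (u t x + ε))) ^ 2) :=
              Finset.sum_le_sum fun x _ => Finset.sum_le_sum_of_subset_of_nonneg hBw
                fun y _ _ => mul_nonneg (hc x y) (by positivity)
          _ ≤ _ := Finset.sum_le_sum_of_subset_of_nonneg hBw fun x _ _ =>
              Finset.sum_nonneg fun y _ => mul_nonneg (hc x y) (by positivity)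
      · have e5 : (B.card : ℝ) * N t = ∑ x ∈ B, max 1 (nu G (ω t) x) := by
          simp only [hN]; field_simp
        rw [e5]
        calc _ ≤ ∑ x ∈ Bw, max 1 (nu G (ω t) x) := Finset.sum_le_sum fun x _ =>
              (inv_conductance_le_nu (F.weight.pos t) Bw x).trans (le_max_right _ _)
          _ ≤ _ := Finset.sum_le_sum_of_subset_of_nonneg hBw fun x _ _ =>
              zero_le_one.trans (le_max_left _ _)
    have hP := hpoin (g t) S hSne hSBk
    have hratio : 1 + (Bk.card : ℝ) / S.card ≤ 1 + 1 / c₀ := by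
      have e1 : (Bk.card : ℝ) ≤ B.card := by exact_mod_cast Finset.card_le_card hBk
      have : (Bk.card : ℝ) / S.card ≤ 1 / c₀ := by
        rw [div_le_div_iff₀ hScard0 hc₀]
        nlinarith
      linarith
    have hsum : ∑ x ∈ Bk, g t x ≤ B.card * Lh + ∑ y ∈ Bk, |g t y - average S (g t)| := by
      have e1 : (Bk.card : ℝ) * Lh ≤ B.card * Lh :=
        mul_le_mul_of_nonneg_right (by exact_mod_cast Finset.card_le_card hBk) hLh0
      have e2 : ∑ x ∈ Bk, g t x ≤ ∑ x ∈ Bk, (Lh + |g t x - average S (g t)|) :=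
        Finset.sum_le_sum fun x _ => by
          have := le_abs_self (g t x - average S (g t))
          linarith
      rw [Finset.sum_add_distrib, Finset.sum_const, nsmul_eq_mul] at e2
      linarith
    have hvar0 : 0 ≤ ∑ x ∈ Bw, ∑ y ∈ Bw, conductance G (fun _ => 1) x y * |g t y - g t x| :=
      Finset.sum_nonneg fun x _ => Finset.sum_nonneg fun y _ =>
        mul_nonneg (conductance_nonneg (fun _ _ => one_pos) x y) (abs_nonneg _)
    have hP2 : ∑ y ∈ Bk, |g t y - average S (g t)| ≤ CP * k * (1 + 1 / c₀) *
        (2 * (k * Λ) * I t + 1 / (2 * (k * Λ)) * (B.card * N t)) := by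
      refine hP.trans ?_
      refine mul_le_mul (mul_le_mul_of_nonneg_left hratio (by positivity)) hvar hvar0
        (by positivity)
    have hfin := mul_le_mul_of_nonneg_left (hsum.trans (add_le_add_right hP2 _))
      (by positivity : 0 ≤ 1 / (B.card : ℝ))
    have halg : ∀ b L X Y I Z N : ℝ, b ≠ 0 →
        1 / b * (b * L + X * (Y * I + Z * (b * N))) = L + X * (Y * (1 / b) * I + Z * N) := by
      intro b L X Y I Z N hb
      field_simp
    exact hfin.trans (le_of_eq (halg _ _ _ _ _ _ _ hb.ne'))
  have hgc : Continuous fun t => 1 / (B.card : ℝ) * ∑ x ∈ Bk, g t x := by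
    refine continuous_const.mul (continuous_finsetSum Bk fun x hx => ?_)
    exact continuous_const.sub (hlogc x (hBk hx))
  have i2 : IntegrableOn (fun t => 2 * (k * Λ) * (1 / B.card) * I t +
        1 / (2 * (k * Λ)) * N t) (Icc a (a + T)) := (hIi.const_mul _).add (hNi.const_mul _)
  refine (setIntegral_mono_on hgc.continuousOn.integrableOn_Icc
    ((integrable_const Lh).add (i2.const_mul (CP * k * (1 + 1 / c₀)))) measurableSet_Icc
    hpt).trans ?_
  rw [integral_add' (integrable_const _) (i2.const_mul _), integral_const_mul,
    integral_add (hIi.const_mul _) (hNi.const_mul _),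
    integral_const_mul (2 * (k * Λ) * (1 / (B.card : ℝ))) I,
    integral_const_mul (1 / (2 * (k * Λ))) N]
  simp only [integral_const, measureReal_restrict_apply_univ,
    Real.volume_real_Icc_of_le (by linarith : a ≤ a + T), add_sub_cancel_left, smul_eq_mul]
  set P := Real.log 3 - Real.log ε + 10 * K₂ * A with hPdef
  have hP0 : 0 ≤ P := by
    have h1 : 0 ≤ ∫ t in Icc a (a + T), I t := integral_nonneg fun t =>
      mul_nonneg (by norm_num) (Finset.sum_nonneg fun x _ => Finset.sum_nonneg fun y _ =>
        mul_nonneg (conductance_nonneg (F.weight.pos t) x y) (by positivity))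
    by_contra hneg
    have := mul_neg_of_pos_of_neg hb (not_le.1 hneg)
    linarith
  have f1 : 2 * (k * Λ) * (1 / (B.card : ℝ)) * ∫ t in Icc a (a + T), I t ≤
      2 * (k * Λ) * P := by
    have := mul_le_mul_of_nonneg_left hIle
      (by positivity : 0 ≤ 2 * (k * Λ) * (1 / (B.card : ℝ)))
    refine this.trans (le_of_eq ?_)
    field_simp
  have f2 : 1 / (2 * (k * Λ)) * ∫ t in Icc a (a + T), N t ≤ 1 / (2 * (k * Λ)) * (T * A) :=
    mul_le_mul_of_nonneg_left hNle (by positivity)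
  have f3 := mul_le_mul_of_nonneg_left (add_le_add f1 f2)
    (by positivity : 0 ≤ CP * k * (1 + 1 / c₀))
  have f4 : CP * k * (1 + 1 / c₀) * (2 * (k * Λ) * P + 1 / (2 * (k * Λ)) * (T * A)) =
      CP * (1 + 1 / c₀) * (k ^ 2 * (2 * Λ * P) + T * (A / (2 * Λ))) := by field_simp
  have f5 : CP * (1 + 1 / c₀) * (k ^ 2 * (2 * Λ * P) + T * (A / (2 * Λ))) ≤
      CP * (1 + 1 / c₀) * (T * (2 * Λ * P) + T * (A / (2 * Λ))) := by
    have := F.sq_le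
    gcongr
  have f6 : T * (Lh + CP * (1 + 1 / c₀) * (2 * Λ * P + A / (2 * Λ))) =
      T * Lh + CP * (1 + 1 / c₀) * (T * (2 * Λ * P) + T * (A / (2 * Λ))) := by ring
  rw [f6]
  linarith

end LogEstimates

/-- A solution with values in `[0, 2]` that is at least `1` on half of the ball at the initial time
is bounded from below on a smaller cylinder. -/
theorem exists_lower_bound {p p' q q' ds A K₁ Ks β θ s σ m c₀ K₂ CP : ℝ}
    (E : Exponents p p' q q' ds β θ s σ m) (hK₁ : 0 ≤ K₁) (hA : 0 < A) (hc₀ : 0 < c₀)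
    (hK₂ : 0 ≤ K₂) (hCP : 0 ≤ CP) :
    ∃ ρ ∈ Ioo (0 : ℝ) 1, ∀ (V : Type*) (G : SimpleGraph V) [G.LocallyFinite]
      (ω : ℝ → Sym2 V → ℝ) (x₀ : V) (B D : Finset V) (k a T : ℝ)
      (_ : Frame G ω x₀ B D k a T p p' q q' ds A K₁ Ks)
      (_ : c₀ * B.card ≤ ∑ x ∈ B, cutoff G x₀ k (k / 2) x ^ 2)
      (Bk Bw : Finset V) (_ : Bk ⊆ B) (_ : Bw ⊆ B) (_ : ∀ x ∈ B, (G.dist x₀ x : ℝ) < k → x ∈ Bk)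
      (R : ℝ) (_ : 0 < R) (_ : ∀ x, (G.dist x₀ x : ℝ) < R → x ∈ D) (_ : T ≤ K₂ * R ^ 2)
      (_ : ∀ x ∈ Bw, (G.dist x₀ x : ℝ) ≤ R / 2)
      (_ : ∀ f : V → ℝ, ∀ N : Finset V, N.Nonempty → N ⊆ Bk →
        ∑ y ∈ Bk, |f y - average N f| ≤ CP * k * (1 + (Bk.card : ℝ) / N.card) *
          ∑ x ∈ Bw, ∑ y ∈ Bw, conductance G (fun _ => 1) x y * |f y - f x|)
      (u : ℝ → V → ℝ) (_ : IsCaloric B D (fun t => conductance G (ω t)) a (a + T) u)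
      (_ : ∀ t ∈ Icc a (a + T), ∀ x ∈ B, 0 ≤ u t x)
      (_ : ∀ t ∈ Icc a (a + T), ∀ x ∈ B, u t x ≤ 2)
      (_ : ∑ x ∈ B with u a x < 1, cutoff G x₀ k (k / 2) x ^ 2 ≤
        1 / 2 * ∑ x ∈ B, cutoff G x₀ k (k / 2) x ^ 2),
      ∀ t ∈ Icc (a + T / 2) (a + T), ∀ x, (G.dist x₀ x : ℝ) ≤ k / 2 → ρ ≤ u t x := by
  have hp' := E.hβ.lt
  obtain ⟨δ, hδ, hDG⟩ := exists_deGiorgi_constant (A := A) (K₁ := K₁) (Ks := Ks) E hK₁ hA.le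
  set Lh := 8 + 40 * K₁ * A / c₀ with hLh
  have hLh0 : 0 ≤ Lh := by positivity
  set h := 3 * Real.exp (-Lh) with hh
  have hh0 : 0 < h := by positivity
  have hlogh : Real.log 3 - Real.log h ≤ Lh := by
    rw [hh, Real.log_mul (by norm_num) (Real.exp_pos _).ne', Real.log_exp]; linarith
  set CP' := CP * (1 + 1 / (c₀ / 4)) with hCP'
  have hCP'0 : 0 ≤ CP' := by positivity
  set Λ := δ / (8 * (CP' + 1)) with hΛ
  have hΛ0 : 0 < Λ := by positivity
  have hΛδ : 4 * Λ * CP' ≤ δ / 2 := by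
    have h1 : 4 * Λ * (CP' + 1) = δ / 2 := by rw [hΛ]; field_simp; norm_num
    linarith
  set Q := Lh + CP' * (20 * Λ * K₂ * A + A / (2 * Λ)) with hQ
  have hQ0 : 0 ≤ Q := by positivity
  set L := 2 + 4 * Q / δ with hL
  have hL2 : 2 ≤ L := by have : 0 ≤ 4 * Q / δ := by positivity
                         linarith
  have hLQ : 2 / L * Q ≤ δ / 2 := by
    have h1 : 4 * Q ≤ L * δ := by
      rw [hL, add_mul, div_mul_cancel₀ _ hδ.ne']; linarith
    rw [div_mul_eq_mul_div, div_le_iff₀ (by linarith)]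
    linarith
  set ε := 3 * Real.exp (-L) with hε
  have hε0 : 0 < ε := by positivity
  have hε1 : ε ≤ 1 := by
    have h1 : 3 ≤ Real.exp L := by
      have := Real.add_one_le_exp L
      linarith
    rw [hε, Real.exp_neg, ← div_eq_mul_inv, div_le_one (Real.exp_pos _)]
    exact h1
  have hlogε : Real.log 3 - Real.log ε = L := by
    rw [hε, Real.log_mul (by norm_num) (Real.exp_pos _).ne', Real.log_exp]; ring
  set l := 3 * Real.exp (-(L / 2)) - ε with hl
  have hl0 : 0 < l := by
    have := Real.exp_lt_exp.2 (by linarith : -L < -(L / 2))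
    rw [hl, hε]
    linarith
  refine ⟨min (l / 2) (1 / 2), ⟨by positivity, (min_le_right _ _).trans_lt (by norm_num)⟩, ?_⟩
  intro V G _ ω x₀ B D k a T F hvol Bk Bw hBk hBw hmem R hR0 hR hTR hBwR hpoin u hu hu0 hu2 hstart
    t ht x hx
  have hT := F.T_pos
  have hb : (0 : ℝ) < B.card := by exact_mod_cast F.nonempty.card_pos
  have hsup := fun t ht => F.card_superlevel_ge E.hp hp'.le hA hu hu0 hu2 hc₀ hvol hstart
    (t := t) ht
  have hint := F.integral_log_le E.hp hp'.le E.hq E.hq' hA hu hu0 hu2 (c₀ := c₀ / 4)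
    (by positivity) hh0 hlogh hLh0 hBk hBw hmem hCP hR0 hR hTR hBwR hpoin hsup hε0 hε1 hΛ0
  rw [hlogε] at hint
  have hv : IsCaloric B D (fun t => conductance G (ω t)) a (a + T) fun t x => 1 / l * u t x := by
    simpa only [add_zero] using hu.affine (1 / l) 0
  have hdens : ∀ t ∈ Icc a (a + T),
      density B (sublevel G x₀ B (fun t x => 1 / l * u t x) k 1 t) ≤ 2 / L * (1 / (B.card : ℝ) *
        ∑ x ∈ Bk, (Real.log 3 - Real.log (max ε (u t x + ε)))) := by
    intro t ht
    set S := sublevel G x₀ B (fun t x => 1 / l * u t x) k 1 t with hS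
    have h1 : (S.card : ℝ) * (L / 2) ≤
        ∑ x ∈ S, (Real.log 3 - Real.log (max ε (u t x + ε))) := by
      rw [← nsmul_eq_mul]
      refine Finset.card_nsmul_le_sum _ _ _ fun x hx => ?_
      obtain ⟨hxB, _, hxl⟩ := mem_sublevel.1 hx
      rw [one_div, inv_mul_lt_iff₀ hl0, mul_one] at hxl
      rw [max_eq_right (by linarith [hu0 t ht x hxB])]
      have h2 : Real.log (u t x + ε) ≤ Real.log (3 * Real.exp (-(L / 2))) :=
        Real.log_le_log (by linarith [hu0 t ht x hxB]) (by linarith)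
      rw [Real.log_mul (by norm_num) (Real.exp_pos _).ne', Real.log_exp] at h2
      linarith
    have h2 : ∑ x ∈ S, (Real.log 3 - Real.log (max ε (u t x + ε))) ≤
        ∑ x ∈ Bk, (Real.log 3 - Real.log (max ε (u t x + ε))) := by
      refine Finset.sum_le_sum_of_subset_of_nonneg (fun x hx => ?_) fun x hx _ => ?_
      · obtain ⟨hxB, hxk, _⟩ := mem_sublevel.1 hx
        exact hmem x hxB hxk
      · exact sub_nonneg.2 (Real.log_le_log (lt_max_of_lt_left hε0)
          (max_le (by linarith) (by linarith [hu2 t ht x (hBk hx)])))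
    have h3 : density B S = 2 / L * (1 / (B.card : ℝ) * (S.card * (L / 2))) := by
      have : L ≠ 0 := by linarith
      unfold density
      field_simp
    rw [h3]
    have : 0 ≤ L := by linarith
    exact mul_le_mul_of_nonneg_left (mul_le_mul_of_nonneg_left (h1.trans h2) (by positivity))
      (by positivity)
  have hSm := fun x hx => measurableSet_mem_sublevel (G := G) (x₀ := x₀) (r := k) (l := 1)
    hv.cont x hx
  have i0 : IntegrableOn (fun t => density B (sublevel G x₀ B (fun t x => 1 / l * u t x) k 1 t))
      (Icc a (a + T)) := by
    have := integrableOn_density_rpow (B := B) (fun t => sublevel_subset) hSm zero_le_one a (a + T)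
    simpa only [Real.rpow_one] using this
  have hgc : Continuous fun t => 1 / (B.card : ℝ) *
      ∑ x ∈ Bk, (Real.log 3 - Real.log (max ε (u t x + ε))) := by
    refine continuous_const.mul (continuous_finsetSum Bk fun x hx => ?_)
    have := hu.cont x (hBk hx)
    exact continuous_const.sub (Continuous.log (by fun_prop)
      fun t => (lt_max_of_lt_left hε0).ne')
  have hbad : ∫ t in Icc a (a + T),
      density B (sublevel G x₀ B (fun t x => 1 / l * u t x) k 1 t) ≤ δ * T := by
    refine (setIntegral_mono_on i0 (hgc.continuousOn.integrableOn_Icc.const_mul (2 / L))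
      measurableSet_Icc hdens).trans ?_
    rw [integral_const_mul]
    have hL0 : 0 < L := by linarith
    refine (mul_le_mul_of_nonneg_left hint (by positivity)).trans ?_
    have h1 : 2 / L * (T * (Lh + CP' * (2 * Λ * (L + 10 * K₂ * A) + A / (2 * Λ)))) =
        T * (4 * Λ * CP' + 2 / L * Q) := by
      rw [hQ]; field_simp; ring
    rw [h1, mul_comm δ T]
    exact mul_le_mul_of_nonneg_left (by linarith) hT.le
  have hfin := hDG V G ω x₀ B D k a T F (fun t x => 1 / l * u t x) hv
    (fun t ht x hx => mul_nonneg (by positivity) (hu0 t ht x hx)) hbad t ht x hx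
  rw [one_div l, inv_mul_eq_div, le_div_iff₀ hl0] at hfin
  exact (min_le_left _ _).trans (by linarith)

/-- `r` is a finite exponent with `r ≤ p`, equal to `p` when `p` is finite. -/
def IsFiniteExponent (p : ℝ≥0∞) (r : ℝ) : Prop := p = ∞ ∨ p = ENNReal.ofReal r

theorem exists_finite_exponent {p : ℝ≥0∞} (hp : 1 ≤ p) {x ε : ℝ} (hx : x = p⁻¹.toReal)
    (hεx : x ≠ 0 → ε ≤ x) : IsFiniteExponent p (1 / max x ε) := by
  have hp0 : p ≠ 0 := (zero_lt_one.trans_le hp).ne'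
  by_cases h : p = ∞
  · exact Or.inl h
  · right
    have hxp : x = p.toReal⁻¹ := by rw [hx, ENNReal.toReal_inv]
    have hx0 : x ≠ 0 := by
      rw [hxp]; exact inv_ne_zero (ENNReal.toReal_ne_zero.2 ⟨hp0, h⟩)
    rw [max_eq_left (hεx hx0), hxp, one_div, inv_inv, ENNReal.ofReal_toReal h]

theorem exists_finite_exponents {p p' q q' : ℝ≥0∞} {d' : ℝ} (hd' : 2 ≤ d') (hp : 1 ≤ p)
    (hp' : 1 < p') (hq : 1 ≤ q) (hq' : 1 ≤ q')
    (hpq : p⁻¹ * (1 - p'⁻¹)⁻¹ * (1 + q'⁻¹) + q⁻¹ < ENNReal.ofReal (2 / d')) :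
    ∃ r r' s s' : ℝ, IsFiniteExponent p r ∧ IsFiniteExponent p' r' ∧ IsFiniteExponent q s ∧
      IsFiniteExponent q' s' ∧ 1 < r ∧ 1 < r' ∧ 1 < s ∧ 1 ≤ s' ∧
      1 / r * (1 - 1 / r')⁻¹ * (1 + 1 / s') + 1 / s < 2 / d' := by
  have hfin : ∀ {z : ℝ≥0∞}, 1 ≤ z → z⁻¹ ≠ ∞ := fun hz =>
    ENNReal.inv_ne_top.2 (zero_lt_one.trans_le hz).ne'
  have hle : ∀ {z : ℝ≥0∞}, 1 ≤ z → z⁻¹.toReal ≤ 1 := fun hz => by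
    have := ENNReal.toReal_mono ENNReal.one_ne_top (ENNReal.inv_le_one.2 hz)
    simpa using this
  set x₁ := p⁻¹.toReal with h₁
  set x₂ := p'⁻¹.toReal with h₂
  set x₃ := q⁻¹.toReal with h₃
  set x₄ := q'⁻¹.toReal with h₄
  have n₁ : 0 ≤ x₁ := ENNReal.toReal_nonneg
  have n₂ : 0 ≤ x₂ := ENNReal.toReal_nonneg
  have n₃ : 0 ≤ x₃ := ENNReal.toReal_nonneg
  have n₄ : 0 ≤ x₄ := ENNReal.toReal_nonneg
  have l₂ : x₂ < 1 := by
    have := (ENNReal.toReal_lt_toReal (hfin hp'.le) ENNReal.one_ne_top).2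
      (ENNReal.inv_lt_one.2 hp')
    rwa [ENNReal.toReal_one] at this
  have hreal : x₁ * (1 - x₂)⁻¹ * (1 + x₄) + x₃ < 2 / d' := by
    have e₁ : p⁻¹ = ENNReal.ofReal x₁ := (ENNReal.ofReal_toReal (hfin hp)).symm
    have e₂ : p'⁻¹ = ENNReal.ofReal x₂ := (ENNReal.ofReal_toReal (hfin hp'.le)).symm
    have e₃ : q⁻¹ = ENNReal.ofReal x₃ := (ENNReal.ofReal_toReal (hfin hq)).symm
    have e₄ : q'⁻¹ = ENNReal.ofReal x₄ := (ENNReal.ofReal_toReal (hfin hq')).symm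
    have hinv : 0 < (1 - x₂)⁻¹ := inv_pos.2 (sub_pos.2 l₂)
    rw [e₁, e₂, e₃, e₄, ← ENNReal.ofReal_one, ← ENNReal.ofReal_sub _ n₂,
      ← ENNReal.ofReal_inv_of_pos (sub_pos.2 l₂), ← ENNReal.ofReal_add zero_le_one n₄,
      ← ENNReal.ofReal_mul n₁, ← ENNReal.ofReal_mul (by positivity),
      ← ENNReal.ofReal_add (by positivity) n₃, ENNReal.ofReal_lt_ofReal_iff (by positivity)] at hpq
    exact hpq
  have hcont : ContinuousAt (fun ε : ℝ =>
      max x₁ ε * (1 - max x₂ ε)⁻¹ * (1 + max x₄ ε) + max x₃ ε) 0 := by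
    have hne : 1 - max x₂ 0 ≠ 0 := by rw [max_eq_left n₂]; linarith
    refine ContinuousAt.add (ContinuousAt.mul (ContinuousAt.mul (by fun_prop)
      (ContinuousAt.inv₀ (by fun_prop) hne)) (by fun_prop)) (by fun_prop)
  have hev : ∀ᶠ ε in nhdsWithin (0 : ℝ) (Ioi 0),
      max x₁ ε * (1 - max x₂ ε)⁻¹ * (1 + max x₄ ε) + max x₃ ε < 2 / d' := by
    refine (hcont.eventually_lt continuousAt_const ?_).filter_mono nhdsWithin_le_nhds
    simpa [max_eq_left n₁, max_eq_left n₂, max_eq_left n₃, max_eq_left n₄] using hreal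
  have hsmall : ∀ x : ℝ, 0 ≤ x → ∀ᶠ ε in nhdsWithin (0 : ℝ) (Ioi 0), x ≠ 0 → ε ≤ x := by
    intro x hx
    rcases hx.eq_or_lt with h | h
    · exact Filter.Eventually.of_forall fun ε hne => absurd h.symm hne
    · filter_upwards [nhdsWithin_le_nhds (Iio_mem_nhds h)] with ε hε _ using (mem_Iio.1 hε).le
  have hlt : ∀ᶠ ε in nhdsWithin (0 : ℝ) (Ioi 0), ε < 1 :=
    nhdsWithin_le_nhds (Iio_mem_nhds zero_lt_one)
  have hgt : ∀ᶠ ε in nhdsWithin (0 : ℝ) (Ioi 0), 0 < ε := self_mem_nhdsWithin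
  obtain ⟨ε, hε, s₁, s₂, s₃, s₄, hε1', hε0'⟩ := (hev.and ((hsmall x₁ n₁).and ((hsmall x₂ n₂).and
    ((hsmall x₃ n₃).and ((hsmall x₄ n₄).and (hlt.and hgt)))))).exists
  have m : ∀ x : ℝ, 0 < max x ε := fun x => lt_max_of_lt_right hε0'
  have hd1 : 2 / d' ≤ 1 := (div_le_one (by linarith)).2 hd'
  have hm₂ : max x₂ ε < 1 := max_lt l₂ hε1'
  have hI : 1 ≤ (1 - max x₂ ε)⁻¹ :=
    (one_le_inv₀ (sub_pos.2 hm₂)).2 (by linarith [m x₂])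
  have hm₁ : max x₁ ε < 1 := by
    have h1 : max x₁ ε ≤ max x₁ ε * (1 - max x₂ ε)⁻¹ * (1 + max x₄ ε) := by
      rw [mul_assoc]
      exact le_mul_of_one_le_right (m x₁).le
        (one_le_mul_of_one_le_of_one_le hI (by linarith [m x₄]))
    linarith [m x₃]
  have hm₃ : max x₃ ε < 1 := by
    have : 0 < max x₁ ε * (1 - max x₂ ε)⁻¹ * (1 + max x₄ ε) :=
      mul_pos (mul_pos (m x₁) (by linarith)) (by linarith [m x₄])
    linarith
  refine ⟨1 / max x₁ ε, 1 / max x₂ ε, 1 / max x₃ ε, 1 / max x₄ ε,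
    exists_finite_exponent hp h₁ s₁, exists_finite_exponent hp'.le h₂ s₂,
    exists_finite_exponent hq h₃ s₃, exists_finite_exponent hq' h₄ s₄,
    (one_lt_div (m _)).2 hm₁, (one_lt_div (m _)).2 hm₂, (one_lt_div (m _)).2 hm₃,
    (one_le_div (m _)).2 (max_le (hle hq') hε1'.le), ?_⟩
  simpa only [one_div_one_div] using hε

theorem exists_exponents {r r' s s' d' : ℝ} (hd' : 2 ≤ d') (hr : 1 < r) (hr' : 1 < r')
    (hs : 1 < s) (hs' : 1 ≤ s')
    (h : 1 / r * (1 - 1 / r')⁻¹ * (1 + 1 / s') + 1 / s < 2 / d') :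
    ∃ β θ τ σ m, Exponents r r' s s' (d' / (d' - 1)) β θ τ σ m := by
  have hd0 : 0 < d' := by linarith
  have hd1 : 0 < d' - 1 := by linarith
  have hr1 : 0 < r' - 1 := by linarith
  have hs1 : 0 < s - 1 := by linarith
  have hβ : r'.HolderConjugate (r' / (r' - 1)) := Real.HolderConjugate.conjExponent hr'
  set β := r' / (r' - 1) with hβdef
  have hβ1 : 1 ≤ β := hβ.symm.lt.le
  set τ := s' / (s' + 1) with hτ
  have hτ0 : 0 < τ := by positivity
  have hτ1 : τ ≤ 1 := (div_le_one (by positivity)).2 (by linarith)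
  set κ := 2 / d' - 1 / s with hκ
  have e1 : (1 - 1 / r')⁻¹ = β := by rw [hβdef]; field_simp
  have e2 : 1 + 1 / s' = 1 / τ := by rw [hτ]; field_simp
  rw [e1, e2] at h
  have hκ0 : β / r < τ * κ := by
    have h1 : 1 / r * β * (1 / τ) < κ := by rw [hκ]; linarith
    have h2 := mul_lt_mul_of_pos_left h1 hτ0
    have h3 : τ * (1 / r * β * (1 / τ)) = β / r := by field_simp
    linarith
  have hs0 : 0 < 1 / s := by positivity
  have hd2 : 2 / d' ≤ 1 := (div_le_one hd0).2 hd'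
  have hσ0 : 0 < 1 - κ := by rw [hκ]; linarith
  have hσ1 : 2 / (d' / (d' - 1)) - (1 - 1 / s) = 1 - κ := by rw [hκ]; field_simp; ring
  have hden : 0 < s * (d' - 2) + d' := by nlinarith
  refine ⟨β, β * (1 - 1 / r), τ, 1 - κ, 2 * s * (d' - 1) / (s * (d' - 2) + d'), hr, hβ, rfl, hs,
    hs', rfl, by positivity, hσ1.symm, hσ0, ?_, ?_, ?_, ?_⟩
  · rw [one_le_div hden]; nlinarith
  · field_simp
    ring
  · have h1 : β * (1 - 1 / r) = β - β / r := by ring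
    rw [h1]
    nlinarith
  · have h1 : β * (1 - 1 / r) = β - β / r := by ring
    rw [h1]
    nlinarith

theorem lpMean_le_spaceNorm {p : ℝ≥0∞} {r : ℝ} (hr : 1 < r) (h : IsFiniteExponent p r)
    {B : Finset V} (hB : B.Nonempty) {f : V → ℝ} (hf : ∀ x, 0 ≤ f x) :
    lpMean r B f ≤ spaceNorm p B f := by
  have hb : (0 : ℝ) < B.card := by exact_mod_cast hB.card_pos
  have hr0 : 0 < r := by linarith
  rcases h with h | h
  · rw [spaceNorm, if_pos h]
    have hle : ∀ x ∈ B, f x ≤ ⨆ x : B, |f x| := fun x hx =>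
      (le_abs_self _).trans (le_ciSup (f := fun x : B => |f x|) (Set.finite_range _).bddAbove ⟨x, hx⟩)
    obtain ⟨x₀, hx₀⟩ := hB
    have hM : 0 ≤ ⨆ x : B, |f x| := (hf x₀).trans (hle x₀ hx₀)
    unfold lpMean
    rw [one_div r, Real.rpow_inv_le_iff_of_pos (mul_nonneg (by positivity)
      (Finset.sum_nonneg fun x _ => Real.rpow_nonneg (hf x) _)) hM hr0, one_div,
      inv_mul_le_iff₀ hb, ← nsmul_eq_mul]
    exact Finset.sum_le_card_nsmul _ _ _ fun x hx => Real.rpow_le_rpow (hf x) (hle x hx) hr0.le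
  · have hne : p ≠ ∞ := by rw [h]; exact ENNReal.ofReal_ne_top
    rw [spaceNorm, if_neg hne, h, ENNReal.toReal_ofReal hr0.le]
    simp only [abs_of_nonneg (hf _)]
    exact le_rfl

theorem mixedBound_of_spaceTimeNorm_le {p p' : ℝ≥0∞} {r r' : ℝ} (hr : 1 < r) (hr' : 1 ≤ r')
    (h : IsFiniteExponent p r) (h' : IsFiniteExponent p' r') {B : Finset V} (hB : B.Nonempty)
    {a e A : ℝ} (hae : a < e) (hA : 0 ≤ A) {g : ℝ → V → ℝ} (hg : ∀ t x, 0 ≤ g t x)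
    (hm : ∀ x ∈ B, Measurable fun t => g t x)
    (hle : spaceTimeNorm p p' (Icc a e) B g ≤ ENNReal.ofReal A) :
    MixedBound r r' B a e g A := by
  have hr'0 : 0 < r' := by linarith
  have hea : 0 < e - a := sub_pos.2 hae
  have hN0 : ∀ t, 0 ≤ lpMean r B (g t) := fun t => lpMean_nonneg fun x _ => hg t x
  have hmeas : Measurable fun t => lpMean r B (g t) ^ r' := by
    unfold lpMean
    exact (((Finset.measurable_fun_sum B fun x hx => (hm x hx).pow_const r).const_mul
      _).pow_const _).pow_const _
  have hpt : ∀ t, ENNReal.ofReal (lpMean r B (g t) ^ r') ≤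
      ENNReal.ofReal (spaceNorm p B (g t)) ^ r' := fun t => by
    rw [← ENNReal.ofReal_rpow_of_nonneg (hN0 t) hr'0.le]
    exact ENNReal.rpow_le_rpow (ENNReal.ofReal_le_ofReal (lpMean_le_spaceNorm hr h hB (hg t)))
      hr'0.le
  have hvol : volume (Icc a e) = ENNReal.ofReal (e - a) := Real.volume_Icc
  have hmain : ∫⁻ t in Icc a e, ENNReal.ofReal (lpMean r B (g t) ^ r') ≤
      ENNReal.ofReal ((e - a) * A ^ r') := by
    rw [ENNReal.ofReal_mul hea.le, ← ENNReal.ofReal_rpow_of_nonneg hA hr'0.le]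
    rcases h' with h' | h'
    · rw [spaceTimeNorm, if_pos h'] at hle
      have h1 : ∀ t ∈ Icc a e, ENNReal.ofReal (lpMean r B (g t) ^ r') ≤ ENNReal.ofReal A ^ r' :=
        fun t ht => (hpt t).trans (ENNReal.rpow_le_rpow ((le_iSup₂ (f := fun t _ =>
          ENNReal.ofReal (spaceNorm p B (g t))) t ht).trans hle) hr'0.le)
      refine (setLIntegral_mono measurable_const h1).trans ?_
      rw [setLIntegral_const, hvol, mul_comm]
    · have hne : p' ≠ ∞ := by rw [h']; exact ENNReal.ofReal_ne_top
      rw [spaceTimeNorm, if_neg hne, h', ENNReal.toReal_ofReal hr'0.le, one_div,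
        ENNReal.rpow_inv_le_iff hr'0, hvol] at hle
      have h0 : ENNReal.ofReal (e - a) ≠ 0 := by simpa using hae
      rw [ENNReal.inv_mul_le_iff h0 ENNReal.ofReal_ne_top] at hle
      exact (lintegral_mono hpt).trans hle
  have hint : IntegrableOn (fun t => lpMean r B (g t) ^ r') (Icc a e) := by
    refine ⟨hmeas.aestronglyMeasurable, ?_⟩
    rw [hasFiniteIntegral_iff_ofReal (Filter.Eventually.of_forall fun t =>
      Real.rpow_nonneg (hN0 t) _)]
    exact hmain.trans_lt ENNReal.ofReal_lt_top
  refine ⟨hg, hm, hint, ?_⟩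
  rw [integral_eq_lintegral_of_nonneg_ae (Filter.Eventually.of_forall fun t =>
    Real.rpow_nonneg (hN0 t) _) hmeas.aestronglyMeasurable]
  exact ENNReal.toReal_le_of_le_ofReal (mul_nonneg hea.le (Real.rpow_nonneg hA _)) hmain

theorem mem_ball {G : SimpleGraph V} [G.LocallyFinite] (hG : G.Connected) {x y : V} {r : ℝ} :
    y ∈ ball G x r ↔ G.dist x y ≤ ⌊r⌋₊ := by
  unfold ball
  rw [Set.Finite.mem_toFinset]
  have h1 : G.edist x y = (G.dist x y : ℕ∞) :=
    (SimpleGraph.Reachable.coe_dist_eq_edist (hG.preconnected x y)).symm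
  simp only [mem_ofPred_eq, h1]
  exact_mod_cast Iff.rfl

theorem mem_ball_iff_le {G : SimpleGraph V} [G.LocallyFinite] (hG : G.Connected) {x y : V} {r : ℝ}
    (hr : 0 ≤ r) : y ∈ ball G x r ↔ (G.dist x y : ℝ) ≤ r := by
  rw [mem_ball hG, Nat.le_floor_iff hr]

theorem tsum_absGrad_le_variation {G : SimpleGraph V} {B D : Finset V} (hDB : D ⊆ B)
    (hD : ∀ x ∈ D, ∀ y, G.Adj x y → y ∈ B) {f : V → ℝ} (hf : ∀ x ∉ D, f x = 0) :
    ∑' e : G.edgeSet, absGrad f e ≤ variation G B f := by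
  classical
  set P := (B ×ˢ B).filter fun z => G.Adj z.1 z.2 with hP
  set Fe := P.image fun z => s(z.1, z.2) with hFe
  have hnn : ∀ e, 0 ≤ absGrad f e := fun e => Sym2.ind (fun x y => abs_nonneg _) e
  have h1 : ∑' e : G.edgeSet, absGrad f e = ∑ e ∈ Fe, G.edgeSet.indicator (absGrad f) e := by
    rw [tsum_subtype G.edgeSet (absGrad f)]
    refine tsum_eq_sum fun e he => ?_
    induction e using Sym2.ind with
    | _ x y =>
      by_cases hxy : s(x, y) ∈ G.edgeSet
      · rw [Set.indicator_of_mem hxy]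
        have hadj : G.Adj x y := hxy
        have hx : x ∉ D := fun hx => he (Finset.mem_image.2 ⟨(x, y), by
          simp [hP, hDB hx, hD x hx y hadj, hadj], rfl⟩)
        have hy : y ∉ D := fun hy => he (Finset.mem_image.2 ⟨(x, y), by
          simp [hP, hDB hy, hD y hy x hadj.symm, hadj], rfl⟩)
        simp [absGrad, hf x hx, hf y hy]
      · exact Set.indicator_of_notMem hxy _
  have h2 : variation G B f = 1 / 2 * ∑ z ∈ P, absGrad f s(z.1, z.2) := by
    unfold variation
    rw [hP, Finset.sum_filter, Finset.sum_product]
    congr 1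
    refine Finset.sum_congr rfl fun x _ => Finset.sum_congr rfl fun y _ => ?_
    by_cases hxy : G.Adj x y <;> simp [conductance, absGrad, hxy, abs_sub_comm]
  rw [h1, h2, Finset.sum_comp (absGrad f) (fun z : V × V => s(z.1, z.2)), Finset.mul_sum]
  refine Finset.sum_le_sum fun e he => ?_
  obtain ⟨⟨x, y⟩, hz, rfl⟩ := Finset.mem_image.1 he
  obtain ⟨hzB, hadj⟩ := Finset.mem_filter.1 hz
  obtain ⟨hxB, hyB⟩ := Finset.mem_product.1 hzB
  simp only at hadj hxB hyB
  have hcard : 2 ≤ (P.filter fun z => s(z.1, z.2) = s(x, y)).card := by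
    rw [← Finset.card_pair (show (x, y) ≠ (y, x) from fun h => hadj.ne (Prod.ext_iff.1 h).1)]
    refine Finset.card_le_card fun z hz => ?_
    rcases Finset.mem_insert.1 hz with rfl | hz
    · simp [hP, hxB, hyB, hadj]
    · rw [Finset.mem_singleton.1 hz]
      simp [hP, hxB, hyB, hadj.symm]
  have hcard' : (2 : ℝ) ≤ (P.filter fun z => s(z.1, z.2) = s(x, y)).card := by exact_mod_cast hcard
  have h3 : G.edgeSet.indicator (absGrad f) s(x, y) ≤ absGrad f s(x, y) :=
    Set.indicator_le_self' (fun _ _ => hnn _) _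
  rw [nsmul_eq_mul]
  have := hnn s(x, y)
  simp only at hcard' h3 this ⊢
  nlinarith

theorem AbsolutelyContinuousOnInterval.congr {f g : ℝ → ℝ} {a b : ℝ}
    (hf : AbsolutelyContinuousOnInterval f a b) (h : EqOn f g (uIcc a b)) :
    AbsolutelyContinuousOnInterval g a b := by
  unfold AbsolutelyContinuousOnInterval at hf ⊢
  refine hf.congr' (Filter.eventually_inf_principal.2 (Filter.Eventually.of_forall fun E hE => ?_))
  exact Finset.sum_congr rfl fun i hi => by rw [h (hE.1 i hi).1, h (hE.1 i hi).2]

/-- A solution, frozen in time outside `[a, e]`. -/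
theorem SolvesHeat.isCaloric {G : SimpleGraph V} [G.LocallyFinite] {ω : ℝ → Sym2 V → ℝ}
    {a e : ℝ} {B D : Finset V} {u : ℝ → V → ℝ} (h : SolvesHeat G ω a e B u) (hω : IsWeight G ω)
    (hae : a ≤ e) (hDB : D ⊆ B) (hD : ∀ x ∈ D, ∀ y, G.Adj x y → y ∈ B)
    (hmu : ∀ x ∈ B, IntegrableOn (fun t => mu G (ω t) x) (Icc a e)) :
    IsCaloric B D (fun t => conductance G (ω t)) a e fun t x => u (max a (min e t)) x := by
  have hid : ∀ t ∈ Icc a e, max a (min e t) = t := fun t ht => by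
    rw [min_eq_right ht.2, max_eq_right ht.1]
  refine ⟨hDB, fun t => conductance_comm G _, fun t => conductance_nonneg (hω.pos t),
    fun x hx y hy => ?_, fun x hx => ?_, fun x hx => ?_, fun x hx => ?_⟩
  · refine (hmu x hx).mono' (hω.measurable_conductance x y).aestronglyMeasurable
      (Filter.Eventually.of_forall fun t => ?_)
    rw [Real.norm_of_nonneg (conductance_nonneg (hω.pos t) x y)]
    refine le_trans ?_ (conductance_le_mu (hω.pos t) B x)
    exact Finset.single_le_sum (f := fun y => conductance G (ω t) x y)
      (fun y _ => conductance_nonneg (hω.pos t) x y) hy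
  · have hc := (h x hx).1.continuousOn
    rw [uIcc_of_le hae] at hc
    exact hc.comp_continuous (by fun_prop) fun t => ⟨le_max_left _ _, max_le hae (min_le_left _ _)⟩
  · refine AbsolutelyContinuousOnInterval.congr (h x hx).1 fun t ht => ?_
    rw [uIcc_of_le hae] at ht
    simp only [hid t ht]
  · have h1 := (h x (hDB hx)).2
    rw [← Measure.restrict_congr_set Ioo_ae_eq_Icc] at h1 ⊢
    filter_upwards [h1, ae_restrict_mem measurableSet_Ioo] with t ht htI
    have e1 : generator G (ω t) (u t) x = ∑ y ∈ B, conductance G (ω t) x y *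
        (u (max a (min e t)) y - u (max a (min e t)) x) := by
      classical
      rw [hid t (Ioo_subset_Icc_self htI)]
      unfold generator conductance
      simp_rw [ite_mul, zero_mul]
      rw [← Finset.sum_filter]
      refine Finset.sum_congr ?_ fun _ _ => rfl
      ext y
      simp only [SimpleGraph.mem_neighborFinset, Finset.mem_filter]
      exact ⟨fun hxy => ⟨hD x hx y hxy, hxy⟩, fun hxy => hxy.2⟩
    rw [← e1]
    refine ht.congr_of_eventuallyEq ?_
    filter_upwards [Ioo_mem_nhds htI.1 htI.2] with r hr
    rw [hid r (Ioo_subset_Icc_self hr)]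

theorem exists_strictMono_majorant {ρ : ℕ → ℝ} (hρ : ∀ N, ρ N ∈ Ioo (0 : ℝ) 1) :
    ∃ γ : ℝ≥0 × ℝ≥0 → ℝ, Continuous γ ∧ (∀ z, γ z ∈ Ioo (0 : ℝ) 1) ∧
      (∀ b, StrictMono fun a => γ (a, b)) ∧ (∀ a, StrictMono fun b => γ (a, b)) ∧
      ∀ a b, 1 - ρ ⌈((a + b : ℝ≥0) : ℝ)⌉₊ ≤ γ (a, b) := by
  set σ : ℕ → ℝ := fun j => (Finset.range (j + 1)).inf' Finset.nonempty_range_add_one ρ with hσ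
  have hσ0 : ∀ j, 0 < σ j := fun j => (Finset.lt_inf'_iff _).2 fun i _ => (hρ i).1
  have hσρ : ∀ j, σ j ≤ ρ j := fun j => Finset.inf'_le _ (by simp)
  have hσanti : Antitone σ := fun i j hij =>
    Finset.inf'_mono _ (Finset.range_subset_range.2 (by omega)) _
  set τ : ℝ → ℝ := fun r => σ ⌈r⌉₊ with hτ
  have hτanti : Antitone τ := fun r s hrs => hσanti (Nat.ceil_mono hrs)
  have hint : ∀ a b, IntervalIntegrable τ volume a b := fun a b => hτanti.intervalIntegrable
  set I : ℝ → ℝ := fun s => ∫ x in s..(s + 1), τ x with hI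
  have hIle : ∀ s, I s ≤ τ s := fun s => by
    have h1 : I s ≤ ∫ _ in s..(s + 1), τ s :=
      intervalIntegral.integral_mono_on (by linarith) (hint _ _) intervalIntegrable_const
        fun x hx => hτanti hx.1
    simpa using h1
  have hIge : ∀ s, τ (s + 1) ≤ I s := fun s => by
    have h1 : ∫ _ in s..(s + 1), τ (s + 1) ≤ I s :=
      intervalIntegral.integral_mono_on (by linarith) intervalIntegrable_const (hint _ _)
        fun x hx => hτanti hx.2
    simpa using h1
  have hI0 : ∀ s, 0 < I s := fun s => (hσ0 _).trans_le (hIge s)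
  have hIanti : Antitone I := fun s t hst => by
    have e : ∀ s, I s = ∫ x in (0 : ℝ)..1, τ (x + s) := fun s => by
      rw [intervalIntegral.integral_comp_add_right, zero_add, add_comm 1 s]
    rw [e s, e t]
    have hm : ∀ s, Antitone fun x => τ (x + s) := fun s x y hxy => hτanti (by linarith)
    exact intervalIntegral.integral_mono_on zero_le_one (hm t).intervalIntegrable
      (hm s).intervalIntegrable fun x _ => hτanti (by linarith)
  have hIcont : Continuous I := by
    have e : I = fun s => (∫ x in (0 : ℝ)..(s + 1), τ x) - ∫ x in (0 : ℝ)..s, τ x := by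
      funext s
      rw [intervalIntegral.integral_interval_sub_left (hint _ _) (hint _ _)]
    have hc := intervalIntegral.continuous_primitive hint 0
    rw [e]
    exact (hc.comp (continuous_add_const 1)).sub hc
  set g : ℝ → ℝ := fun s => 1 - Real.exp (-s) * I s with hg
  have hgmono : StrictMono g := fun s t hst => by
    have h1 : Real.exp (-t) < Real.exp (-s) := Real.exp_lt_exp.2 (by linarith)
    have h2 : Real.exp (-t) * I t < Real.exp (-s) * I s :=
      mul_lt_mul h1 (hIanti hst.le) (hI0 t) (Real.exp_pos _).le
    simp only [hg]
    linarith
  have hle : ∀ s, 0 ≤ s → Real.exp (-s) * I s ≤ τ s := fun s hs =>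
    (mul_le_of_le_one_left (hI0 s).le (Real.exp_le_one_iff.2 (by linarith))).trans (hIle s)
  have hgcont : Continuous g := by fun_prop
  refine ⟨fun z => g ((z.1 + z.2 : ℝ≥0) : ℝ), by fun_prop, fun z => ⟨?_, ?_⟩, fun b a a' h => ?_,
    fun a b b' h => ?_, fun a b => ?_⟩
  · have h1 := hle ((z.1 + z.2 : ℝ≥0) : ℝ) (NNReal.coe_nonneg _)
    have h2 := (hσρ ⌈((z.1 + z.2 : ℝ≥0) : ℝ)⌉₊).trans_lt (hρ _).2
    simp only [hg, hτ] at h1 ⊢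
    linarith
  · have h1 := mul_pos (Real.exp_pos (-((z.1 + z.2 : ℝ≥0) : ℝ))) (hI0 ((z.1 + z.2 : ℝ≥0) : ℝ))
    simp only [hg]
    linarith
  · exact hgmono (NNReal.coe_lt_coe.2 (add_lt_add_left h b))
  · exact hgmono (NNReal.coe_lt_coe.2 (add_lt_add_right h a))
  · have h1 := hle ((a + b : ℝ≥0) : ℝ) (NNReal.coe_nonneg _)
    have h2 := hσρ ⌈((a + b : ℝ≥0) : ℝ)⌉₊
    simp only [hg, hτ] at h1 ⊢
    linarith

theorem measurable_mu {G : SimpleGraph V} [G.LocallyFinite] {ω : ℝ → Sym2 V → ℝ}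
    (hω : IsWeight G ω) (x : V) : Measurable fun t => mu G (ω t) x := by
  unfold mu
  refine Finset.measurable_fun_sum _ fun y hy => hω.meas _ ?_
  simpa using hy

theorem measurable_nu {G : SimpleGraph V} [G.LocallyFinite] {ω : ℝ → Sym2 V → ℝ}
    (hω : IsWeight G ω) (x : V) : Measurable fun t => nu G (ω t) x := by
  unfold nu
  refine Finset.measurable_fun_sum _ fun y hy => (hω.meas s(x, y) ?_).const_div 1
  simpa using hy

theorem mu_nonneg {G : SimpleGraph V} [G.LocallyFinite] {w : Sym2 V → ℝ}
    (hw : ∀ e ∈ G.edgeSet, 0 < w e) (x : V) : 0 ≤ mu G w x :=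
  Finset.sum_nonneg fun y hy => (hw s(x, y) (by simpa using hy)).le

theorem osc_mono {Q' Q : Set (ℝ × V)} (h : Q' ⊆ Q) (hne : Q'.Nonempty) {u : ℝ → V → ℝ}
    (hb : BddBelow ((fun z : ℝ × V => u z.1 z.2) '' Q))
    (ha : BddAbove ((fun z : ℝ × V => u z.1 z.2) '' Q)) : osc Q' u ≤ osc Q u :=
  sub_le_sub (csSup_le_csSup ha (hne.image _) (image_mono h))
    (csInf_le_csInf hb (hne.image _) (image_mono h))

/-- If `u`, rescaled to take values in `[0, 2]` on `Q`, is at least `ρ` away on `Q'` from one of the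
two end points, then its oscillation decreases from `Q` to `Q'`. -/
theorem osc_le_of_separated {Q' Q : Set (ℝ × V)} (h : Q' ⊆ Q) (hne : Q'.Nonempty)
    {u : ℝ → V → ℝ} (hb : BddBelow ((fun z : ℝ × V => u z.1 z.2) '' Q))
    (ha : BddAbove ((fun z : ℝ × V => u z.1 z.2) '' Q)) {ρ : ℝ}
    (H : ∀ m M, m < M → (∀ z ∈ Q, u z.1 z.2 ∈ Icc m M) →
      (∀ z ∈ Q', ρ ≤ 2 / (M - m) * u z.1 z.2 + -(2 / (M - m) * m)) ∨
      (∀ z ∈ Q', ρ ≤ -(2 / (M - m)) * u z.1 z.2 + 2 / (M - m) * M)) :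
    osc Q' u ≤ (1 - ρ / 2) * osc Q u := by
  have hmono := osc_mono h hne hb ha
  unfold osc at hmono ⊢
  set f := fun z : ℝ × V => u z.1 z.2 with hf
  set M := sSup (f '' Q) with hM
  set m := sInf (f '' Q) with hm
  have hQ : ∀ z ∈ Q, u z.1 z.2 ∈ Icc m M := fun z hz =>
    ⟨csInf_le hb (mem_image_of_mem f hz), le_csSup ha (mem_image_of_mem f hz)⟩
  have hne' := hne.image f
  obtain ⟨z₀, hz₀⟩ := hne
  rcases ((hQ z₀ (h hz₀)).1.trans (hQ z₀ (h hz₀)).2).eq_or_lt with e | hlt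
  · rw [e, sub_self] at hmono ⊢
    linarith
  have hd : 0 < M - m := sub_pos.2 hlt
  rcases H m M hlt hQ with H | H
  · have h1 : sSup (f '' Q') ≤ M := csSup_le_csSup ha hne' (image_mono h)
    have h2 : m + ρ / 2 * (M - m) ≤ sInf (f '' Q') := by
      refine le_csInf hne' ?_
      rintro _ ⟨z, hz, rfl⟩
      have h3 := H z hz
      have e : 2 / (M - m) * u z.1 z.2 + -(2 / (M - m) * m) = 2 * (u z.1 z.2 - m) / (M - m) := by
        ring
      rw [e, le_div_iff₀ hd] at h3
      simp only [hf]
      linarith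
    linarith
  · have h1 : m ≤ sInf (f '' Q') := csInf_le_csInf hb hne' (image_mono h)
    have h2 : sSup (f '' Q') ≤ M - ρ / 2 * (M - m) := by
      refine csSup_le hne' ?_
      rintro _ ⟨z, hz, rfl⟩
      have h3 := H z hz
      have e : -(2 / (M - m)) * u z.1 z.2 + 2 / (M - m) * M = 2 * (M - u z.1 z.2) / (M - m) := by
        ring
      rw [e, le_div_iff₀ hd] at h3
      simp only [hf]
      linarith
    linarith

theorem isCompact_image_prod {B : Finset V} {a e : ℝ} {u : ℝ → V → ℝ}
    (hu : ∀ x ∈ B, ContinuousOn (fun t => u t x) (Icc a e)) :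
    IsCompact ((fun z : ℝ × V => u z.1 z.2) '' (Icc a e ×ˢ (B : Set V))) := by
  have e1 : (fun z : ℝ × V => u z.1 z.2) '' (Icc a e ×ˢ (B : Set V)) =
      ⋃ x ∈ B, (fun t => u t x) '' Icc a e := by
    ext y
    simp only [mem_image, mem_prod, Prod.exists, mem_iUnion, exists_prop, Finset.mem_coe]
    constructor
    · rintro ⟨t, x, ⟨ht, hx⟩, rfl⟩
      exact ⟨x, hx, t, ht, rfl⟩
    · rintro ⟨x, hx, t, ht, rfl⟩
      exact ⟨t, x, ⟨ht, hx⟩, rfl⟩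
  rw [e1]
  exact B.isCompact_biUnion fun x hx => isCompact_Icc.image_of_continuousOn (hu x hx)

theorem SolvesHeat.osc_nonneg {G : SimpleGraph V} [G.LocallyFinite] {ω : ℝ → Sym2 V → ℝ}
    {a e : ℝ} {B : Finset V} {u : ℝ → V → ℝ} (h : SolvesHeat G ω a e B u) (hae : a ≤ e) :
    0 ≤ osc (Icc a e ×ˢ (B : Set V)) u := by
  have hcomp := isCompact_image_prod fun x hx => by
    have hc := (h x hx).1.continuousOn
    rwa [uIcc_of_le hae] at hc
  exact sub_nonneg.2 (Real.sInf_le_sSup _ hcomp.bddBelow hcomp.bddAbove)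

/-- The lower bounds at radius `n` yield the decay of the oscillation of `u`. -/
theorem IsCaloric.osc_le {B D : Finset V} {c : ℝ → V → V → ℝ} {a e : ℝ} {v : ℝ → V → ℝ}
    (hv : IsCaloric B D c a e v) {u : ℝ → V → ℝ}
    (huv : ∀ t ∈ Icc a e, ∀ x, v t x = u t x) {η : V → ℝ} {Q' : Set (ℝ × V)}
    (hQ' : Q' ⊆ Icc a e ×ˢ (B : Set V)) (hne : Q'.Nonempty) {ρ : ℝ}
    (H : ∀ w : ℝ → V → ℝ, IsCaloric B D c a e w → (∀ t ∈ Icc a e, ∀ x ∈ B, 0 ≤ w t x) →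
      (∀ t ∈ Icc a e, ∀ x ∈ B, w t x ≤ 2) →
      (∑ x ∈ B with w a x < 1, η x ^ 2 ≤ 1 / 2 * ∑ x ∈ B, η x ^ 2) →
      ∀ z ∈ Q', ρ ≤ w z.1 z.2) :
    osc Q' u ≤ (1 - ρ / 2) * osc (Icc a e ×ˢ (B : Set V)) u := by
  classical
  have hcomp := isCompact_image_prod fun x hx => (hv.cont x hx).continuousOn.congr
    fun t (ht : t ∈ Icc a e) => (huv t ht x).symm
  refine osc_le_of_separated hQ' hne hcomp.bddBelow hcomp.bddAbove fun m M hmM hQ => ?_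
  have hd : 0 < M - m := sub_pos.2 hmM
  have hvQ : ∀ t ∈ Icc a e, ∀ x ∈ B, v t x ∈ Icc m M := fun t ht x hx => by
    rw [huv t ht x]
    exact hQ (t, x) ⟨ht, hx⟩
  have e₁ : ∀ y, 2 / (M - m) * y + -(2 / (M - m) * m) = 2 * (y - m) / (M - m) := fun y => by ring
  have e₂ : ∀ y, -(2 / (M - m)) * y + 2 / (M - m) * M = 2 * (M - y) / (M - m) := fun y => by ring
  have hB₁ := H _ (hv.affine (2 / (M - m)) (-(2 / (M - m) * m)))
    (fun t ht x hx => by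
      rw [e₁]; exact div_nonneg (by linarith [(hvQ t ht x hx).1]) hd.le)
    (fun t ht x hx => by rw [e₁, div_le_iff₀ hd]; linarith [(hvQ t ht x hx).2])
  have hB₂ := H _ (hv.affine (-(2 / (M - m))) (2 / (M - m) * M))
    (fun t ht x hx => by
      rw [e₂]; exact div_nonneg (by linarith [(hvQ t ht x hx).2]) hd.le)
    (fun t ht x hx => by rw [e₂, div_le_iff₀ hd]; linarith [(hvQ t ht x hx).1])
  have hsum : ∑ x ∈ B with 2 / (M - m) * v a x + -(2 / (M - m) * m) < 1, η x ^ 2 +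
      ∑ x ∈ B with -(2 / (M - m)) * v a x + 2 / (M - m) * M < 1, η x ^ 2 ≤ ∑ x ∈ B, η x ^ 2 := by
    rw [← Finset.sum_union]
    · exact Finset.sum_le_sum_of_subset_of_nonneg
        (Finset.union_subset (Finset.filter_subset _ _) (Finset.filter_subset _ _))
        fun _ _ _ => sq_nonneg _
    · refine Finset.disjoint_filter.2 fun x _ h1 h2 => ?_
      rw [e₁, div_lt_iff₀ hd] at h1
      rw [e₂, div_lt_iff₀ hd] at h2
      linarith
  rcases le_or_gt (∑ x ∈ B with 2 / (M - m) * v a x + -(2 / (M - m) * m) < 1, η x ^ 2)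
    (1 / 2 * ∑ x ∈ B, η x ^ 2) with hc | hc
  · left
    intro z hz
    rw [← huv z.1 (hQ' hz).1]
    exact hB₁ hc z hz
  · right
    intro z hz
    rw [← huv z.1 (hQ' hz).1]
    exact hB₂ (by linarith) z hz

theorem RegularGraph.one_le_N₁ {G : SimpleGraph V} [G.LocallyFinite]
    {d d' creg Creg CS CP CW : ℝ} {N₁ N₂ N₃ : V → ℕ}
    (hR : RegularGraph G d d' creg Creg CS CP CW N₁ N₂ N₃) (hG : G.Connected) (hd : 2 ≤ d)
    (x : V) : 1 ≤ N₁ x := by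
  by_contra h
  have h0 := (hR.volume_reg x 0 (by omega)).2
  rw [Nat.cast_zero, Real.zero_rpow (by linarith), mul_zero] at h0
  have h1 : x ∈ ball G x 0 := (mem_ball hG).2 (by simp)
  have h2 := Finset.card_pos.2 ⟨x, h1⟩
  have h3 : (0 : ℝ) < (ball G x 0).card := by exact_mod_cast h2
  linarith

/-- The radii at which the assumptions on the graph are used in the ball of radius `n`. -/
structure RadiusBounds (n CW : ℝ) (N K : ℕ) : Prop where
  n_pos : 0 < n
  N_le_floor : N ≤ ⌊n⌋₊
  N_le : N ≤ K
  N_le_half : N ≤ K / 2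
  le_half : n / (32 * CW) ≤ (K / 2 : ℕ)
  le : n / (8 * CW) ≤ K
  le' : CW * K ≤ n / 4
  K_le : (K : ℝ) ≤ n / 4
  two_le : 2 ≤ n

theorem exists_radiusBounds {n CW d : ℝ} {N : ℕ} (hCW : 1 ≤ CW) (hd : 2 ≤ d) (hN : 1 ≤ N)
    (hn : 2 ^ (8 * d) * CW * (N : ℝ) ≤ n) : RadiusBounds n CW N ⌊n / (4 * CW)⌋₊ := by
  have hN' : (1 : ℝ) ≤ N := by exact_mod_cast hN
  have h2 : (65536 : ℝ) ≤ 2 ^ (8 * d) := by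
    have h := Real.rpow_le_rpow_of_exponent_le (one_le_two (α := ℝ))
      (show ((16 : ℕ) : ℝ) ≤ 8 * d by push_cast; linarith)
    rw [Real.rpow_natCast] at h
    norm_num at h
    exact h
  have h3 : 65536 * (CW * N) ≤ n := by
    refine le_trans ?_ hn
    rw [mul_assoc]
    gcongr
  have hCN : (N : ℝ) ≤ CW * N := le_mul_of_one_le_left (by linarith) hCW
  have hCC : CW ≤ CW * N := le_mul_of_one_le_right (by linarith) hN'
  have hCW0 : 0 < CW := by linarith
  set K := ⌊n / (4 * CW)⌋₊ with hK
  have hn0 : 0 < n := by linarith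
  have hK1 : (K : ℝ) ≤ n / (4 * CW) := Nat.floor_le (by positivity)
  have hK2 : n / (4 * CW) < K + 1 := Nat.lt_floor_add_one _
  have hx : 16384 * (N : ℝ) ≤ n / (4 * CW) := by
    rw [le_div_iff₀ (by positivity)]; linarith
  have hhalf : (K : ℝ) ≤ 2 * (K / 2 : ℕ) + 1 := by
    have : K ≤ 2 * (K / 2) + 1 := by omega
    exact_mod_cast this
  have e1 : n / (8 * CW) = n / (4 * CW) / 2 := by field_simp; norm_num
  have e2 : n / (32 * CW) = n / (4 * CW) / 8 := by field_simp; norm_num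
  have hCK : CW * K ≤ n / 4 := by
    rw [le_div_iff₀ (by positivity)] at hK1
    linarith
  have hNh : (N : ℝ) ≤ (K / 2 : ℕ) := by linarith
  have hNh' : N ≤ K / 2 := by exact_mod_cast hNh
  refine ⟨hn0, Nat.le_floor (by linarith), hNh'.trans (Nat.div_le_self _ _), hNh', ?_, ?_, hCK,
    (le_mul_of_one_le_left K.cast_nonneg hCW).trans hCK, by linarith⟩
  · rw [e2]; linarith
  · rw [e1]; linarith

theorem RegularGraph.card_ball_le {G : SimpleGraph V} [G.LocallyFinite]
    {d d' creg Creg CS CP CW : ℝ} {N₁ N₂ N₃ : V → ℕ}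
    (hR : RegularGraph G d d' creg Creg CS CP CW N₁ N₂ N₃) (hd : 2 ≤ d) (hcreg : 0 < creg)
    (hCreg : 0 < Creg) (hCW : 1 ≤ CW) {x₀ : V} {n : ℝ} {N K : ℕ} (hb : RadiusBounds n CW N K)
    (hN : N₁ x₀ ≤ N) :
    creg / (Creg * (32 * CW) ^ d) * (ball G x₀ n).card ≤ (ball G x₀ (K / 2 : ℕ)).card := by
  have hn := hb.n_pos
  have hCW0 : 0 < CW := by linarith
  have h1 : ((ball G x₀ n).card : ℝ) ≤ Creg * n ^ d := by
    have h := (hR.volume_reg x₀ ⌊n⌋₊ (hN.trans hb.N_le_floor)).2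
    have e : ball G x₀ (⌊n⌋₊ : ℝ) = ball G x₀ n := by
      unfold ball; simp only [Nat.floor_natCast]
    rw [e] at h
    refine h.trans ?_
    gcongr
    exact Nat.floor_le hn.le
  have h2 := (hR.volume_reg x₀ (K / 2) (hN.trans hb.N_le_half)).1
  have h3 : (n / (32 * CW)) ^ d ≤ ((K / 2 : ℕ) : ℝ) ^ d :=
    Real.rpow_le_rpow (by positivity) hb.le_half (by linarith)
  rw [Real.div_rpow hn.le (by positivity)] at h3
  calc creg / (Creg * (32 * CW) ^ d) * (ball G x₀ n).card
      ≤ creg / (Creg * (32 * CW) ^ d) * (Creg * n ^ d) := by gcongr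
    _ = creg * (n ^ d / (32 * CW) ^ d) := by
        have : 0 < (32 * CW) ^ d := by positivity
        field_simp
    _ ≤ creg * ((K / 2 : ℕ) : ℝ) ^ d := by gcongr
    _ ≤ _ := h2

theorem card_ball_half_le_sum_cutoff_sq {G : SimpleGraph V} [G.LocallyFinite] (hG : G.Connected)
    {x₀ : V} {K : ℕ} (hK : 0 < K) {B : Finset V} (hB : ball G x₀ K ⊆ B) :
    ((ball G x₀ (K / 2 : ℕ)).card : ℝ) ≤ ∑ x ∈ B, cutoff G x₀ K (K / 2) x ^ 2 := by
  have hK' : (0 : ℝ) < K := by exact_mod_cast hK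
  have hhalf : ((K / 2 : ℕ) : ℝ) ≤ (K : ℝ) / 2 := Nat.cast_div_le
  have hsub : ball G x₀ (K / 2 : ℕ) ⊆ B := fun x hx => hB <| by
    rw [mem_ball_iff_le hG (by positivity)] at hx ⊢
    linarith
  refine le_trans ?_ (Finset.sum_le_sum_of_subset_of_nonneg hsub fun _ _ _ => sq_nonneg _)
  rw [Finset.cast_card]
  refine (Finset.sum_congr rfl fun x hx => ?_).le
  rw [mem_ball_iff_le hG (by positivity)] at hx
  rw [cutoff_eq_one (by linarith) (hx.trans hhalf), one_pow]

/-- The vertices at distance less than `⌊r⌋` from `x`. -/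
noncomputable def innerBall (G : SimpleGraph V) [G.LocallyFinite] (x : V) (r : ℝ) : Finset V :=
  (ball G x r).filter fun y => G.dist x y + 1 ≤ ⌊r⌋₊

theorem mem_innerBall {G : SimpleGraph V} [G.LocallyFinite] (hG : G.Connected) {x y : V} {r : ℝ} :
    y ∈ innerBall G x r ↔ G.dist x y + 1 ≤ ⌊r⌋₊ := by
  unfold innerBall
  rw [Finset.mem_filter, mem_ball hG]
  omega

theorem mem_ball_of_mem_innerBall {G : SimpleGraph V} [G.LocallyFinite] (hG : G.Connected)
    {x y z : V} {r : ℝ} (hy : y ∈ innerBall G x r) (h : G.Adj y z) : z ∈ ball G x r := by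
  rw [mem_innerBall hG] at hy
  rw [mem_ball hG]
  have h1 := hG.dist_triangle (u := x) (v := y) (w := z)
  rw [SimpleGraph.dist_eq_one_iff_adj.2 h] at h1
  omega

theorem RegularGraph.lpMean_le {G : SimpleGraph V} [G.LocallyFinite]
    {d d' creg Creg CS CP CW : ℝ} {N₁ N₂ N₃ : V → ℕ}
    (hR : RegularGraph G d d' creg Creg CS CP CW N₁ N₂ N₃) (hG : G.Connected) (hd' : 1 < d')
    (hCS : 0 ≤ CS) {x₀ : V} {K : ℕ} (hK : N₂ x₀ ≤ K) {B D : Finset V} (hDB : D ⊆ B)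
    (hD : ∀ x ∈ D, ∀ y, G.Adj x y → y ∈ B) (hB : ball G x₀ K ⊆ B)
    (hnear : ∀ x, (G.dist x₀ x : ℝ) < K → x ∈ D) {c₀ : ℝ} (hc₀ : 0 < c₀)
    (hvol : c₀ * B.card ≤ (ball G x₀ K).card) {f : V → ℝ} (hf : ∀ x, 0 ≤ f x)
    (hfK : ∀ x, (K : ℝ) ≤ G.dist x₀ x → f x = 0) :
    lpMean (d' / (d' - 1)) B f ≤ CS / c₀ * K / B.card * variation G B f := by
  have hds : 0 < d' / (d' - 1) := div_pos (by linarith) (by linarith)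
  have hout : ∀ y ∉ ball G x₀ K, f y = 0 := fun y hy => hfK y <| by
    rw [mem_ball_iff_le hG (by positivity), not_le] at hy
    exact hy.le
  have h0K : (0 : ℝ) < (ball G x₀ K).card := by
    exact_mod_cast Finset.card_pos.2 ⟨x₀, (mem_ball hG).2 (by simp)⟩
  have h0B : (0 : ℝ) < B.card :=
    h0K.trans_le (by exact_mod_cast Finset.card_le_card hB)
  have h1 := hR.sobolev x₀ K hK f hout
  rw [spaceNorm, if_neg ENNReal.ofReal_ne_top, ENNReal.toReal_ofReal hds.le] at h1
  simp only [abs_of_nonneg (hf _)] at h1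
  have hsum : ∑ x ∈ B, f x ^ (d' / (d' - 1)) = ∑ x ∈ ball G x₀ K, f x ^ (d' / (d' - 1)) :=
    (Finset.sum_subset hB fun x _ hx => by rw [hout x hx, Real.zero_rpow hds.ne']).symm
  have hS : 0 ≤ ∑ x ∈ ball G x₀ K, f x ^ (d' / (d' - 1)) :=
    Finset.sum_nonneg fun x _ => Real.rpow_nonneg (hf x) _
  have hvar := tsum_absGrad_le_variation hDB hD fun x hx => hfK x <| by
    by_contra h
    exact hx (hnear x (not_le.1 h))
  have hvar0 : 0 ≤ ∑' e : G.edgeSet, absGrad f e :=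
    tsum_nonneg fun e => Sym2.ind (fun x y => abs_nonneg (f x - f y)) e.1
  calc lpMean (d' / (d' - 1)) B f
      ≤ (1 / ((ball G x₀ K).card : ℝ) * ∑ x ∈ ball G x₀ K, f x ^ (d' / (d' - 1))) ^
          (1 / (d' / (d' - 1))) := by
        unfold lpMean
        rw [hsum]
        gcongr
    _ ≤ CS * ((K : ℝ) / (ball G x₀ K).card) * ∑' e : G.edgeSet, absGrad f e := h1
    _ ≤ CS * ((K : ℝ) / (c₀ * B.card)) * variation G B f := by gcongr
    _ = CS / c₀ * K / B.card * variation G B f := by field_simp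

theorem RegularGraph.poincare_conductance {G : SimpleGraph V} [G.LocallyFinite]
    {d d' creg Creg CS CP CW : ℝ} {N₁ N₂ N₃ : V → ℕ}
    (hR : RegularGraph G d d' creg Creg CS CP CW N₁ N₂ N₃) {x : V} {K : ℕ} (hK : N₃ x ≤ K)
    (f : V → ℝ) (N : Finset V) (hN : N.Nonempty) (hNK : N ⊆ ball G x K) :
    ∑ y ∈ ball G x K, |f y - average N f| ≤
      CP * K * (1 + ((ball G x K).card : ℝ) / N.card) *
        ∑ y ∈ ball G x (CW * K), ∑ z ∈ ball G x (CW * K),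
          conductance G (fun _ => 1) y z * |f z - f y| := by
  classical
  refine (hR.poincare x K hK f N hN hNK).trans_eq ?_
  congr 1
  refine Finset.sum_congr rfl fun y _ => ?_
  rw [Finset.sum_filter]
  refine Finset.sum_congr rfl fun z _ => ?_
  unfold conductance
  by_cases h : G.Adj y z <;> simp [h, abs_sub_comm]

/-- The oscillation inequality, with a constant that is uniform for bounded norms of the weights. -/
theorem exists_osc_le (d d' creg Creg CS CP CW : ℝ) (hd : 2 ≤ d) (hd' : d ≤ d')
    (hcreg : 0 < creg) (hCreg : 0 < Creg) (hCS : 0 < CS) (hCP : 0 < CP) (hCW : 1 ≤ CW)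
    (p p' q q' : ℝ≥0∞) (hp : 1 ≤ p) (hp' : 1 < p') (hq : 1 ≤ q) (hq' : 1 ≤ q')
    (hpq : p⁻¹ * (1 - p'⁻¹)⁻¹ * (1 + q'⁻¹) + q⁻¹ < ENNReal.ofReal (2 / d')) {A : ℝ} (hA : 0 < A) :
    ∃ ρ ∈ Ioo (0 : ℝ) 1, ∀ (V : Type*) (G : SimpleGraph V) [G.LocallyFinite] (_ : G.Connected)
      (N₁ N₂ N₃ : V → ℕ) (_ : RegularGraph G d d' creg Creg CS CP CW N₁ N₂ N₃)
      (ω : ℝ → Sym2 V → ℝ) (_ : IsWeight G ω) (t₀ : ℝ) (x₀ : V) (n : ℝ)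
      (_ : 2 ^ (8 * d) * CW * ((max (N₁ x₀) (max (N₂ x₀) (N₃ x₀)) : ℕ) : ℝ) ≤ n)
      (u : ℝ → V → ℝ) (_ : SolvesHeat G ω (t₀ - n ^ 2) t₀ (ball G x₀ n) u)
      (_ : muNorm G ω p p' t₀ x₀ n ≤ ENNReal.ofReal A)
      (_ : nuNorm G ω q q' t₀ x₀ n ≤ ENNReal.ofReal A),
      osc (cylinder G t₀ x₀ (1 / (16 * CW) * n)) u ≤ (1 - ρ / 2) * osc (cylinder G t₀ x₀ n) u := by
  have hd2 : 2 ≤ d' := hd.trans hd'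
  have hCW0 : 0 < CW := by linarith
  obtain ⟨r, r', s, s', hr, hr', hs, hs', hr1, hr'1, hs1, hs'1, hrs⟩ :=
    exists_finite_exponents hd2 hp hp' hq hq' hpq
  obtain ⟨β, θ, τ, σ, m, E⟩ := exists_exponents hd2 hr1 hr'1 hs1 hs'1 hrs
  set c₀ := creg / (Creg * (32 * CW) ^ d) with hc₀
  have hc₀0 : 0 < c₀ := by positivity
  obtain ⟨ρ, hρ, H⟩ := exists_lower_bound (A := A) (K₁ := 64 * CW ^ 2) (Ks := CS / c₀) (c₀ := c₀)
    (K₂ := 4) (CP := CP) E (by positivity) hA hc₀0 (by norm_num) hCP.le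
  refine ⟨ρ, hρ, fun V G _ hG N₁ N₂ N₃ hR ω hω t₀ x₀ n hn u hu hmu hnu => ?_⟩
  have hN1 : 1 ≤ max (N₁ x₀) (max (N₂ x₀) (N₃ x₀)) :=
    (hR.one_le_N₁ hG hd x₀).trans (le_max_left _ _)
  have hb := exists_radiusBounds hCW hd hN1 hn
  set K := ⌊n / (4 * CW)⌋₊ with hK
  have hn0 := hb.n_pos
  have hn2 := hb.two_le
  have hKn := hb.K_le
  have hK0 : 0 < K := (hN1.trans hb.N_le)
  have hK0' : (0 : ℝ) < K := by exact_mod_cast hK0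
  have hK8 : n ≤ 8 * CW * K := by
    have := hb.le
    rw [div_le_iff₀ (by positivity)] at this
    linarith
  set B := ball G x₀ n with hB
  set D := innerBall G x₀ n with hDdef
  have hDB : D ⊆ B := Finset.filter_subset _ _
  have hD : ∀ x ∈ D, ∀ y, G.Adj x y → y ∈ B := fun x hx y hxy => mem_ball_of_mem_innerBall hG hx hxy
  have hballB : ∀ r : ℝ, 0 ≤ r → r ≤ n → ball G x₀ r ⊆ B := fun r h0 hr x hx => by
    rw [mem_ball_iff_le hG h0] at hx
    rw [hB, mem_ball_iff_le hG hn0.le]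
    exact hx.trans hr
  have hBk : ball G x₀ K ⊆ B := hballB K hK0'.le (by linarith)
  have hx₀B : x₀ ∈ B := (mem_ball hG).2 (by simp)
  have hBne : B.Nonempty := ⟨x₀, hx₀B⟩
  have hnearR : ∀ x, (G.dist x₀ x : ℝ) < n / 2 → x ∈ D := fun x hx => by
    rw [hDdef, mem_innerBall hG, Nat.le_floor_iff hn0.le]
    push_cast
    linarith
  have hnear : ∀ x, (G.dist x₀ x : ℝ) < K → x ∈ D := fun x hx => hnearR x (by linarith)
  have hsq : t₀ - n ^ 2 + n ^ 2 = t₀ := sub_add_cancel _ _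
  have hae : t₀ - n ^ 2 < t₀ := by linarith [pow_pos hn0 2]
  have hvol : c₀ * B.card ≤ (ball G x₀ (K / 2 : ℕ)).card :=
    hR.card_ball_le hd hcreg hCreg hCW hb (le_max_left _ _)
  have hcut := card_ball_half_le_sum_cutoff_sq hG hK0 hBk
  have hhalf : ((K / 2 : ℕ) : ℝ) ≤ K := by exact_mod_cast Nat.div_le_self K 2
  have hvolK : c₀ * B.card ≤ (ball G x₀ K).card := by
    refine hvol.trans ?_
    refine Nat.cast_le.2 (Finset.card_le_card fun x hx => ?_)
    rw [mem_ball_iff_le hG (by positivity)] at hx ⊢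
    exact hx.trans hhalf
  have hMu : MixedBound r r' B (t₀ - n ^ 2) t₀ (fun t x => max 1 (mu G (ω t) x)) A :=
    mixedBound_of_spaceTimeNorm_le hr1 hr'1.le hr hr' hBne hae hA.le
      (fun t x => zero_le_one.trans (le_max_left _ _))
      (fun x _ => measurable_const.max (measurable_mu hω x)) hmu
  have hNu : MixedBound s s' B (t₀ - n ^ 2) t₀ (fun t x => max 1 (nu G (ω t) x)) A :=
    mixedBound_of_spaceTimeNorm_le hs1 hs'1 hs hs' hBne hae hA.le
      (fun t x => zero_le_one.trans (le_max_left _ _))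
      (fun x _ => measurable_const.max (measurable_nu hω x)) hnu
  have F : Frame G ω x₀ B D K (t₀ - n ^ 2) (n ^ 2) r r' s s' (d' / (d' - 1)) A (64 * CW ^ 2)
      (CS / c₀) := by
    refine ⟨hG, hω, hK0', by gcongr; linarith, ?_, hA.le, hBne, hnear, hDB, by rwa [hsq],
      by rwa [hsq], fun f hf hfK => hR.lpMean_le hG (by linarith) hCS.le ?_ hDB hD hBk hnear hc₀0
        hvolK hf hfK⟩
    · calc n ^ 2 ≤ (8 * CW * K) ^ 2 := by gcongr
        _ = 64 * CW ^ 2 * (K : ℝ) ^ 2 := by ring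
    · exact ((le_max_left _ _).trans (le_max_right _ _)).trans hb.N_le
  have hmuint : ∀ x ∈ B, IntegrableOn (fun t => mu G (ω t) x) (Icc (t₀ - n ^ 2) t₀) := by
    intro x hx
    have h1 := ((hMu.integral_mean_le hr1 hr'1.le hBne hA hae.le).1).const_mul (B.card : ℝ)
    refine h1.mono' (measurable_mu hω x).aestronglyMeasurable
      (Filter.Eventually.of_forall fun t => ?_)
    have hb0 : (B.card : ℝ) ≠ 0 := by exact_mod_cast hBne.card_pos.ne'
    have h2 : (B.card : ℝ) * (1 / (B.card : ℝ) * ∑ x ∈ B, max 1 (mu G (ω t) x)) =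
        ∑ x ∈ B, max 1 (mu G (ω t) x) := by field_simp
    rw [h2, Real.norm_of_nonneg (mu_nonneg (hω.pos t) x)]
    exact (le_max_right 1 _).trans (Finset.single_le_sum (f := fun x => max 1 (mu G (ω t) x))
      (fun x _ => zero_le_one.trans (le_max_left _ _)) hx)
  have hcal := hu.isCaloric hω hae.le hDB hD hmuint
  have hϑ : 1 / (16 * CW) * n ≤ K / 2 := by
    rw [one_div_mul_eq_div, div_le_iff₀ (by positivity)]
    linarith
  have hϑ0 : 0 ≤ 1 / (16 * CW) * n := by positivity
  have hϑsq : (1 / (16 * CW) * n) ^ 2 ≤ n ^ 2 / 2 := by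
    have : 1 / (16 * CW) * n ≤ n / 2 := by linarith
    nlinarith
  have hcyl : cylinder G t₀ x₀ (1 / (16 * CW) * n) ⊆ Icc (t₀ - n ^ 2) t₀ ×ˢ (B : Set V) := by
    rintro ⟨t, x⟩ ⟨ht, hx⟩
    exact ⟨⟨by linarith [ht.1, sq_nonneg n], ht.2⟩, hballB _ hϑ0 (by linarith) hx⟩
  refine hcal.osc_le (fun t ht x => by rw [min_eq_right ht.2, max_eq_right ht.1]) hcyl
    ⟨(t₀, x₀), ⟨by linarith [sq_nonneg (1 / (16 * CW) * n)], le_rfl⟩, (mem_ball hG).2 (by simp)⟩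
    (η := cutoff G x₀ K (K / 2)) fun w hw h0 h2 hstart => ?_
  have H' := H V G ω x₀ B D K (t₀ - n ^ 2) (n ^ 2) F (hvol.trans hcut) (ball G x₀ K)
    (ball G x₀ (CW * K)) hBk (hballB _ (by positivity) (by linarith [hb.le']))
    (fun x _ hx => (mem_ball_iff_le hG (by positivity)).2 hx.le) (n / 2) (by positivity) hnearR
    (by nlinarith) (fun x hx => ?_)
    (hR.poincare_conductance
      (((le_max_right _ _).trans (le_max_right _ _)).trans hb.N_le)) w (by rwa [hsq])
    (by rwa [hsq]) (by rwa [hsq]) hstart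
  · rw [hsq] at H'
    rintro ⟨t, x⟩ ⟨ht, hx⟩
    refine H' t ⟨by linarith [ht.1], ht.2⟩ x ?_
    exact ((mem_ball_iff_le hG hϑ0).1 hx).trans hϑ
  · rw [mem_ball_iff_le hG (by positivity)] at hx
    linarith [hb.le']

end DeGiorgiGraph

theorem theorem2p3
    (d d' creg Creg CS CP CW : ℝ) (hd : 2 ≤ d) (hd' : d ≤ d')
    (hcreg : 0 < creg) (hCreg : 0 < Creg) (hCS : 0 < CS) (hCP : 0 < CP) (hCW : 1 ≤ CW)
    (p p' q q' : ℝ≥0∞) (hp : 1 ≤ p) (hp' : 1 < p') (hq : 1 ≤ q) (hq' : 1 ≤ q')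
    (hpq : p⁻¹ * (1 - p'⁻¹)⁻¹ * (1 + q'⁻¹) + q⁻¹ < ENNReal.ofReal (2 / d')) :
    ∃ ϑ ∈ Ioo (0 : ℝ) (1 / 2), ∃ γ : ℝ≥0 × ℝ≥0 → ℝ,
      Continuous γ ∧ (∀ z, γ z ∈ Ioo (0 : ℝ) 1) ∧
      (∀ b, StrictMono fun a => γ (a, b)) ∧ (∀ a, StrictMono fun b => γ (a, b)) ∧
      ∀ (V : Type*) [Infinite V] (G : SimpleGraph V) [G.LocallyFinite] (_ : G.Connected)
        (N₁ N₂ N₃ : V → ℕ)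
        (_ : DeGiorgiGraph.RegularGraph G d d' creg Creg CS CP CW N₁ N₂ N₃)
        (ω : ℝ → Sym2 V → ℝ) (_ : DeGiorgiGraph.IsWeight G ω)
        (t₀ : ℝ) (x₀ : V) (n : ℝ)
        (_ : 2 ^ (8 * d) * CW * ((max (N₁ x₀) (max (N₂ x₀) (N₃ x₀)) : ℕ) : ℝ) ≤ n)
        (u : ℝ → V → ℝ)
        (_ : ∀ t ∈ Icc (t₀ - n ^ 2) t₀, ∀ x ∈ DeGiorgiGraph.ball G x₀ n, 0 < u t x)
        (_ : DeGiorgiGraph.SolvesHeat G ω (t₀ - n ^ 2) t₀ (DeGiorgiGraph.ball G x₀ n) u)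
        (_ : DeGiorgiGraph.muNorm G ω p p' t₀ x₀ n < ∞)
        (_ : DeGiorgiGraph.nuNorm G ω q q' t₀ x₀ n < ∞),
        DeGiorgiGraph.osc (DeGiorgiGraph.cylinder G t₀ x₀ (ϑ * n)) u ≤
          γ ((DeGiorgiGraph.muNorm G ω p p' t₀ x₀ n).toNNReal,
              (DeGiorgiGraph.nuNorm G ω q q' t₀ x₀ n).toNNReal) *
            DeGiorgiGraph.osc (DeGiorgiGraph.cylinder G t₀ x₀ n) u := by
  choose ρ hρ H using fun N : ℕ => DeGiorgiGraph.exists_osc_le d d' creg Creg CS CP CW hd hd'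
    hcreg hCreg hCS hCP hCW p p' q q' hp hp' hq hq' hpq (A := N + 1) (by positivity)
  obtain ⟨γ, hcont, hγ, hmono₁, hmono₂, hle⟩ := DeGiorgiGraph.exists_strictMono_majorant
    (ρ := fun N => ρ N / 2) fun N => ⟨half_pos (hρ N).1, (half_lt_self (hρ N).1).trans (hρ N).2⟩
  refine ⟨1 / (16 * CW), ⟨by positivity, ?_⟩, γ, hcont, hγ, hmono₁, hmono₂, ?_⟩
  · rw [div_lt_div_iff₀ (by positivity) (by norm_num)]
    linarith
  intro V _ G _ hG N₁ N₂ N₃ hR ω hω t₀ x₀ n hn u hpos hu hmu hnu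
  set a := (DeGiorgiGraph.muNorm G ω p p' t₀ x₀ n).toNNReal with ha
  set b := (DeGiorgiGraph.nuNorm G ω q q' t₀ x₀ n).toNNReal with hb
  have hceil : ((a + b : ℝ≥0) : ℝ) ≤ ⌈((a + b : ℝ≥0) : ℝ)⌉₊ := Nat.le_ceil _
  rw [NNReal.coe_add] at hceil
  have hmain := H ⌈((a + b : ℝ≥0) : ℝ)⌉₊ V G hG N₁ N₂ N₃ hR ω hω t₀ x₀ n hn u hu ?_ ?_
  · exact hmain.trans (mul_le_mul_of_nonneg_right (hle a b)
      (hu.osc_nonneg (by linarith [sq_nonneg n])))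
  · rw [← ENNReal.coe_toNNReal hmu.ne, ← ENNReal.ofReal_coe_nnreal]
    refine ENNReal.ofReal_le_ofReal ?_
    rw [NNReal.coe_add]
    linarith [NNReal.coe_nonneg b]
  · rw [← ENNReal.coe_toNNReal hnu.ne, ← ENNReal.ofReal_coe_nnreal]
    refine ENNReal.ofReal_le_ofReal ?_
    rw [NNReal.coe_add]
    linarith [NNReal.coe_nonneg a]
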